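/- Let $K$ be a henselian discrete valuation field with ring of integers ${\cal O}_K$ and residue field $F$ of characteristic $p>0$ ($F$ need not be perfect). Let $L/K$ be a finite Galois extension that is totally ramified: the ramification index $e$ equals $[L:K]$, so the residue field $E$ of $L$ is $F$. Let $G={\rm Gal}(L/K)$, let $\alpha$ be a uniformizer of $L$ and let $f\in{\cal O}_K[X]$ be its minimal polynomial. *Ramification groups.* For integers $j\ge 0$ put $G_{j,\rm cl}={\rm Ker}(G\to{\rm Aut}({\cal O}_L/\mathfrak m_L^{j+1}))$, and $G_{t,\rm cl}=G_{\lceil t\rceil,\rm cl}$ for real $t\ge0$. Let $\psi$ be the inverse of $\varphi(u)=\int_0^u dt/(G_{0,\rm cl}:G_{t,\rm cl})$, $u\ge 0$, and for rational $s>1$ put $G^s=G^{s-1}_{\rm cl}=G_{\psi(s-1),\rm cl}$. Let $r>1$ be the largest rational number with $G^r\ne1$, and let $i>0$ be the largest integer with $G_{i,\rm cl}\neq1$. *The geometric sequence.* When $er\in{\bf Z}$, let $Q^{[r]}_T={\rm Spec}\,{\cal O}_L[X][f/\alpha^{er}]$, let $Q^{(r)}_T$ be its normalization, let $Q^{[r]}_E$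 be the reduced closed fiber of $Q^{[r]}_T$, and let $Q^{(r)\circ}_E$ be the connected component, with reduced structure, of the closed fiber of $Q^{(r)}_T$ that contains the closed point of the section ${\rm Spec}\,{\cal O}_L\to Q^{(r)}_T$ lifting $X\mapsto\alpha$. An $E$-vector space of finite dimension is regarded as a vector group scheme over $E$. Identify $Q^{[r]}_E$ with $\mathfrak m_L^{e(r-1)}/\mathfrak m_L^{e(r-1)+1}$ by $(f/\alpha^{er})\cdot(\alpha^{er}/f(0))$; that is, the point where the function $f/\alpha^{er}$ has value $s$ corresponds to the class of $s\,\alpha^{er}/f(0)$. *The classical sequence.* Let $M\subset L$ be the fixed field of $G_{i,\rm cl}$. For $R\in\{L,M\}$ put $U_R^i=1+\mathfrak m_R^i$ and identify $U_R^i/U_R^{i+1}=\mathfrak m_R^i/\mathfrak m_R^{i+1}$ by $u\mapsto u-1$; these are regarded as vector groups over $E$. Let $T^i:\mathfrak m_L^i/\mathfrak m_L^{i+1}\to\mathfrak m_M^i/\mathfrak m_M^{i+1}$ be induced by the trace ${\rm Tr}_{L/M}$, and let $N^i:U_L^i/U_L^{i+1}\to U_M^i/U_M^{i+1}$ be the morphism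 of group schemes induced by the norm $N_{L/M}$: for $x\in\mathfrak m_L^i$ it is given on the line $t\mapsto t\bar x$ by the classes of the coefficients of $N_{L/M}(1+tx)-1\in\mathfrak m_M^i[t]$. Then the following hold. 1. $er$ is an integer and $er={\rm ord}_L f'(\alpha)+(i+1)$. 2. $G^r=G_{i,\rm cl}$; the identification of $Q^{[r]}_E$ above is an isomorphism of schemes; the maps $T^i$ and $N^i$ are well defined and $T^i$ is an isomorphism. The scheme $Q^{(r)\circ}_E$ has a unique structure of group scheme over $E$ for which the projection to $Q^{[r]}_E=\mathfrak m_L^{e(r-1)}/\mathfrak m_L^{e(r-1)+1}$ is a homomorphism and the closed point of the section $X\mapsto\alpha$ is the origin. For $\sigma\in G^r$ the closed point of the section lifting $X\mapsto\sigma(\alpha)$ lies in $Q^{(r)\circ}_E$, and with $G^r\to Q^{(r)\circ}_E$ sending $\sigma$ to this point, there is an isomorphism of exact sequences of group schemes over $E$ $$\begin{array}{ccccccccc} 0&\to& G^r&\to& Q^{(r)\circ}_E&\to&\mathfrak m_L^{e(r-1)}/\mathfrak m_L^{e(r-1)+1}&\to&0\\ &&\|&&\uparrow&&\uparrow{\scriptstyle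 f'(\alpha)\cdot\alpha/f(0)}&&\\ 0&\to& G_{i,\rm cl}&\xrightarrow{\ \sigma\mapsto\sigma(\alpha)/\alpha\ }&U^i_L/U^{i+1}_L&\xrightarrow{\ (T^i)^{-1}\circ N^i\ }&U^i_L/U^{i+1}_L&\to&0 \end{array}$$ in which the left vertical arrow is the identity, the right vertical arrow is multiplication by $f'(\alpha)\alpha/f(0)$ on $U^i_L/U^{i+1}_L=\mathfrak m_L^i/\mathfrak m_L^{i+1}$, and the middle vertical arrow is an isomorphism of group schemes. -/

import Mathlib

open IsLocalRing Polynomial TensorProduct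
open scoped Polynomial TensorProduct

universe u

namespace TotRam

noncomputable section

/-! ### Ramification filtrations -/

section Ramification

variable (A K L B : Type*) [CommRing A] [Field K] [Field L] [CommRing B]
  [Algebra A K] [IsFractionRing A K] [Algebra K L] [Algebra A L] [IsScalarTower A K L]
  [Algebra A B] [Algebra B L] [IsScalarTower A B L] [IsIntegralClosure B A L]
  [Algebra.IsAlgebraic K L] [IsLocalRing B]

/-- The lower ramification group `G_j = Ker (G → Aut (O_L / m_L ^ (j + 1)))` of `G = Gal(L/K)`,
for an integer `j ≥ 0`, where `B = O_L`. -/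
def lowerRam (j : ℕ) : Subgroup Gal(L/K) :=
  ((maximalIdeal B ^ (j + 1)).inertia (B ≃ₐ[A] B)).comap (galRestrict A K L B).toMonoidHom

/-- The Herbrand function `φ(u) = ∫_0^u dt / (G_0 : G_t)`, where `G_t = G_⌈t⌉` for real `t ≥ 0`. -/
def herbrand (x : ℝ) : ℝ :=
  ∫ t in (0 : ℝ)..x, (((lowerRam A K L B ⌈t⌉₊).relIndex (lowerRam A K L B 0) : ℕ) : ℝ)⁻¹

/-- The classical upper numbering `G^v_cl = G_⌈ψ(v)⌉`, for real `v ≥ 0`, where `ψ` is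
the inverse of the bijection `φ : [0, ∞) → [0, ∞)`. -/
def upperRamCl (v : ℝ) : Subgroup Gal(L/K) :=
  lowerRam A K L B ⌈Function.invFunOn (herbrand A K L B) (Set.Ici 0) v⌉₊

/-- The (non-logarithmic) upper ramification group `G^s = G^(s - 1)_cl`, for rational `s > 1`. -/
def upperRam (s : ℚ) : Subgroup Gal(L/K) :=
  upperRamCl A K L B ((s : ℝ) - 1)

end Ramification

/-! ### Graded pieces and vector groups -/

section VectorGroups

/-- The graded piece `m ^ n / m ^ (n + 1)` of a local ring. -/
abbrev Gr (B : Type*) [CommRing B] [IsLocalRing B] (n : ℕ) : Type _ :=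
  ↥(maximalIdeal B ^ n) ⧸ (maximalIdeal B • ⊤ : Submodule B ↥(maximalIdeal B ^ n))

instance (B : Type*) [CommRing B] [IsLocalRing B] (n : ℕ) : Module (ResidueField B) (Gr B n) :=
  inferInstanceAs <| Module (B ⧸ maximalIdeal B) (Gr B n)

/-- The class in `m ^ n / m ^ (n + 1)` of an element of `m ^ n`. -/
def Gr.mk {B : Type*} [CommRing B] [IsLocalRing B] {n : ℕ} (x : ↥(maximalIdeal B ^ n)) : Gr B n :=
  Submodule.Quotient.mk x

/-- The symmetric algebra is a Hopf algebra: the generators are primitive and the antipode is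
`ι x ↦ - ι x`. -/
instance (E V : Type*) [CommRing E] [AddCommGroup V] [Module E V] :
    HopfAlgebra E (SymmetricAlgebra E V) :=
  HopfAlgebra.ofAlgHom (SymmetricAlgebra.lift (-SymmetricAlgebra.ι E V))
    (by
      ext x
      simp [SymmetricAlgebra.algebraMapInv_ι]
      erw [Algebra.TensorProduct.lift_tmul, Algebra.TensorProduct.lift_tmul]
      simp)
    (by ext x; simp [SymmetricAlgebra.algebraMapInv_ι])

variable (E : Type*) [Field E] (V : Type*) [AddCommGroup V] [Module E V]

/-- The Hopf algebra of the vector group scheme over `E` attached to a finite dimensional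
`E`-vector space `V`, namely `Spec Sym (V^∨)`, with `R`-points `V ⊗ R`. -/
abbrev VecGrp : Type _ := SymmetricAlgebra E (Module.Dual E V)

variable {E V}

/-- The `E`-rational point of the vector group of `V` given by `v`. -/
def VecGrp.point (v : V) : VecGrp E V →ₐ[E] E :=
  SymmetricAlgebra.lift (Module.Dual.eval E V v)

/-- The line `𝔸¹ → V`, `t ↦ t v`. -/
def VecGrp.line (v : V) : VecGrp E V →ₐ[E] E[X] :=
  SymmetricAlgebra.lift ((LinearMap.toSpanSingleton E E[X] X).comp (Module.Dual.eval E V v))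

/-- The morphism of vector groups induced by a linear map `V → W`. -/
def VecGrp.map {W : Type*} [AddCommGroup W] [Module E W] (φ : V →ₗ[E] W) :
    VecGrp E W →ₐ[E] VecGrp E V :=
  SymmetricAlgebra.lift ((SymmetricAlgebra.ι E (Module.Dual E V)).comp φ.dualMap)

/-- For an abstract group `Γ` and affine group schemes `H = Spec AH`, `V = Spec AV` over `E`,
the sequence `0 → Γ → H → V → 0`, given by a homomorphism `ι : Γ → H(E)`
and a homomorphism `π : H → V` of group schemes, is exact: the scheme theoretic kernel of `π` is the
finite constant group scheme `Γ`, and `π` is faithfully flat. -/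
structure IsExactSequence {Γ : Type*} (E AH AV : Type*) [Field E] [Group Γ] [CommRing AH] [HopfAlgebra E AH]
    [CommRing AV] [HopfAlgebra E AV] (ι : Γ →* WithConv (AH →ₐ[E] E)) (π : AV →ₐc[E] AH) :
    Prop where
  finite : Finite Γ
  surjective : Function.Surjective fun (a : AH) (σ : Γ) => (ι σ).ofConv a
  kernel : ∀ a : AH, (∀ σ : Γ, (ι σ).ofConv a = 0) ↔
    a ∈ (RingHom.ker (Bialgebra.counitAlgHom E AV)).map (π : AV →ₐ[E] AH)
  faithfullyFlat : (π : AV →ₐ[E] AH).toRingHom.FaithfullyFlat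

end VectorGroups

/-! ### The dilatation, its normalization and the component of the closed fiber -/

section Dilatation

set_option linter.unusedSectionVars false

variable (A K L B : Type*) [CommRing A] [Field K] [Field L] [CommRing B]
  [Algebra A K] [IsFractionRing A K] [Algebra K L] [Algebra A L] [IsScalarTower A K L]
  [Algebra A B] [Algebra B L] [IsScalarTower A B L] [IsIntegralClosure B A L]

/-- The coordinate ring `O_L[X][f / α ^ m]` of the dilatation `Q^[r]_T`, `m = e r`, where `f` is
the minimal polynomial of `α` over `A = O_K`, as a subring of `L[X]`. -/
def dilatation (α : B) (m : ℕ) : Subalgebra B L[X] :=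
  Algebra.adjoin B
    {X, C ((algebraMap B L α ^ m)⁻¹) * (minpoly A α).map (algebraMap A L)}

/-- The coordinate ring of the normalization `Q^(r)_T` of `Q^[r]_T`. As `L[X]` is normal, it is the
integral closure in `L[X]`; that this is the integral closure in the fraction field `L(X)`
is `isIntegral_fractionField_iff`. -/
def normalization (α : B) (m : ℕ) : Subalgebra B L[X] :=
  (integralClosure (dilatation A L B α m) L[X]).restrictScalars B



theorem isIntegral_fractionField_iff (α : B) (m : ℕ) (z : RatFunc L) :
    IsIntegral (dilatation A L B α m) z ↔
      ∃ q ∈ normalization A L B α m, algebraMap L[X] (RatFunc L) q = z := by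
  constructor
  · intro hz
    have h1 : IsIntegral L[X] z := hz.tower_top
    obtain ⟨q, rfl⟩ := IsIntegrallyClosed.isIntegral_iff.mp h1
    exact ⟨q, (isIntegral_algebraMap_iff (RatFunc.algebraMap_injective L)).mp hz, rfl⟩
  · rintro ⟨q, hq, rfl⟩
    exact IsIntegral.algebraMap (show IsIntegral (dilatation A L B α m) q from hq)

theorem dilatation_le (α : B) (m : ℕ) : dilatation A L B α m ≤ normalization A L B α m :=
  fun q hq => show IsIntegral (dilatation A L B α m) q from
    isIntegral_algebraMap (x := (⟨q, hq⟩ : dilatation A L B α m))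

variable [Algebra.IsAlgebraic K L]

/-- Evaluation of polynomials at the conjugate `σ(α)`. -/
def evalConj (α : B) (σ : Gal(L/K)) : L[X] →ₐ[B] L :=
  (aeval (R := L) (σ (algebraMap B L α))).restrictScalars B

theorem evalConj_dilatation (α : B) (m : ℕ) (σ : Gal(L/K)) (q : L[X])
    (hq : q ∈ dilatation A L B α m) : evalConj K L B α σ q ∈ (⊥ : Subalgebra B L) := by
  have hB : ∀ b : B, algebraMap B L b ∈ (⊥ : Subalgebra B L) := fun b => ⟨b, rfl⟩
  suffices dilatation A L B α m ≤ (⊥ : Subalgebra B L).comap (evalConj K L B α σ) from this hq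
  refine Algebra.adjoin_le ?_
  rintro x (rfl | rfl)
  · have : σ (algebraMap B L α) = algebraMap B L (galRestrict A K L B σ α) :=
      (algebraMap_galRestrict_apply A σ α).symm
    simp [evalConj, this]
  · have hz : aeval (σ (algebraMap B L α)) (minpoly A α) = 0 := by
      have h := aeval_algHom_apply
        ((σ : L →ₐ[K] L).restrictScalars A |>.comp (IsScalarTower.toAlgHom A B L)) α (minpoly A α)
      simpa using h
    have : evalConj K L B α σ
        (C ((algebraMap B L α ^ m)⁻¹) * (minpoly A α).map (algebraMap A L)) = 0 := by
      simp [evalConj, hz]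
    rw [SetLike.mem_coe, Subalgebra.mem_comap, this]
    exact zero_mem _

variable [IsFractionRing B L] [IsDomain B] [IsDiscreteValuationRing B]

theorem evalConj_normalization (α : B) (m : ℕ) (σ : Gal(L/K)) (q : normalization A L B α m) :
    evalConj K L B α σ q ∈ (⊥ : Subalgebra B L) := by
  have hq : IsIntegral (dilatation A L B α m) (q : L[X]) := q.2
  have h2 : IsIntegral (⊥ : Subalgebra B L) (evalConj K L B α σ q) := by
    refine hq.map_of_comp_eq
      ((((evalConj K L B α σ).comp (dilatation A L B α m).val).codRestrict ⊥
        fun d => evalConj_dilatation A K L B α m σ d d.2) : _ →+* _)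
      (evalConj K L B α σ : L[X] →+* L) ?_
    ext d
    rfl
  have h3 : IsIntegral B (evalConj K L B α σ q) := isIntegral_trans (A := (⊥ : Subalgebra B L)) _ h2
  obtain ⟨b, hb⟩ := IsIntegrallyClosed.isIntegral_iff.mp h3
  exact ⟨b, hb⟩

/-- The section `T → Q^(r)_T` lifting `X ↦ σ(α)`; for `σ = 1` it is the section given by `α`. -/
def sectionConj (α : B) (m : ℕ) (σ : Gal(L/K)) : normalization A L B α m →ₐ[B] B :=
  (Algebra.botEquivOfInjective (IsFractionRing.injective B L)).toAlgHom.comp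
    (((evalConj K L B α σ).comp (normalization A L B α m).val).codRestrict ⊥
      (evalConj_normalization A K L B α m σ))

theorem algebraMap_sectionConj (α : B) (m : ℕ) (σ : Gal(L/K)) (q : normalization A L B α m) :
    algebraMap B L (sectionConj A K L B α m σ q) =
      (q : L[X]).eval (σ (algebraMap B L α)) := by
  have key : ∀ y : (⊥ : Subalgebra B L), algebraMap B L
      (Algebra.botEquivOfInjective (IsFractionRing.injective B L) y) = y := by
    intro y
    obtain ⟨b, hb⟩ := (Algebra.botEquivOfInjective (IsFractionRing.injective B L)).symm.surjective y
    rw [← hb, AlgEquiv.apply_symm_apply]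
    rfl
  refine (key _).trans ?_
  simp [evalConj]

/-- The ring of functions on the closed fiber `Q^(r)_T ×_T Spec E`. -/
abbrev Fiber (α : B) (m : ℕ) : Type _ := ResidueField B ⊗[B] normalization A L B α m

/-- The image of the closed point of `T` under the section `sectionConj σ`, as an `E`-rational
point of the closed fiber. -/
def closedPoint (α : B) (m : ℕ) (σ : Gal(L/K)) : Fiber A L B α m →ₐ[ResidueField B] ResidueField B :=
  Algebra.TensorProduct.lift (AlgHom.id _ _)
    ((IsScalarTower.toAlgHom B B (ResidueField B)).comp (sectionConj A K L B α m σ))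
    fun _ _ => Commute.all _ _

/-- The ideal of the connected component `Q^(r)∘_E`, with its reduced structure, of the closed fiber:
the component that contains the closed point of the section given by `α`. -/
def componentIdeal (α : B) (m : ℕ) : Ideal (Fiber A L B α m) :=
  PrimeSpectrum.vanishingIdeal (connectedComponent
    (⟨RingHom.ker (closedPoint A K L B α m 1), RingHom.ker_isPrime _⟩ :
      PrimeSpectrum (Fiber A L B α m)))

/-- The ring of functions on `Q^(r)∘_E`. -/
abbrev Component (α : B) (m : ℕ) : Type _ := Fiber A L B α m ⧸ componentIdeal A K L B α m

/-- The ring of functions on `Q^[r]_E`, the reduced closed fiber of the dilatation. -/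
abbrev RedFiber (α : B) (m : ℕ) : Type _ :=
  (ResidueField B ⊗[B] dilatation A L B α m) ⧸ nilradical (ResidueField B ⊗[B] dilatation A L B α m)

/-- The morphism `Q^(r)∘_E → Q^[r]_E`. -/
def redFiberToComponent (α : B) (m : ℕ) :
    RedFiber A L B α m →ₐ[ResidueField B] Component A K L B α m :=
  Ideal.Quotient.liftₐ _
    ((Ideal.Quotient.mkₐ (ResidueField B) (componentIdeal A K L B α m)).comp
      (Algebra.TensorProduct.map (AlgHom.id (ResidueField B) (ResidueField B))
        (Subalgebra.inclusion (dilatation_le A L B α m))))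
    (by
      intro a ha
      have hrad : (componentIdeal A K L B α m).IsRadical := PrimeSpectrum.isRadical_vanishingIdeal _
      have h1 := (mem_nilradical.mp ha).map (Algebra.TensorProduct.map
        (AlgHom.id (ResidueField B) (ResidueField B))
        (Subalgebra.inclusion (dilatation_le A L B α m)))
      obtain ⟨k, hk⟩ := h1
      exact Ideal.Quotient.eq_zero_iff_mem.mpr
        (hrad ⟨k, by erw [hk]; exact Ideal.zero_mem _⟩))

/-- The function `S = f / α ^ m` on `Q^[r]_E`. -/
def coordS (α : B) (m : ℕ) : RedFiber A L B α m :=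
  Ideal.Quotient.mk _ (1 ⊗ₜ ⟨C ((algebraMap B L α ^ m)⁻¹) * (minpoly A α).map (algebraMap A L),
    Algebra.subset_adjoin (by simp)⟩)

/-- For `c = α ^ m / f(0)`, where `m = e r`, the morphism
`Q^[r]_E → m_L ^ (e (r - 1)) / m_L ^ (e (r - 1) + 1)` obtained from
`Q^[r]_E → Hom_E (m_L^m / m_L^(m+1), N ⊗ E)^∨` for the conormal module `N = (f)/(f^2)`,
and from the identification `N ⊗ E = m_K / m_K ^ 2` that sends the class of `f` to that of `f(0)`.
It is the point `S · c`: a linear form `l` is pulled back to the function `l(c) S`. -/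
def redFiberToGr (α : B) (m : ℕ) {n : ℕ} (c : Gr B n) :
    VecGrp (ResidueField B) (Gr B n) →ₐ[ResidueField B] RedFiber A L B α m :=
  SymmetricAlgebra.lift (A := RedFiber A L B α m)
    ((LinearMap.toSpanSingleton (ResidueField B) _ (coordS A L B α m)).comp (Module.Dual.eval (ResidueField B) _ c))

end Dilatation

/-! ### Norm and trace on the graded pieces -/

section NormTrace

variable (A : Type*) {K L : Type*} (B : Type*) [CommRing A] [Field K] [Field L] [CommRing B]
  [Algebra A K] [Algebra K L] [Algebra A L] [IsScalarTower A K L]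
  [Algebra A B] [Algebra B L] [IsScalarTower A B L] [IsLocalRing B] (M : IntermediateField K L)

/-- The ring of integers `O_M = O_L ∩ M` of an intermediate field, that is, the integral closure
of `A` in `M`, as a subring of `B = O_L`. -/
def intRing : Subalgebra A B :=
  (M.toSubalgebra.restrictScalars A).comap (IsScalarTower.toAlgHom A B L)

/-- The maximal ideal `m_M = m_L ∩ O_M` of `O_M`. -/
def maxIdeal : Ideal (intRing A B M) :=
  (maximalIdeal B).comap (intRing A B M).val

/-- The graded piece `m_M ^ n / m_M ^ (n + 1)`. -/
abbrev GrSub (n : ℕ) : Type _ :=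
  ↥(maxIdeal A B M ^ n) ⧸ (maxIdeal A B M • ⊤ : Submodule (intRing A B M) ↥(maxIdeal A B M ^ n))

/-- The class in `m_M ^ n / m_M ^ (n + 1)` of an element of `m_M ^ n`. -/
def GrSub.mk {n : ℕ} (z : ↥(maxIdeal A B M ^ n)) : GrSub A B M n :=
  Submodule.Quotient.mk z

variable {A B}

/-- `T` is the map `m_L ^ n / m_L ^ (n + 1) → m_M ^ n / m_M ^ (n + 1)` induced by the trace of `L/M`;
in particular the trace maps `m_L ^ n` to `m_M ^ n`. -/
def IsTraceMap {n : ℕ} (T : Gr B n ≃+ GrSub A B M n) : Prop :=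
  ∀ y : ↥(maximalIdeal B ^ n), ∃ z : ↥(maxIdeal A B M ^ n),
    algebraMap B L (z : intRing A B M) = algebraMap M L (Algebra.trace M L (algebraMap B L y)) ∧
      T (Gr.mk y) = GrSub.mk A B M z

/-- The norm `N_{L/M}(1 + t x)` in `M[t]`, that is, the norm of `M[t] ⊗ L` over `M[t]`. -/
def normPoly (x : L) : M[X] :=
  Algebra.norm M[X] (1 + (X : M[X]) ⊗ₜ[M] x : M[X] ⊗[M] L)

/-- For the isomorphism `T` induced by the trace, `ν` is the morphism `T⁻¹ ∘ N` of group schemes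
over `E` from `U_L^n / U_L^(n+1)` to itself, for `n ≥ 1`. Here `U_L^n / U_L^(n+1)` is
identified with `m_L^n / m_L^(n+1)` by `u ↦ u - 1`, and similarly for `M`, and `N` is induced
by the norm of `L/M`:
for every `x ∈ m_L^n` all coefficients of `N_{L/M}(1 + t x) - 1 = ∑ c_k t^k` are in `m_M^n`, and
the restriction of `T⁻¹ ∘ N` to the line `t ↦ t x` is `t ↦ ∑ T⁻¹(c_k) t^k`.
On `E`-rational points (take `t = 1`) this says that `ν` sends the class of a unit
`1 + x` to the inverse image under `T` of the class of `N_{L/M}(1 + x)`. -/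
def IsTraceInvNorm {n : ℕ} (T : Gr B n ≃+ GrSub A B M n)
    (ν : VecGrp (ResidueField B) (Gr B n) →ₐc[ResidueField B] VecGrp (ResidueField B) (Gr B n)) :
    Prop :=
  ∀ x : ↥(maximalIdeal B ^ n), ∃ c : ℕ →₀ ↥(maxIdeal A B M ^ n),
    c 0 = 0 ∧
    (normPoly M (algebraMap B L x)).map (algebraMap M L) =
      1 + c.sum (fun k a => monomial k (algebraMap B L (a : intRing A B M))) ∧
    ∀ l : Module.Dual (ResidueField B) (Gr B n),
      VecGrp.line (Gr.mk x) (ν (SymmetricAlgebra.ι (ResidueField B) _ l)) =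
        c.sum (fun k a => monomial k (l (T.symm (GrSub.mk A B M a))))

end NormTrace

end

end TotRam

open TotRam

/-!
Write `v` for the valuation of `L`, `q` for the order of the last ramification group `H = G_i`,
`σ α = α + α ^ (i + 1) c_σ` for `σ ∈ H`, and `E` for the residue field.

*The integer `m = e r`.* Counting the pairs of an automorphism `τ` and a ramification group
`G_k`, `k ≤ i`, that contains it gives `m = ∑_{k ≤ i} |G_k| = ∑_τ min (v(α - τ α), i + 1)`
(`prod_gap_associated_pow_sum`). The Herbrand function turns the sum into `e r`
(`last_upper_break_mul_card`), and separating `H` from its complement turns it into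
`v(f'(α)) + i + 1` (`aeval_derivative_mul_pow_associated`).

*The geometric sequence.* A polynomial over `L` is integral over the dilatation if and only if it has
integral coefficients in the coordinate `Y` of each disc `X = σ α + α ^ (i + 1) Y`
(`mem_normalization_iff`): a valuation ring of `L(X)` that contains the dilatation sees
`f(X) / α ^ m` as integral, which forces `X` into one of the discs. Hence the component of the
closed fiber that contains the section given by `α` is the reduction `Spec E[Y]` of the disc
around `α` (`componentEquiv`), the section given by `σ α` passes through the point `Y = c_σ`
(`closedPoint_eq_eval`), and `f / α ^ m` restricts to a unit multiple of `∏_σ (Y - c_σ)`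
(`redHom_generator`). The map `σ ↦ c_σ` is an injective homomorphism from `H` to `E`, so that this
polynomial is additive (`isAdditivePoly_prod`); it defines the group structure, for which the
sequence is exact (`TotRam.VecGrp.isExactSequence`). Two comultiplications for which the projection
is a homomorphism differ by a root of the additive polynomial, and this root is determined by the origin
(`TotRam.VecGrp.exists_bialgEquiv`).

*The classical sequence.* By Euler's formula for the dual basis of `1, α, …, α ^ (q - 1)`, the
trace maps `m_L ^ n` to `m_M ^ n` for `n = i, i + 1`, and bijectively on the graded piece of degree `i`
(`HasSingleBreak.pow_dvd_trace`, `HasSingleBreak.exists_trace_eq`,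
`HasSingleBreak.pow_dvd_of_pow_dvd_trace`). The coefficients of `N(1 + t x)` are sums over orbits
of `H` on its subsets, hence traces, and lie in `m_M ^ n` for the same reason
(`HasSingleBreak.pow_dvd_coeff_norm`). So on a line `T⁻¹ ∘ N` is a polynomial of degree at most `q`. It
vanishes at the classes of `σ α / α`, which are units of norm `1`, and its linear coefficient is that of
the identity. Thus it is the additive polynomial with the roots `c_σ` and linear coefficient `1`
(`HasSingleBreak.sum_monomial_residue_eq_rootPoly_comp`).

Both sequences are therefore given by the same roots, and the polynomials differ by the factor
`f'(α) α ^ (i + 1) / α ^ m` (`lineEquiv_polyHom_eq`).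
-/

open TotRam
set_option linter.unusedSectionVars false

/-! ### Additive polynomials -/

/-- A polynomial `P` is additive if `P(X + Y) = P(X) + P(Y)`; here `X` is the variable of the
coefficient ring `E[X]` and `Y` is the outer variable of `E[X][Y]`. -/
def IsAdditivePoly {E : Type*} [CommRing E] (P : E[X]) : Prop :=
  aeval (X + C X : E[X][X]) P = aeval (C X : E[X][X]) P + aeval (X : E[X][X]) P

theorem IsAdditivePoly.aeval_add {E : Type*} [CommRing E] {P : E[X]} (hP : IsAdditivePoly P)
    {R : Type*} [CommRing R] [Algebra E R] (r s : R) :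
    aeval (r + s) P = aeval r P + aeval s P := by
  have h := congrArg (eval₂ (aeval r : E[X] →ₐ[E] R).toRingHom s) hP
  have key : ∀ z : E[X][X], eval₂ (aeval r : E[X] →ₐ[E] R).toRingHom s (aeval z P) =
      aeval (eval₂ (aeval r : E[X] →ₐ[E] R).toRingHom s z) P := by
    intro z
    simp only [aeval_def]
    rw [← coe_eval₂RingHom, hom_eval₂]
    congr 1
    ext a
    simp
  rw [eval₂_add, key, key, key] at h
  simpa [add_comm] using h

theorem IsAdditivePoly.aeval_zero {E : Type*} [CommRing E] {P : E[X]} (hP : IsAdditivePoly P)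
    {R : Type*} [CommRing R] [Algebra E R] : aeval (0 : R) P = 0 := by
  simpa using hP.aeval_add (0 : R) 0

theorem IsAdditivePoly.C_mul {E : Type*} [CommRing E] {P : E[X]} (hP : IsAdditivePoly P) (a : E) :
    IsAdditivePoly (C a * P) := by
  unfold IsAdditivePoly at *
  rw [map_mul, map_mul, map_mul, hP]
  simp [mul_add]

/-- The monic polynomial whose roots form a finite subgroup of a domain is additive. -/
theorem isAdditivePoly_prod {E Γ : Type*} [CommRing E] [IsDomain E] [Group Γ] [Fintype Γ]
    (c : Γ → E) (hc : Function.Injective c) (hmul : ∀ σ τ, c (σ * τ) = c σ + c τ) :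
    IsAdditivePoly (∏ σ, (X - C (c σ))) := by
  set P : E[X] := ∏ σ, (X - C (c σ)) with hPdef
  have hmon : P.Monic := monic_prod_of_monic _ _ fun σ _ => monic_X_sub_C _
  have hdeg : P.natDegree = Fintype.card Γ := by
    rw [hPdef, natDegree_prod_of_monic _ _ fun σ _ => monic_X_sub_C _]
    simp
  have hq : 0 < Fintype.card Γ := Fintype.card_pos
  have hroot : ∀ τ, P.eval (c τ) = 0 := by
    intro τ
    rw [hPdef, eval_prod]
    exact Finset.prod_eq_zero (Finset.mem_univ τ) (by simp)
  have hP' : ∀ z : E[X][X], aeval z P = (P.map C).comp z := by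
    intro z
    rw [aeval_def, comp, eval₂_map]
    rfl
  have hmon' : (P.map (C : E →+* E[X])).Monic := hmon.map _
  have hdeg' : (P.map (C : E →+* E[X])).natDegree = Fintype.card Γ := by
    rw [hmon.natDegree_map, hdeg]
  have hshift : ∀ τ, P.comp (X + C (c τ)) = P := by
    intro τ
    rw [hPdef, prod_comp]
    rw [← Equiv.prod_comp (Equiv.mulLeft τ)]
    refine Finset.prod_congr rfl fun σ _ => ?_
    simp only [Equiv.coe_mulLeft, hmul, map_add, sub_comp, add_comp, X_comp, C_comp]
    ring
  have hzero : (P.map (C : E →+* E[X])).comp (X + C X) - (P.map C).comp (C X) -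
      P.map (C : E →+* E[X]) = 0 := by
    refine eq_zero_of_natDegree_lt_card_of_eval_eq_zero (f := fun τ => C (c τ)) _
      (fun σ τ h => hc (C_injective h)) (fun τ => ?_) ?_
    · have h1 : ((P.map (C : E →+* E[X])).comp (X + C X)).eval (C (c τ)) = P := by
        conv_rhs => rw [← hshift τ]
        rw [eval_comp, eval_map, comp]
        simp [add_comm]
      have h2 : ((P.map (C : E →+* E[X])).comp (C X)).eval (C (c τ)) = P := by
        rw [eval_comp, eval_C, eval_map, eval₂_C_X]
      have h3 : (P.map (C : E →+* E[X])).eval (C (c τ)) = 0 := by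
        rw [eval_map, eval₂_at_apply, hroot, map_zero]
      rw [eval_sub, eval_sub, h1, h2, h3]
      simp
    · have hmc : ((P.map (C : E →+* E[X])).comp (X + C X)).Monic := hmon'.comp_X_add_C _
      have hdc : ((P.map (C : E →+* E[X])).comp (X + C X)).natDegree = Fintype.card Γ := by
        rw [natDegree_comp, hdeg']
        simp
      rw [sub_right_comm]
      refine lt_of_le_of_lt (natDegree_sub_le _ _) (max_lt ?_ ?_)
      · exact IsMonicOfDegree.natDegree_sub_lt hq.ne' ⟨hdc, hmc⟩ ⟨hdeg', hmon'⟩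
      · rw [comp_C, natDegree_C]
        exact hq
  rw [IsAdditivePoly, hP', hP', hP', comp_X]
  linear_combination hzero

/-! ### Vector groups of dimension one -/

namespace TotRam.VecGrp

open SymmetricAlgebra

variable {E V W : Type*} [Field E] [AddCommGroup V] [Module E V] [AddCommGroup W] [Module E W]

/-- The coordinate function on the vector group of a line `V` that is given by an
isomorphism `V ≃ E`. -/
noncomputable def coord (η : V ≃ₗ[E] E) : VecGrp E V :=
  SymmetricAlgebra.ι E (Module.Dual E V) (η : V →ₗ[E] E)

theorem dual_eq_smul (η : V ≃ₗ[E] E) (l : Module.Dual E V) :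
    l = l (η.symm 1) • (η : V →ₗ[E] E) := by
  ext v
  obtain ⟨a, rfl⟩ := η.symm.surjective v
  have : η.symm a = a • η.symm 1 := by rw [← map_smul, smul_eq_mul, mul_one]
  rw [this]
  simp [mul_comm]

@[simp] theorem line_ι (v : V) (l : Module.Dual E V) :
    line v (SymmetricAlgebra.ι E _ l) = l v • X := by
  simp [line]

@[simp] theorem point_ι (v : V) (l : Module.Dual E V) :
    point v (SymmetricAlgebra.ι E _ l) = l v := by
  simp [point]

theorem line_coord (η : V ≃ₗ[E] E) : line (η.symm 1) (coord η) = X := by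
  simp [coord]

theorem algHom_ext_coord (η : V ≃ₗ[E] E) {R : Type*} [CommRing R] [Algebra E R]
    {f g : VecGrp E V →ₐ[E] R} (h : f (coord η) = g (coord η)) : f = g := by
  refine SymmetricAlgebra.algHom_ext (LinearMap.ext fun l => ?_)
  have h' : f (SymmetricAlgebra.ι E _ (η : V →ₗ[E] E)) =
    g (SymmetricAlgebra.ι E _ (η : V →ₗ[E] E)) := h
  rw [dual_eq_smul η l]
  simp [h']

/-- The ring of functions on a line is a polynomial ring in the coordinate. -/
noncomputable def lineEquiv (η : V ≃ₗ[E] E) : VecGrp E V ≃ₐ[E] E[X] :=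
  AlgEquiv.ofAlgHom (line (η.symm 1)) (aeval (coord η))
    (by ext; simp [line_coord])
    (algHom_ext_coord η (by simp [line_coord]))

theorem lineEquiv_apply (η : V ≃ₗ[E] E) (a : VecGrp E V) :
    lineEquiv η a = line (η.symm 1) a := rfl

theorem lineEquiv_symm_apply (η : V ≃ₗ[E] E) (p : E[X]) :
    (lineEquiv η).symm p = aeval (coord η) p := rfl

theorem lineEquiv_coord (η : V ≃ₗ[E] E) : lineEquiv η (coord η) = X := line_coord η

theorem lineEquiv_aeval (η : V ≃ₗ[E] E) (p : E[X]) : lineEquiv η (aeval (coord η) p) = p :=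
  (lineEquiv η).apply_symm_apply p

/-- Evaluation at a point is evaluation of polynomials. -/
theorem point_eq_eval (η : V ≃ₗ[E] E) (t : E) (a : VecGrp E V) :
    point (t • η.symm 1) a = (lineEquiv η a).eval t := by
  have : point (t • η.symm 1) = (aeval t : E[X] →ₐ[E] E).comp (lineEquiv η).toAlgHom := by
    refine algHom_ext_coord η ?_
    simp [lineEquiv_coord]
    simp [coord]
  rw [this]
  simp [coe_aeval_eq_eval]

theorem line_smul (t : E) (v : V) (a : VecGrp E V) :
    line (t • v) a = (line v a).comp (C t * X) := by
  have : line (t • v) = (aeval (C t * X) : E[X] →ₐ[E] E[X]).comp (line v) := by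
    refine SymmetricAlgebra.algHom_ext (LinearMap.ext fun l => ?_)
    simp [smul_eq_C_mul, mul_left_comm, ← mul_assoc]
  rw [this, AlgHom.comp_apply, comp_eq_aeval]

theorem comul_coord (η : V ≃ₗ[E] E) :
    Coalgebra.comul (R := E) (coord η) = coord η ⊗ₜ[E] 1 + 1 ⊗ₜ[E] coord η :=
  SymmetricAlgebra.comul_ι _ _ _

theorem counit_coord (η : V ≃ₗ[E] E) : Coalgebra.counit (R := E) (coord η) = 0 :=
  SymmetricAlgebra.counit_ι _ _ _

/-- The ring homomorphism underlying `polyHom`. -/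
noncomputable def polyAlgHom (η : V ≃ₗ[E] E) (w : W) (N : E[X]) : VecGrp E W →ₐ[E] VecGrp E V :=
  SymmetricAlgebra.lift
    ((LinearMap.toSpanSingleton E (VecGrp E V) (aeval (coord η) N)).comp (Module.Dual.eval E W w))

theorem polyAlgHom_ι (η : V ≃ₗ[E] E) (w : W) (N : E[X]) (l : Module.Dual E W) :
    polyAlgHom η w N (SymmetricAlgebra.ι E _ l) = l w • aeval (coord η) N := by
  simp [polyAlgHom]

/-- The homomorphism of vector groups from a line `V` to `W` given by an additive polynomial `N`:
the point `t` is sent to `N(t) w`. -/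
noncomputable def polyHom (η : V ≃ₗ[E] E) (w : W) (N : E[X]) (hN : IsAdditivePoly N) :
    VecGrp E W →ₐc[E] VecGrp E V :=
  .ofAlgHom (polyAlgHom η w N)
    (by
      refine SymmetricAlgebra.algHom_ext (LinearMap.ext fun l => ?_)
      have h : Bialgebra.counitAlgHom E (VecGrp E V) (aeval (coord η) N) = 0 := by
        rw [← aeval_algHom_apply, Bialgebra.counitAlgHom_apply, counit_coord]
        exact hN.aeval_zero
      change Bialgebra.counitAlgHom E (VecGrp E V) (polyAlgHom η w N (SymmetricAlgebra.ι E _ l)) =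
        Bialgebra.counitAlgHom E (VecGrp E W) (SymmetricAlgebra.ι E _ l)
      rw [polyAlgHom_ι, map_smul, h, smul_zero, Bialgebra.counitAlgHom_apply,
        SymmetricAlgebra.counit_ι])
    (by
      refine SymmetricAlgebra.algHom_ext (LinearMap.ext fun l => ?_)
      have h : Bialgebra.comulAlgHom E (VecGrp E V) (aeval (coord η) N) =
          aeval (coord η) N ⊗ₜ[E] 1 + 1 ⊗ₜ[E] aeval (coord η) N := by
        rw [← aeval_algHom_apply, Bialgebra.comulAlgHom_apply, comul_coord, hN.aeval_add]
        congr 1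
        · exact aeval_algHom_apply
            (Algebra.TensorProduct.includeLeft : VecGrp E V →ₐ[E] _) (coord η) N
        · exact aeval_algHom_apply
            (Algebra.TensorProduct.includeRight : VecGrp E V →ₐ[E] _) (coord η) N
      change Algebra.TensorProduct.map (polyAlgHom η w N) (polyAlgHom η w N)
          (Bialgebra.comulAlgHom E (VecGrp E W) (SymmetricAlgebra.ι E _ l)) =
        Bialgebra.comulAlgHom E (VecGrp E V) (polyAlgHom η w N (SymmetricAlgebra.ι E _ l))
      rw [polyAlgHom_ι, map_smul, h, Bialgebra.comulAlgHom_apply, SymmetricAlgebra.comul_ι, map_add,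
        Algebra.TensorProduct.map_tmul, Algebra.TensorProduct.map_tmul, map_one, polyAlgHom_ι,
        smul_add, TensorProduct.smul_tmul', TensorProduct.tmul_smul])

theorem polyHom_ι (η : V ≃ₗ[E] E) (w : W) (N : E[X]) (hN : IsAdditivePoly N)
    (l : Module.Dual E W) :
    polyHom η w N hN (SymmetricAlgebra.ι E _ l) = l w • aeval (coord η) N :=
  polyAlgHom_ι η w N l

/-- Points of a vector group are multiplied by adding vectors. -/
theorem toConv_point_add (v w : V) :
    WithConv.toConv (point (E := E) (v + w)) =
      WithConv.toConv (point v) * WithConv.toConv (point w) := by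
  refine WithConv.ext (SymmetricAlgebra.algHom_ext (LinearMap.ext fun l => ?_))
  rw [AlgHom.convMul_def]
  simp

/-- The homomorphism from a group to the group of rational points of a line that is given by
an additive character. -/
noncomputable def pointHom {Γ : Type*} [Group Γ] (v : V) (c : Γ → E)
    (hmul : ∀ σ τ, c (σ * τ) = c σ + c τ) : Γ →* WithConv (VecGrp E V →ₐ[E] E) :=
  { toFun := fun σ => WithConv.toConv (point (c σ • v))
    map_one' := by
      have h1 : c 1 = 0 := by simpa using hmul 1 1
      refine WithConv.ext (SymmetricAlgebra.algHom_ext (LinearMap.ext fun l => ?_))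
      change point (c 1 • v) (SymmetricAlgebra.ι E _ l) =
        algebraMap E E (Coalgebra.counit (R := E) (SymmetricAlgebra.ι E (Module.Dual E V) l))
      rw [point_ι, h1, zero_smul, map_zero, SymmetricAlgebra.counit_ι, map_zero]
    map_mul' := fun σ τ => by rw [hmul, add_smul, toConv_point_add] }

theorem pointHom_ofConv {Γ : Type*} [Group Γ] (v : V) (c : Γ → E)
    (hmul : ∀ σ τ, c (σ * τ) = c σ + c τ) (σ : Γ) :
    (pointHom v c hmul σ).ofConv = point (c σ • v) := rfl

end TotRam.VecGrp

namespace TotRam.VecGrp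

open SymmetricAlgebra

variable {E V W : Type*} [Field E] [AddCommGroup V] [Module E V] [AddCommGroup W] [Module E W]

theorem lineEquiv_algHom_eq_comp (η : V ≃ₗ[E] E) (η' : W ≃ₗ[E] E) (N : E[X])
    {π : VecGrp E W →ₐc[E] VecGrp E V}
    (hπ : ∀ l : Module.Dual E W,
      π (SymmetricAlgebra.ι E _ l) = l (η'.symm 1) • aeval (coord η) N) (a : VecGrp E W) :
    lineEquiv η (π a) = (lineEquiv η' a).comp N := by
  have h : (lineEquiv η).toAlgHom.comp (π : VecGrp E W →ₐ[E] VecGrp E V) =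
      (aeval N : E[X] →ₐ[E] E[X]).comp (lineEquiv η').toAlgHom := by
    refine algHom_ext_coord η' ?_
    change lineEquiv η (π (SymmetricAlgebra.ι E _ (η' : W →ₗ[E] E))) =
      aeval N (lineEquiv η' (coord η'))
    rw [hπ, map_smul, lineEquiv_aeval, lineEquiv_coord]
    simp
  have h2 := DFunLike.congr_fun h a
  rw [comp_eq_aeval]
  exact h2

/-- A nonconstant homomorphism between vector groups of dimension one is faithfully flat: the ring
of functions on the source is integral and torsion free over the principal ideal domain of
functions on the target. -/
theorem faithfullyFlat_of_eq_comp (η : V ≃ₗ[E] E) (η' : W ≃ₗ[E] E) (N : E[X])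
    (hN : 0 < N.natDegree) (π : VecGrp E W →ₐ[E] VecGrp E V)
    (hπ : ∀ a, lineEquiv η (π a) = (lineEquiv η' a).comp N) :
    π.toRingHom.FaithfullyFlat := by
  have hinj : Function.Injective π := by
    rw [injective_iff_map_eq_zero]
    intro a ha
    have h := hπ a
    rw [ha, map_zero, eq_comm, comp_eq_zero_iff] at h
    rcases h with h | ⟨-, h⟩
    · simpa using h
    · rw [h, natDegree_C] at hN
      exact absurd hN (lt_irrefl 0)
  have : IsPrincipalIdealRing (VecGrp E W) :=
    IsPrincipalIdealRing.of_surjective (lineEquiv η').symm.toRingEquiv.toRingHom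
      (lineEquiv η').symm.surjective
  let _  : Algebra (VecGrp E W) (VecGrp E V) := π.toRingHom.toAlgebra
  have : IsScalarTower E (VecGrp E W) (VecGrp E V) :=
    IsScalarTower.of_algebraMap_eq fun x => (π.commutes x).symm
  have hfs : FaithfulSMul (VecGrp E W) (VecGrp E V) :=
    (faithfulSMul_iff_algebraMap_injective _ _).mpr hinj
  have : Module.IsTorsionFree (VecGrp E W) (VecGrp E V) :=
    Module.isTorsionFree_iff_algebraMap_injective.mpr hinj
  have hN0 : N.leadingCoeff ≠ 0 := leadingCoeff_ne_zero.mpr fun h => by simp [h] at hN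
  have hcoord : IsIntegral (VecGrp E W) (coord η) := by
    have hNy : aeval (coord η) N = π (coord η') := by
      apply (lineEquiv η).injective
      rw [hπ, lineEquiv_coord, lineEquiv_aeval, X_comp]
    let M : (VecGrp E W)[X] :=
      (C N.leadingCoeff⁻¹ * N).map (algebraMap E (VecGrp E W)) -
        C (algebraMap E (VecGrp E W) N.leadingCoeff⁻¹ * coord η')
    have hm : (C N.leadingCoeff⁻¹ * N).Monic := by
      rw [Monic, leadingCoeff_mul, leadingCoeff_C, inv_mul_cancel₀ hN0]
    refine ⟨M, ?_, ?_⟩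
    · refine (hm.map _).sub_of_left (lt_of_le_of_lt degree_C_le ?_)
      rw [hm.degree_map, ← natDegree_pos_iff_degree_pos, natDegree_C_mul (inv_ne_zero hN0)]
      exact hN
    · change aeval (coord η) M = 0
      rw [map_sub, aeval_map_algebraMap, map_mul, aeval_C, aeval_C, hNy, map_mul,
        ← IsScalarTower.algebraMap_apply]
      exact sub_self _
  have : Algebra.IsIntegral (VecGrp E W) (VecGrp E V) := by
    refine ⟨fun a => ?_⟩
    rw [← (lineEquiv η).symm_apply_apply a, lineEquiv_symm_apply]
    have h : aeval (coord η) (lineEquiv η a) ∈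
        (integralClosure (VecGrp E W) (VecGrp E V)).restrictScalars E :=
      Algebra.adjoin_le (Set.singleton_subset_iff.mpr hcoord) (aeval_mem_adjoin_singleton E (coord η))
    exact h
  exact (inferInstance : Module.FaithfullyFlat (VecGrp E W) (VecGrp E V))

/-- The homomorphism between vector groups of dimension one that is given by an additive polynomial
is surjective, and its kernel is the constant group of the roots. -/
theorem isExactSequence (η : V ≃ₗ[E] E) (η' : W ≃ₗ[E] E) {Γ : Type*} [Group Γ] [Fintype Γ]
    {c : Γ → E} (hc : Function.Injective c) {u : E} (hu : u ≠ 0)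
    {ι : Γ →* WithConv (VecGrp E V →ₐ[E] E)}
    (hι : ∀ σ, (ι σ).ofConv = point (c σ • η.symm 1))
    {π : VecGrp E W →ₐc[E] VecGrp E V}
    (hπ : ∀ l : Module.Dual E W, π (SymmetricAlgebra.ι E _ l) =
      l (η'.symm 1) • aeval (coord η) (C u * ∏ σ, (X - C (c σ)))) :
    IsExactSequence E (VecGrp E V) (VecGrp E W) ι π := by
  set N : E[X] := C u * ∏ σ, (X - C (c σ)) with hNdef
  have heval : ∀ σ (a : VecGrp E V), (ι σ).ofConv a = (lineEquiv η a).eval (c σ) := by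
    intro σ a
    rw [hι, point_eq_eval]
  have hNroot : ∀ σ, N.eval (c σ) = 0 := by
    intro σ
    rw [hNdef, eval_mul, eval_prod, Finset.prod_eq_zero (Finset.mem_univ σ) (by simp), mul_zero]
  have hcomp := lineEquiv_algHom_eq_comp η η' N hπ
  classical
  refine ⟨inferInstance, fun g => ?_, fun a => ⟨fun h => ?_, fun h => ?_⟩, ?_⟩
  · refine ⟨(lineEquiv η).symm (Lagrange.interpolate Finset.univ c g), funext fun σ => ?_⟩
    simp only [heval, AlgEquiv.apply_symm_apply]
    exact Lagrange.eval_interpolate_at_node g hc.injOn (Finset.mem_univ σ)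
  · have hdvd : (∏ σ, (X - C (c σ))) ∣ lineEquiv η a := by
      refine Finset.prod_dvd_of_coprime (fun σ _ τ _ hne => ?_) fun σ _ => ?_
      · exact isCoprime_X_sub_C_of_isUnit_sub (sub_ne_zero.mpr (hc.ne hne)).isUnit
      · rw [dvd_iff_isRoot, IsRoot, ← heval, h]
    obtain ⟨b, hb⟩ := hdvd
    have ha : a = (lineEquiv η).symm (C u⁻¹ * b) * π (coord η') := by
      apply (lineEquiv η).injective
      rw [map_mul, AlgEquiv.apply_symm_apply, hcomp, lineEquiv_coord, X_comp, hb, hNdef]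
      have : (C u⁻¹ : E[X]) * C u = 1 := by rw [← C_mul, inv_mul_cancel₀ hu, C_1]
      linear_combination (- b * ∏ σ, (X - C (c σ))) * this
    rw [ha]
    refine Ideal.mul_mem_left _ _ (Ideal.mem_map_of_mem (π : VecGrp E W →ₐ[E] VecGrp E V) ?_)
    exact counit_coord η'
  · intro σ
    have hle : (RingHom.ker (Bialgebra.counitAlgHom E (VecGrp E W))).map
        (π : VecGrp E W →ₐ[E] VecGrp E V) ≤ RingHom.ker (ι σ).ofConv := by
      rw [Ideal.map_le_iff_le_comap]
      intro x hx
      have hx' : Bialgebra.counitAlgHom E (VecGrp E W) x = 0 := hx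
      have : ((ι σ).ofConv).comp (π : VecGrp E W →ₐ[E] VecGrp E V) =
          Bialgebra.counitAlgHom E (VecGrp E W) := by
        refine algHom_ext_coord η' ?_
        rw [Bialgebra.counitAlgHom_apply, counit_coord]
        change (ι σ).ofConv (π (coord η')) = 0
        rw [heval, hcomp, lineEquiv_coord, X_comp, hNroot]
      rw [Ideal.mem_comap, RingHom.mem_ker]
      rw [← this] at hx'
      exact hx'
    exact hle h
  · refine faithfullyFlat_of_eq_comp η η' N ?_ _ hcomp
    rw [hNdef, natDegree_C_mul hu, natDegree_prod_of_monic _ _ fun σ _ => monic_X_sub_C _]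
    simp [Fintype.card_pos]

/-- The ring of functions on the product of two lines is a domain. -/
theorem isDomain_tensor (η : V ≃ₗ[E] E) : IsDomain (VecGrp E V ⊗[E] VecGrp E V) := by
  have e : VecGrp E V ⊗[E] VecGrp E V ≃ₐ[E] (VecGrp E V)[X] :=
    (Algebra.TensorProduct.congr AlgEquiv.refl (lineEquiv η)).trans
      (polyEquivTensor E (VecGrp E V)).symm
  exact e.toMulEquiv.isDomain _

/-- A Hopf algebra structure on the functions on a line is determined by its counit and by an
étale isogeny to a line that is a homomorphism: the comultiplication of the coordinate and the
standard one differ by a root of the isogeny, and this root is the value at the origin. -/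
theorem exists_bialgEquiv (η : V ≃ₗ[E] E) (η' : W ≃ₗ[E] E) {Γ : Type*} [Group Γ] [Fintype Γ]
    {c : Γ → E} (hc : Function.Injective c) (hmul : ∀ σ τ, c (σ * τ) = c σ + c τ)
    {u : E} (hu : u ≠ 0)
    {π : VecGrp E W →ₐc[E] VecGrp E V}
    (hπ : ∀ l : Module.Dual E W, π (SymmetricAlgebra.ι E _ l) =
      l (η'.symm 1) • aeval (coord η) (C u * ∏ σ, (X - C (c σ))))
    {Q : Type*} [CommRing Q] [Bialgebra E Q] (g : Q ≃ₐ[E] VecGrp E V)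
    (π' : VecGrp E W →ₐc[E] Q) (hg : ∀ a, g (π' a) = π a)
    (hcounit : ∀ a, Bialgebra.counitAlgHom E Q (g.symm a) =
      Bialgebra.counitAlgHom E (VecGrp E V) a) :
    ∃ g' : Q ≃ₐc[E] VecGrp E V, ∀ a, g' a = g a := by
  set N : E[X] := C u * ∏ σ, (X - C (c σ)) with hNdef
  have hN : IsAdditivePoly N := (isAdditivePoly_prod c hc hmul).C_mul u
  have hNy : aeval (coord η) N = π (coord η') := by
    apply (lineEquiv η).injective
    rw [lineEquiv_algHom_eq_comp η η' N hπ, lineEquiv_coord, lineEquiv_aeval, X_comp]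
  have := isDomain_tensor (E := E) η
  let Δ : VecGrp E V →ₐ[E] VecGrp E V ⊗[E] VecGrp E V :=
    ((Algebra.TensorProduct.map g.toAlgHom g.toAlgHom).comp (Bialgebra.comulAlgHom E Q)).comp
      g.symm.toAlgHom
  let ε := Bialgebra.counitAlgHom E (VecGrp E V)
  have hεQ : ε.comp g.toAlgHom = Bialgebra.counitAlgHom E Q := by
    ext a
    have := hcounit (g a)
    rw [g.symm_apply_apply] at this
    exact this.symm
  -- the standard comultiplication of the coordinate
  set Z : VecGrp E V ⊗[E] VecGrp E V := coord η ⊗ₜ[E] 1 + 1 ⊗ₜ[E] coord η with hZ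
  have hNZ : aeval Z N = aeval (coord η) N ⊗ₜ[E] 1 + 1 ⊗ₜ[E] aeval (coord η) N := by
    rw [hZ, hN.aeval_add]
    congr 1
    · exact aeval_algHom_apply
        (Algebra.TensorProduct.includeLeft : VecGrp E V →ₐ[E] _) (coord η) N
    · exact aeval_algHom_apply
        (Algebra.TensorProduct.includeRight : VecGrp E V →ₐ[E] _) (coord η) N
  have hΔN : aeval (Δ (coord η)) N = aeval Z N := by
    rw [hNZ, aeval_algHom_apply, hNy]
    have h1 : g.symm (π (coord η')) = π' (coord η') := by rw [← hg, g.symm_apply_apply]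
    change Algebra.TensorProduct.map g.toAlgHom g.toAlgHom
      (Coalgebra.comul (R := E) (g.symm (π (coord η')))) = _
    have h2 : Coalgebra.comul (R := E) (π' (coord η')) =
        π' (coord η') ⊗ₜ[E] 1 + 1 ⊗ₜ[E] π' (coord η') := by
      rw [← CoalgHomClass.map_comp_comul_apply, comul_coord]
      simp
    rw [h1, h2, map_add, Algebra.TensorProduct.map_tmul, Algebra.TensorProduct.map_tmul, map_one]
    change g (π' (coord η')) ⊗ₜ[E] 1 + 1 ⊗ₜ[E] g (π' (coord η')) = _
    rw [hg]
  have hroot : aeval (Δ (coord η) - Z) N = 0 := by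
    have h := hN.aeval_add (Δ (coord η) - Z) Z
    rw [sub_add_cancel, hΔN] at h
    exact left_eq_add.mp ((add_comm (aeval Z N) _).symm ▸ h)
  obtain ⟨σ, hσ⟩ : ∃ σ, Δ (coord η) = Z + algebraMap E _ (c σ) := by
    rw [hNdef, map_mul, aeval_C, map_prod, mul_eq_zero] at hroot
    rcases hroot with h | h
    · exact absurd ((map_eq_zero_iff _ (algebraMap E _).injective).mp h) hu
    · obtain ⟨σ, -, h⟩ := Finset.prod_eq_zero_iff.mp h
      refine ⟨σ, ?_⟩
      rw [map_sub, aeval_X, aeval_C] at h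
      linear_combination h
  -- the root is the value of both sides at the origin
  have hcσ : c σ = 0 := by
    have h1 : (Algebra.TensorProduct.lmul' E).comp (Algebra.TensorProduct.map ε ε) (Δ (coord η)) =
        ε (coord η) := by
      have h2 : ((Algebra.TensorProduct.lmul' E (S := E)).comp (Algebra.TensorProduct.map ε ε)).comp
          ((Algebra.TensorProduct.map g.toAlgHom g.toAlgHom).comp (Bialgebra.comulAlgHom E Q)) =
          Bialgebra.counitAlgHom E Q := by
        rw [AlgHom.comp_assoc, ← AlgHom.comp_assoc _ (Algebra.TensorProduct.map g.toAlgHom _),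
          ← Algebra.TensorProduct.map_comp, hεQ]
        ext a
        have h3 := Coalgebra.rTensor_counit_comul (R := E) a
        have h4 : Algebra.TensorProduct.map (Bialgebra.counitAlgHom E Q)
            (Bialgebra.counitAlgHom E Q) (Coalgebra.comul (R := E) a) =
            1 ⊗ₜ[E] Coalgebra.counit (R := E) a := by
          have h5 : Algebra.TensorProduct.map (Bialgebra.counitAlgHom E Q)
              (Bialgebra.counitAlgHom E Q) =
              (Algebra.TensorProduct.map (AlgHom.id E E) (Bialgebra.counitAlgHom E Q)).comp
                (Algebra.TensorProduct.map (Bialgebra.counitAlgHom E Q) (AlgHom.id E Q)) := by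
            rw [← Algebra.TensorProduct.map_comp]; rfl
          rw [h5, AlgHom.comp_apply]
          have h6 : Algebra.TensorProduct.map (Bialgebra.counitAlgHom E Q) (AlgHom.id E Q)
              (Coalgebra.comul (R := E) a) = 1 ⊗ₜ[E] a := h3
          rw [h6]
          simp
        change Algebra.TensorProduct.lmul' E (Algebra.TensorProduct.map
          (Bialgebra.counitAlgHom E Q) (Bialgebra.counitAlgHom E Q)
            (Coalgebra.comul (R := E) a)) = Coalgebra.counit (R := E) a
        rw [h4]
        simp
      have h3 := DFunLike.congr_fun h2 (g.symm (coord η))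
      have h4 : Bialgebra.counitAlgHom E Q (g.symm (coord η)) = ε (coord η) := hcounit _
      rw [h4] at h3
      exact h3
    have hε0 : ε (coord η) = 0 := counit_coord η
    rw [hσ, hε0, map_add, hZ, map_add] at h1
    have h7 : ∀ a b : VecGrp E V, (Algebra.TensorProduct.lmul' E).comp
        (Algebra.TensorProduct.map ε ε) (a ⊗ₜ[E] b) = ε a * ε b := fun a b => by simp
    rw [h7, h7, hε0, AlgHom.commutes] at h1
    simpa using h1
  have hΔ : Δ = Bialgebra.comulAlgHom E (VecGrp E V) := by
    refine algHom_ext_coord η ?_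
    rw [hσ, hcσ, map_zero, add_zero, hZ]
    exact (comul_coord η).symm
  refine ⟨BialgEquiv.ofAlgEquiv g ?_ ?_, fun a => rfl⟩
  · exact hεQ
  · have h := congrArg (fun φ => AlgHom.comp φ g.toAlgHom) hΔ
    simp only [Δ] at h
    rw [AlgHom.comp_assoc] at h
    have h8 : g.symm.toAlgHom.comp g.toAlgHom = AlgHom.id E Q := by ext; simp
    rw [h8, AlgHom.comp_id] at h
    exact h

end TotRam.VecGrp

/-! ### Traces and norms for a group with a single ramification break -/

/-- A finite group `H` acts on a discrete valuation ring `B` with uniformizer `α` in such a way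
that the residue field is generated by fixed elements and that every `σ ≠ 1` satisfies
`v(σ α - α) = i + 1`. Thus `i` is the only break of the lower ramification filtration. -/
structure HasSingleBreak {B : Type*} [CommRing B] (H : Type*) [Group H]
    [MulSemiringAction H B] (α : B) (i : ℕ) : Prop where
  irreducible : Irreducible α
  associated : ∀ σ : H, σ ≠ 1 → Associated (α - σ • α) (α ^ (i + 1))
  exists_fixed : ∀ b : B, ∃ a : B, (∀ σ : H, σ • a = a) ∧ α ∣ b - a

namespace HasSingleBreak

variable {B : Type*} [CommRing B] [IsDomain B] [IsDiscreteValuationRing B]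
  {H : Type*} [Group H] [MulSemiringAction H B] {α : B} {i : ℕ}

theorem subgroup (h : HasSingleBreak H α i) (H' : Subgroup H) : HasSingleBreak H' α i where
  irreducible := h.irreducible
  associated σ hσ := h.associated σ (by simpa using hσ)
  exists_fixed b := by
    obtain ⟨a, ha, hb⟩ := h.exists_fixed b
    exact ⟨a, fun σ => ha σ, hb⟩

theorem smul_associated (h : HasSingleBreak H α i) (σ : H) : Associated (σ • α) α :=
  IsDiscreteValuationRing.associated_of_irreducible B
    ((MulEquiv.irreducible_iff (MulSemiringAction.toRingEquiv H B σ)).mpr h.irreducible)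
    h.irreducible

theorem smul_ne (h : HasSingleBreak H α i) {σ : H} (hσ : σ ≠ 1) : σ • α ≠ α := by
  intro he
  have h1 := h.associated σ hσ
  rw [he, sub_self] at h1
  exact h.irreducible.ne_zero (pow_eq_zero_iff (Nat.succ_ne_zero i) |>.mp
    ((associated_zero_iff_eq_zero _).mp h1.symm))

theorem smul_injective (h : HasSingleBreak H α i) : Function.Injective fun σ : H => σ • α := by
  intro σ τ he
  by_contra hne
  refine h.smul_ne (σ := τ⁻¹ * σ) (fun h1 => hne (inv_mul_eq_one.mp h1).symm) ?_
  have he' : σ • α = τ • α := he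
  rw [mul_smul, he', inv_smul_smul]

/-- Polynomials in the uniformizer with fixed coefficients are dense. -/
theorem exists_polynomial (h : HasSingleBreak H α i) (N : ℕ) (b : B) :
    ∃ p : B[X], (∀ σ : H, σ • p.eval α = p.eval (σ • α)) ∧ α ^ N ∣ b - p.eval α := by
  induction N generalizing b with
  | zero => exact ⟨0, by simp, by simp⟩
  | succ N ih =>
    obtain ⟨a, ha, c, hc⟩ := h.exists_fixed b
    obtain ⟨p, hp, d, hd⟩ := ih c
    refine ⟨C a + X * p, fun σ => ?_, d, ?_⟩
    · simp [smul_add, ha, hp]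
    · simp only [eval_add, eval_C, eval_mul, eval_X]
      linear_combination hc + α * hd

section Fintype

variable [Fintype H] [DecidableEq H]

variable (H α) in
/-- The value `g'(α)` of the derivative of `g = ∏ (X - σ α)`. -/
def different : B := ∏ σ ∈ Finset.univ.erase (1 : H), (α - σ • α)

theorem smul_different (σ : H) :
    σ • different H α = ∏ τ ∈ Finset.univ.erase σ, (σ • α - τ • α) := by
  rw [different, Finset.smul_prod']
  refine Finset.prod_bij (fun τ _ => σ * τ) (fun τ hτ => ?_) (fun _ _ _ _ h => mul_left_cancel h)
    (fun τ hτ => ⟨σ⁻¹ * τ, ?_, by simp⟩) (fun τ _ => ?_)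
  · simpa using hτ
  · simp only [Finset.mem_erase, Finset.mem_univ, and_true] at hτ ⊢
    exact fun h => hτ (inv_mul_eq_one.mp h).symm
  · rw [smul_sub, mul_smul]

theorem different_associated (h : HasSingleBreak H α i) :
    Associated (different H α) (α ^ ((i + 1) * (Fintype.card H - 1))) := by
  have h1 : Associated (different H α) (∏ _σ ∈ Finset.univ.erase (1 : H), α ^ (i + 1)) :=
    Associated.prod _ _ _ fun σ hσ => h.associated σ (Finset.ne_of_mem_erase hσ)
  rwa [Finset.prod_const, Finset.card_erase_of_mem (Finset.mem_univ _), Finset.card_univ,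
    ← pow_mul] at h1

theorem prod_smul_associated (h : HasSingleBreak H α i) :
    Associated (∏ σ : H, σ • α) (α ^ Fintype.card H) := by
  have h1 : Associated (∏ σ : H, σ • α) (∏ _σ : H, α) :=
    Associated.prod _ _ _ fun σ _ => h.smul_associated σ
  rwa [Finset.prod_const, Finset.card_univ] at h1

variable (L : Type*) [Field L] [Algebra B L] [IsFractionRing B L]

theorem algebraMap_smul_different_ne_zero (h : HasSingleBreak H α i) (σ : H) :
    algebraMap B L (σ • different H α) ≠ 0 := by
  rw [Ne, FaithfulSMul.algebraMap_eq_zero_iff, smul_different, Finset.prod_eq_zero_iff]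
  rintro ⟨τ, hτ, he⟩
  exact Finset.ne_of_mem_erase hτ (h.smul_injective (sub_eq_zero.mp he)).symm

/-- Lagrange interpolation at the conjugates of `α`: the trace of `p(α)` divided by the different is the
coefficient of degree `|H| - 1` of the remainder of `p`. -/
theorem sum_eval_div_different (h : HasSingleBreak H α i) (p : B[X]) :
    ∑ σ : H, algebraMap B L (p.eval (σ • α)) / algebraMap B L (σ • different H α) =
      algebraMap B L ((p %ₘ ∏ σ : H, (X - C (σ • α))).coeff (Fintype.card H - 1)) := by
  have hmon : (∏ σ : H, (X - C (σ • α))).Monic := monic_prod_of_monic _ _ fun σ _ => monic_X_sub_C _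
  have hdeg : (∏ σ : H, (X - C (σ • α))).degree = ((Fintype.card H : ℕ) : WithBot ℕ) := by
    rw [degree_prod]
    simp
  set r := p %ₘ ∏ σ : H, (X - C (σ • α)) with hr
  have hrd : r.degree < (Fintype.card H : ℕ) := hdeg ▸ degree_modByMonic_lt p hmon
  have heval : ∀ σ : H, p.eval (σ • α) = r.eval (σ • α) := by
    intro σ
    conv_lhs => rw [← modByMonic_add_div p (∏ σ : H, (X - C (σ • α)))]
    have h0 : (∏ σ : H, (X - C (σ • α))).eval (σ • α) = 0 := by
      rw [eval_prod]
      exact Finset.prod_eq_zero (Finset.mem_univ σ) (by simp)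
    rw [eval_add, eval_mul, h0, zero_mul, add_zero]
  have hinj : Function.Injective fun σ : H => algebraMap B L (σ • α) :=
    (FaithfulSMul.algebraMap_injective B L).comp h.smul_injective
  have key := Lagrange.coeff_eq_sum (s := (Finset.univ : Finset H)) hinj.injOn
    (P := r.map (algebraMap B L)) (by
      rw [Finset.card_univ]
      exact lt_of_le_of_lt degree_map_le hrd)
  rw [Finset.card_univ, coeff_map] at key
  rw [key]
  refine Finset.sum_congr rfl fun σ _ => ?_
  rw [heval, smul_different, map_prod, eval_map, eval₂_at_apply]
  simp

/-- Euler's formula: the inverse of `g'(α)` generates a lattice on which the trace is integral. -/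
theorem exists_sum_div_different (h : HasSingleBreak H α i) (b : B) :
    ∃ t : B, ∑ σ : H, algebraMap B L (σ • b) / algebraMap B L (σ • different H α) =
      algebraMap B L t := by
  obtain ⟨u, hu⟩ := h.different_associated
  obtain ⟨p, hp, c, hc⟩ := h.exists_polynomial ((i + 1) * (Fintype.card H - 1)) b
  refine ⟨(p %ₘ ∏ σ : H, (X - C (σ • α))).coeff (Fintype.card H - 1) + ∑ σ : H, σ • (u * c), ?_⟩
  rw [map_add, ← h.sum_eval_div_different L, map_sum, ← Finset.sum_add_distrib]
  refine Finset.sum_congr rfl fun σ _ => ?_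
  have hb : b = p.eval α + different H α * (u * c) := by
    rw [← mul_assoc, hu, ← hc]
    ring
  have hne := h.algebraMap_smul_different_ne_zero L σ
  rw [hb, smul_add, hp, smul_mul', map_add, map_mul]
  field_simp

theorem sum_pow_div_different (h : HasSingleBreak H α i) :
    ∑ σ : H, algebraMap B L (σ • α ^ (Fintype.card H - 1)) /
      algebraMap B L (σ • different H α) = 1 := by
  have hmon : (∏ σ : H, (X - C (σ • α))).Monic := monic_prod_of_monic _ _ fun σ _ => monic_X_sub_C _
  have hdeg : (∏ σ : H, (X - C (σ • α))).degree = ((Fintype.card H : ℕ) : WithBot ℕ) := by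
    rw [degree_prod]
    simp
  have hlt : ((X : B[X]) ^ (Fintype.card H - 1)).degree < (∏ σ : H, (X - C (σ • α))).degree := by
    rw [hdeg, degree_X_pow]
    exact_mod_cast Nat.sub_lt Fintype.card_pos one_pos
  have h1 := h.sum_eval_div_different L (X ^ (Fintype.card H - 1))
  rw [(modByMonic_eq_self_iff hmon).mpr hlt, coeff_X_pow_self, map_one] at h1
  rw [← h1]
  simp [smul_pow']

/-- The trace maps `m ^ n` to the `n`-th power of the maximal ideal of the ring of invariants, whose
ramification index is the order of `H`. -/
theorem pow_dvd_trace (h : HasSingleBreak H α i) {n : ℕ} (hn : n ≤ i + 1) {x : B}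
    (hx : α ^ n ∣ x) : α ^ (n * Fintype.card H) ∣ ∑ σ : H, σ • x := by
  classical
  obtain ⟨s, hs⟩ : ∃ s, Fintype.card H = s + 1 := ⟨_, (Nat.sub_add_cancel Fintype.card_pos).symm⟩
  set ϖ : B := ∏ σ : H, σ • α with hϖ
  have hfix : ∀ τ : H, τ • ϖ = ϖ := by
    intro τ
    rw [hϖ, Finset.smul_prod']
    simp_rw [← mul_smul]
    exact Equiv.prod_comp (Equiv.mulLeft τ) fun σ : H => σ • α
  have hϖn : Associated (ϖ ^ n) (α ^ (n * Fintype.card H)) := by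
    rw [mul_comm, pow_mul]
    exact h.prod_smul_associated.pow_pow
  obtain ⟨b, hb⟩ : ϖ ^ n ∣ x * different H α := by
    rw [hϖn.dvd_iff_dvd_left]
    refine dvd_trans ?_ (mul_dvd_mul hx h.different_associated.symm.dvd)
    rw [← pow_add, hs]
    refine pow_dvd_pow _ ?_
    have := Nat.mul_le_mul_right s hn
    rw [Nat.add_sub_cancel]
    linarith
  obtain ⟨t, ht⟩ := h.exists_sum_div_different (FractionRing B) b
  rw [← hϖn.dvd_iff_dvd_left]
  refine ⟨t, FaithfulSMul.algebraMap_injective B (FractionRing B) ?_⟩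
  rw [map_mul, ← ht, map_sum, Finset.mul_sum]
  refine Finset.sum_congr rfl fun σ _ => ?_
  have h1 := congrArg (fun y => algebraMap B (FractionRing B) (σ • y)) hb
  simp only [smul_mul', smul_pow', hfix, map_mul] at h1
  rw [mul_div_assoc', eq_div_iff (h.algebraMap_smul_different_ne_zero _ σ), h1]

/-- The trace is surjective onto the `n`-th power of the maximal ideal of the ring of invariants. -/
theorem exists_trace_eq (h : HasSingleBreak H α i) {n : ℕ} (hn : i ≤ n) {z : B}
    (hfix : ∀ σ : H, σ • z = z) (hz : α ^ (n * Fintype.card H) ∣ z) :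
    ∃ w : B, α ^ n ∣ w ∧ ∑ σ : H, σ • w = z := by
  classical
  obtain ⟨s, hs⟩ : ∃ s, Fintype.card H = s + 1 := ⟨_, (Nat.sub_add_cancel Fintype.card_pos).symm⟩
  obtain ⟨k, rfl⟩ := Nat.exists_eq_add_of_le hn
  obtain ⟨y, rfl⟩ := hz
  obtain ⟨u, hu⟩ := h.different_associated
  have hw : different H α * (u * α ^ (i + k + k * s) * y) =
      α ^ ((i + k) * Fintype.card H) * y * α ^ (Fintype.card H - 1) := by
    rw [← mul_assoc, ← mul_assoc, hu, hs, Nat.add_sub_cancel]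
    ring
  refine ⟨u * α ^ (i + k + k * s) * y, ?_, ?_⟩
  · exact Dvd.dvd.mul_right (Dvd.dvd.mul_left (pow_dvd_pow _ (Nat.le_add_right _ _)) _) _
  · apply FaithfulSMul.algebraMap_injective B (FractionRing B)
    rw [← mul_one (algebraMap B (FractionRing B) (_ * y)),
      ← h.sum_pow_div_different (FractionRing B), map_sum, Finset.mul_sum]
    refine Finset.sum_congr rfl fun σ _ => ?_
    rw [mul_div_assoc', eq_div_iff (h.algebraMap_smul_different_ne_zero _ σ), ← map_mul, ← map_mul]
    have h1 := congrArg (fun y => σ • y) hw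
    simp only [smul_mul' _ (different H α), smul_mul' _ (_ * y), hfix] at h1
    rw [← h1, mul_comm]

end Fintype

section Norm

open scoped Pointwise

variable [Fintype H] [DecidableEq H]

theorem smul_prod_finset (σ : H) (t : Finset H) (x : B) :
    σ • ∏ τ ∈ t, τ • x = ∏ τ ∈ σ • t, τ • x := by
  rw [Finset.smul_prod', Finset.smul_finset_def, Finset.prod_image (MulAction.injective σ).injOn]
  simp_rw [smul_eq_mul, mul_smul]

theorem card_stabilizer_le {t : Finset H} (ht : t.Nonempty) :
    Nat.card (MulAction.stabilizer H t) ≤ t.card := by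
  obtain ⟨a, ha⟩ := ht
  have hmem : ∀ σ : MulAction.stabilizer H t, (σ : H) * a ∈ t := by
    intro σ
    have h := MulAction.mem_stabilizer_iff.mp σ.2
    have h' := Finset.smul_mem_smul_finset (a := (σ : H)) ha
    rwa [h] at h'
  rw [← Nat.card_eq_finsetCard t]
  exact Nat.card_le_card_of_injective (fun σ => (⟨(σ : H) * a, hmem σ⟩ : t)) fun σ τ hστ =>
    Subtype.ext (mul_right_cancel (congrArg Subtype.val hστ))

/-- The contribution of one orbit of `H` on the sets of `k` elements to the `k`-th elementary
symmetric function of the conjugates of `x` is a trace: the product over a set is a trace from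
its stabilizer, to which the surjectivity of the trace applies. -/
theorem pow_dvd_sum_orbit (h : HasSingleBreak H α i) {n : ℕ} (hin : i ≤ n) (hn : n ≤ i + 1) {x : B}
    (hx : α ^ n ∣ x) (s : Finset (Finset H)) {t : Finset H} (ht : t.Nonempty)
    (hs : ∀ y, y ∈ s ↔ ∃ σ : H, σ • t = y) :
    α ^ (n * Fintype.card H) ∣ ∑ y ∈ s, ∏ τ ∈ y, τ • x := by
  classical
  let S := MulAction.stabilizer H t
  have : Fintype S := Fintype.ofFinite S
  have hfix : ∀ σ : S, σ • ∏ τ ∈ t, τ • x = ∏ τ ∈ t, τ • x := by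
    intro σ
    rw [Subgroup.smul_def, smul_prod_finset, MulAction.mem_stabilizer_iff.mp σ.2]
  have hdvd : α ^ (n * Fintype.card S) ∣ ∏ τ ∈ t, τ • x := by
    have h1 : α ^ (n * t.card) ∣ ∏ τ ∈ t, τ • x := by
      rw [pow_mul, ← Finset.prod_const]
      refine Finset.prod_dvd_prod_of_dvd _ _ fun τ _ => ?_
      obtain ⟨y, rfl⟩ := hx
      rw [smul_mul', smul_pow']
      exact Dvd.dvd.mul_right ((h.smul_associated τ).pow_pow.symm.dvd) _
    refine dvd_trans (pow_dvd_pow _ (Nat.mul_le_mul_left n ?_)) h1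
    rw [← Nat.card_eq_fintype_card]
    exact card_stabilizer_le ht
  obtain ⟨w, hw, hwt⟩ := (h.subgroup S).exists_trace_eq hin hfix hdvd
  have key : ∑ y ∈ s, ∏ τ ∈ y, τ • x = ∑ σ : H, σ • w := by
    rw [← Finset.sum_fiberwise_of_maps_to (s := (Finset.univ : Finset H)) (t := s)
      (g := fun σ => σ • t) fun σ _ => (hs _).mpr ⟨σ, rfl⟩]
    refine Finset.sum_congr rfl fun y hy => ?_
    obtain ⟨σ, rfl⟩ := (hs y).mp hy
    rw [← smul_prod_finset, ← hwt, Finset.smul_sum]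
    refine Finset.sum_bij (fun τ _ => σ * (τ : H)) (fun τ _ => ?_)
      (fun τ _ τ' _ hτ => Subtype.ext (mul_left_cancel hτ)) (fun τ hτ => ?_) (fun τ _ => ?_)
    · rw [Finset.mem_filter, mul_smul, MulAction.mem_stabilizer_iff.mp τ.2]
      exact ⟨Finset.mem_univ _, rfl⟩
    · refine ⟨⟨σ⁻¹ * τ, ?_⟩, Finset.mem_univ _, by simp⟩
      rw [MulAction.mem_stabilizer_iff, mul_smul, (Finset.mem_filter.mp hτ).2, inv_smul_smul]
    · rw [mul_smul, Subgroup.smul_def]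
  rw [key]
  exact h.pow_dvd_trace hn hw

/-- All nonconstant coefficients of the norm of `1 + t x`, for `x ∈ m ^ n`, are in the `n`-th power
of the maximal ideal of the ring of invariants. -/
theorem pow_dvd_coeff_norm (h : HasSingleBreak H α i) {n : ℕ} (hin : i ≤ n) (hn : n ≤ i + 1) {x : B}
    (hx : α ^ n ∣ x) {k : ℕ} (hk : k ≠ 0) :
    α ^ (n * Fintype.card H) ∣ (∏ σ : H, (1 + X * C (σ • x))).coeff k := by
  classical
  have h1 : (∏ σ : H, (1 + X * C (σ • x))).coeff k =
      ∑ t ∈ Finset.powersetCard k (Finset.univ : Finset H), ∏ τ ∈ t, τ • x := by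
    rw [Finset.prod_one_add, finsetSum_coeff, Finset.powersetCard_eq_filter, Finset.sum_filter]
    refine Finset.sum_congr rfl fun t _ => ?_
    rw [Finset.prod_mul_distrib, Finset.prod_const, ← map_prod, mul_comm, coeff_C_mul_X_pow]
    simp [eq_comm]
  rw [h1, Finset.sum_partition (MulAction.orbitRel H (Finset H))]
  refine Finset.dvd_sum fun y hy => ?_
  obtain ⟨t, ht, rfl⟩ := Finset.mem_image.mp hy
  have ht' := (Finset.mem_powersetCard.mp ht).2
  refine h.pow_dvd_sum_orbit hin hn hx _ (t := t) ?_ fun y => ?_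
  · rw [← Finset.card_pos, ht']
    exact Nat.pos_of_ne_zero hk
  · rw [Finset.mem_filter, Quotient.eq]
    refine ⟨fun hy => hy.2, ?_⟩
    rintro ⟨σ, rfl⟩
    refine ⟨?_, σ, rfl⟩
    rw [Finset.mem_powersetCard, Finset.card_smul_finset]
    exact ⟨Finset.subset_univ _, ht'⟩

end Norm

end HasSingleBreak

/-! ### The discs around the conjugates of the uniformizer -/

/-- A finite group `G` acts on a discrete valuation ring `B` with uniformizer `α`, the residue field
is generated by fixed elements, and `i` is the last break of the ramification filtration:
`H` is the last nontrivial ramification group, `v(σ α - α) ≥ i + 1` exactly for `σ ∈ H`, with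
equality for `σ ≠ 1`. -/
structure HasLastBreak {B : Type*} [CommRing B] {G : Type*} [Group G]
    [MulSemiringAction G B] (H : Subgroup G) (α : B) (i : ℕ) : Prop where
  irreducible : Irreducible α
  mem_iff : ∀ σ : G, σ ∈ H ↔ α ^ (i + 1) ∣ α - σ • α
  associated : ∀ σ ∈ H, σ ≠ 1 → Associated (α - σ • α) (α ^ (i + 1))
  exists_fixed : ∀ b : B, ∃ a : B, (∀ σ : G, σ • a = a) ∧ α ∣ b - a

namespace HasLastBreak

variable {B : Type*} [CommRing B] [IsDomain B] [IsDiscreteValuationRing B]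
  {G : Type*} [Group G] [MulSemiringAction G B] {H : Subgroup G} {α : B} {i : ℕ}

theorem hasSingleBreak (h : HasLastBreak H α i) : HasSingleBreak H α i where
  irreducible := h.irreducible
  associated σ hσ := h.associated σ σ.2 (by simpa using hσ)
  exists_fixed b := by
    obtain ⟨a, ha, hb⟩ := h.exists_fixed b
    exact ⟨a, fun σ => ha σ, hb⟩

theorem smul_associated (h : HasLastBreak H α i) (σ : G) (x : B) : Associated (σ • x) x := by
  rcases eq_or_ne x 0 with rfl | hx
  · simp
  obtain ⟨n, hn⟩ := IsDiscreteValuationRing.associated_pow_irreducible hx h.irreducible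
  have h1 : Associated (σ • α) α := IsDiscreteValuationRing.associated_of_irreducible B
    ((MulEquiv.irreducible_iff (MulSemiringAction.toRingEquiv G B σ)).mpr h.irreducible)
    h.irreducible
  have h2 : Associated (σ • x) (σ • α ^ n) :=
    hn.map (MulSemiringAction.toRingHom G B σ)
  rw [smul_pow'] at h2
  exact (h2.trans h1.pow_pow).trans hn.symm

theorem pow_dvd_smul_sub_smul_iff (h : HasLastBreak H α i) (σ τ : G) :
    σ⁻¹ * τ ∈ H ↔ α ^ (i + 1) ∣ σ • α - τ • α := by
  have : σ • α - τ • α = σ • (α - (σ⁻¹ * τ) • α) := by rw [smul_sub, smul_smul, mul_inv_cancel_left]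
  rw [h.mem_iff, this, (h.smul_associated σ _).dvd_iff_dvd_right]

variable (H α i) in
open Classical in
/-- A generator of the ideal `(σ α - τ α, α ^ (i + 1))`. -/
noncomputable def gap (σ τ : G) : B := if σ⁻¹ * τ ∈ H then α ^ (i + 1) else σ • α - τ • α

theorem mul_sub_dvd_pow (h : HasLastBreak H α i) {σ τ : G} (hστ : σ⁻¹ * τ ∉ H) :
    α * (σ • α - τ • α) ∣ α ^ (i + 1) := by
  rw [h.pow_dvd_smul_sub_smul_iff] at hστ
  have h0 : σ • α - τ • α ≠ 0 := fun h0 => hστ (h0 ▸ dvd_zero _)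
  obtain ⟨n, hn⟩ := IsDiscreteValuationRing.associated_pow_irreducible h0 h.irreducible
  rw [hn.dvd_iff_dvd_right, pow_dvd_pow_iff h.irreducible.ne_zero h.irreducible.not_isUnit] at hστ
  rw [(hn.mul_left α).dvd_iff_dvd_left, ← pow_succ']
  exact pow_dvd_pow _ (by omega)

theorem gap_dvd_pow (h : HasLastBreak H α i) (σ τ : G) : gap H α i σ τ ∣ α ^ (i + 1) := by
  unfold gap
  split_ifs with hστ
  · exact dvd_rfl
  · exact (Dvd.intro_left _ rfl).trans (h.mul_sub_dvd_pow hστ)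

theorem gap_dvd_sub (h : HasLastBreak H α i) (σ τ : G) : gap H α i σ τ ∣ σ • α - τ • α := by
  unfold gap
  split_ifs with hστ
  · exact (h.pow_dvd_smul_sub_smul_iff σ τ).mp hστ
  · exact dvd_rfl

theorem gap_ne_zero (h : HasLastBreak H α i) (σ τ : G) : gap H α i σ τ ≠ 0 :=
  fun h0 => pow_ne_zero (i + 1) h.irreducible.ne_zero
    (zero_dvd_iff.mp (h0 ▸ h.gap_dvd_pow σ τ))

theorem gap_smul_associated (h : HasLastBreak H α i) (σ τ : G) :
    Associated (gap H α i σ (σ * τ)) (gap H α i 1 τ) := by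
  by_cases hτ : τ ∈ H
  · rw [gap, gap, if_pos (by simpa using hτ), if_pos (by simpa using hτ)]
  · rw [gap, gap, if_neg (by simpa using hτ), if_neg (by simpa using hτ), one_smul, mul_smul,
      ← smul_sub]
    exact h.smul_associated _ _

variable [Fintype G]

theorem prod_gap_associated (h : HasLastBreak H α i) (σ : G) :
    Associated (∏ τ, gap H α i σ τ) (∏ τ, gap H α i 1 τ) := by
  rw [← Equiv.prod_comp (Equiv.mulLeft σ)]
  exact Associated.prod _ _ _ fun τ _ => h.gap_smul_associated σ τ

/-! #### Factors of `∏ (X - τ α)` in the coordinate of a disc -/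

variable (α i) in
/-- The coordinate `σ α + α ^ (i + 1) Y` of the disc around `σ α`. -/
noncomputable def discCoord (σ : G) : B[X] := C (σ • α) + C (α ^ (i + 1)) * X

theorem C_gap_dvd (h : HasLastBreak H α i) (σ τ : G) :
    C (gap H α i σ τ) ∣ discCoord α i σ - C (τ • α) := by
  have : discCoord α i σ - C (τ • α) = C (σ • α - τ • α) + C (α ^ (i + 1)) * X := by
    rw [discCoord, C_sub]; ring
  rw [this]
  exact dvd_add (map_dvd C (h.gap_dvd_sub σ τ)) (Dvd.dvd.mul_right (map_dvd C (h.gap_dvd_pow σ τ)) _)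

theorem C_pow_dvd_prod (h : HasLastBreak H α i) {m : ℕ}
    (hm : Associated (∏ τ : G, gap H α i 1 τ) (α ^ m)) (σ : G) :
    C (α ^ m) ∣ ∏ τ : G, (discCoord α i σ - C (τ • α)) := by
  have h1 : C (∏ τ, gap H α i σ τ) ∣ ∏ τ : G, (discCoord α i σ - C (τ • α)) := by
    rw [map_prod]
    exact Finset.prod_dvd_prod_of_dvd _ _ fun τ _ => h.C_gap_dvd σ τ
  exact (map_dvd C ((h.prod_gap_associated σ).trans hm).symm.dvd).trans h1

section Residue

/-- Off the group `H` the factors of `∏ (X - τ α)` are constant on the disc around `α`, up to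
smaller terms. -/
theorem exists_prod_not_mem (h : HasLastBreak H α i) (s : Finset G) (hs : ∀ τ ∈ s, τ ∉ H) :
    ∃ p : B[X], ∏ τ ∈ s, (discCoord α i (1 : G) - C (τ • α)) =
      C (∏ τ ∈ s, (α - τ • α)) * p ∧ p.map (residue B) = 1 := by
  classical
  have h1 : ∀ τ, ∃ y, τ ∉ H → α ^ (i + 1) = α * (α - τ • α) * y := by
    intro τ
    by_cases hτ : τ ∈ H
    · exact ⟨0, fun h => absurd hτ h⟩
    · obtain ⟨y, hy⟩ := h.mul_sub_dvd_pow (σ := 1) (τ := τ) (by simpa using hτ)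
      exact ⟨y, fun _ => by simpa using hy⟩
  choose y hy using h1
  refine ⟨∏ τ ∈ s, (1 + C α * C (y τ) * X), ?_, ?_⟩
  · rw [map_prod, ← Finset.prod_mul_distrib]
    refine Finset.prod_congr rfl fun τ hτ => ?_
    rw [discCoord, one_smul, hy τ (hs τ hτ)]
    simp only [C_mul, C_sub]
    ring
  · have hα : residue B α = 0 := by
      rw [residue_eq_zero_iff, h.irreducible.maximalIdeal_eq]
      exact Ideal.mem_span_singleton_self α
    rw [Polynomial.map_prod]
    exact Finset.prod_eq_one fun τ _ => by simp [hα]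

end Residue

end HasLastBreak

/-! ### The normalization of the dilatation -/

section Normalization

open HasLastBreak

variable {A K L B : Type*} [CommRing A] [Field K] [Field L] [CommRing B]
  [Algebra A K] [IsFractionRing A K] [Algebra K L] [Algebra A L] [IsScalarTower A K L]
  [Algebra A B] [Algebra B L] [IsScalarTower A B L] [IsIntegralClosure B A L]
  [IsDomain B] [IsDiscreteValuationRing B] [IsFractionRing B L]
  {G : Type*} [Group G] [Fintype G] [MulSemiringAction G B] {H : Subgroup G} {α : B} {i m : ℕ}

variable (B L) in
/-- Polynomials with coefficients in `B`, inside `L[X]`. -/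
noncomputable def integralPolys : Subalgebra B L[X] := (mapAlgHom (Algebra.ofId B L)).range

theorem mem_integralPolys {q : L[X]} :
    q ∈ integralPolys L B ↔ ∃ p : B[X], p.map (algebraMap B L) = q := Iff.rfl

theorem map_mem_integralPolys (p : B[X]) : p.map (algebraMap B L) ∈ integralPolys L B := ⟨p, rfl⟩

variable (L α i) in
/-- Restriction of polynomials to the disc around `σ α`. -/
noncomputable def disc (σ : G) : L[X] →ₐ[L] L[X] :=
  aeval ((discCoord α i σ).map (algebraMap B L))

theorem disc_map (σ : G) (p : B[X]) :
    disc L α i σ (p.map (algebraMap B L)) = (p.comp (discCoord α i σ)).map (algebraMap B L) := by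
  rw [disc, Polynomial.map_comp, comp_eq_aeval]

variable (hf : (minpoly A α).map (algebraMap A L) = ∏ σ : G, (X - C (algebraMap B L (σ • α))))
  (hm : Associated (∏ τ : G, gap H α i 1 τ) (α ^ m))

include hf

theorem minpoly_eq_map :
    (minpoly A α).map (algebraMap A L) = (∏ σ : G, (X - C (σ • α))).map (algebraMap B L) := by
  rw [hf, Polynomial.map_prod]
  simp

include hm

theorem disc_generator_mem (h : HasLastBreak H α i) (σ : G) :
    ∃ p : B[X], C (α ^ m) * p = ∏ τ : G, (discCoord α i σ - C (τ • α)) ∧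
      disc L α i σ (C ((algebraMap B L α ^ m)⁻¹) * (minpoly A α).map (algebraMap A L)) =
        p.map (algebraMap B L) := by
  obtain ⟨p, hp⟩ := h.C_pow_dvd_prod hm σ
  refine ⟨p, hp.symm, ?_⟩
  have hα : algebraMap B L α ^ m ≠ 0 :=
    pow_ne_zero _ ((FaithfulSMul.algebraMap_eq_zero_iff B L).not.mpr h.irreducible.ne_zero)
  rw [map_mul, minpoly_eq_map hf, disc_map, prod_comp]
  simp only [sub_comp, X_comp, C_comp]
  rw [hp, Polynomial.map_mul, disc, aeval_C, ← C_eq_algebraMap, Polynomial.map_C, ← mul_assoc, ← C_mul,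
    map_pow, inv_mul_cancel₀ hα, C_1, one_mul]

theorem disc_mem_of_mem_normalization (h : HasLastBreak H α i) (σ : G) {q : L[X]}
    (hq : q ∈ normalization A L B α m) : disc L α i σ q ∈ integralPolys L B := by
  have hD : ∀ d ∈ dilatation A L B α m, disc L α i σ d ∈ integralPolys L B := by
    suffices dilatation A L B α m ≤
        (integralPolys L B).comap ((disc L α i σ).restrictScalars B) from fun d hd => this hd
    refine Algebra.adjoin_le ?_
    rintro x (rfl | rfl)
    · exact ⟨discCoord α i σ, (aeval_X _).symm⟩
    · obtain ⟨p, -, hp⟩ := disc_generator_mem hf hm h σ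
      exact ⟨p, hp.symm⟩
  have hq' : IsIntegral (dilatation A L B α m) q := hq
  have h2 : IsIntegral (integralPolys L B) (disc L α i σ q) := by
    refine hq'.map_of_comp_eq
      (((((disc L α i σ).restrictScalars B).comp (dilatation A L B α m).val).codRestrict
        (integralPolys L B) fun d => hD d d.2) : _ →+* _) (disc L α i σ : L[X] →+* L[X]) ?_
    ext d
    rfl
  let _ : Algebra B[X] L[X] := Polynomial.algebra B L
  have h3 : IsIntegral B[X] (disc L α i σ q) := by
    obtain ⟨P, hP, hP0⟩ := h2
    let e : B[X] →+* integralPolys L B :=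
      ((mapAlgHom (Algebra.ofId B L)).rangeRestrict : B[X] →ₐ[B] integralPolys L B).toRingHom
    have he : Function.Surjective e := (mapAlgHom (Algebra.ofId B L)).rangeRestrict_surjective
    obtain ⟨P', rfl, -, hP'⟩ := lifts_and_degree_eq_and_monic (mem_lifts_of_surjective he P) hP
    refine ⟨P', hP', ?_⟩
    rw [eval₂_map] at hP0
    exact hP0
  rw [isIntegral_iff_isIntegral_coeff] at h3
  have h4 : disc L α i σ q ∈ lifts (algebraMap B L) := by
    rw [lifts_iff_coeff_lifts]
    exact fun n => IsIntegrallyClosed.isIntegral_iff.mp (h3 n)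
  exact (mem_lifts _).mp h4

/-- A polynomial that is integral on the discs around all conjugates of `α` is integral over the
dilatation: by the valuative criterion it suffices that in every valuation ring containing the
dilatation `X` lies in one of the discs, and this is the disc around a closest conjugate. -/
theorem mem_normalization_of_disc_mem (h : HasLastBreak H α i) {q : L[X]}
    (hq : ∀ σ : G, disc L α i σ q ∈ integralPolys L B) : q ∈ normalization A L B α m := by
  classical
  let φ : L[X] →+* RatFunc L := algebraMap L[X] (RatFunc L)
  have hφ : Function.Injective φ := RatFunc.algebraMap_injective L
  let ψ : dilatation A L B α m →+* RatFunc L := φ.comp (dilatation A L B α m).val.toRingHom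
  have hψ : Function.Injective ψ := hφ.comp Subtype.val_injective
  have key : φ q ∈ (⨅ V : {V : ValuationSubring (RatFunc L) //
      (ψ.range : Set (RatFunc L)) ⊆ V.toSubring}, V.1.toSubring) := by
    rw [Subring.mem_iInf]
    rintro ⟨V, hV⟩
    change φ q ∈ V
    have hBV : ∀ b : B, φ (C (algebraMap B L b)) ∈ V := fun b =>
      hV ⟨algebraMap B _ b, rfl⟩
    have hXV : φ X ∈ V := hV ⟨⟨X, Algebra.subset_adjoin (by simp)⟩, rfl⟩
    have hSV : φ (C ((algebraMap B L α ^ m)⁻¹) * (minpoly A α).map (algebraMap A L)) ∈ V :=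
      hV ⟨⟨_, Algebra.subset_adjoin (Set.mem_insert_of_mem _ (Set.mem_singleton _))⟩, rfl⟩
    let b : B → RatFunc L := fun x => φ (C (algebraMap B L x))
    have hb0 : ∀ x, x ≠ 0 → b x ≠ 0 := by
      intro x hx
      rw [Ne, map_eq_zero_iff φ hφ, C_eq_zero, FaithfulSMul.algebraMap_eq_zero_iff]
      exact hx
    let ξ : G → RatFunc L := fun σ => φ X - b (σ • α)
    have hξ0 : ∀ σ, ξ σ ≠ 0 := by
      intro σ
      have h1 : ξ σ = φ (X - C (algebraMap B L (σ • α))) := (map_sub φ _ _).symm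
      rw [h1, Ne, map_eq_zero_iff φ hφ]
      exact X_sub_C_ne_zero _
    obtain ⟨σ, hσ⟩ : ∃ σ : G, ξ σ / b (α ^ (i + 1)) ∈ V := by
      by_contra hcon
      push Not at hcon
      -- For the conjugate `σ α` nearest to `X`, every `gap σ τ / (X - τ α)` lies in `V`. Their product
      -- is, up to a unit of `B`, the inverse of `f / α ^ m`, which lies in `V`;
      -- so every factor is a unit of `V`, in particular `α ^ (i + 1) / (X - σ α)`.
      obtain ⟨σ, -, hσ⟩ := Finset.exists_min_image Finset.univ (fun σ => V.valuation (ξ σ))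
        ⟨(1 : G), Finset.mem_univ _⟩
      refine hcon σ ?_
      have hdiv : ∀ τ, b (gap H α i σ τ) / ξ τ ∈ V := by
        intro τ
        by_cases hτ : σ⁻¹ * τ ∈ H
        · have h1 := (V.mem_or_inv_mem (ξ τ / b (α ^ (i + 1)))).resolve_left (hcon τ)
          rw [inv_div] at h1
          rw [gap, if_pos hτ]
          exact h1
        · rw [gap, if_neg hτ]
          have h1 : b (σ • α - τ • α) / ξ τ = 1 - ξ σ / ξ τ := by
            have h2 : b (σ • α - τ • α) = ξ τ - ξ σ := by simp [ξ, b]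
            rw [h2, sub_div, div_self (hξ0 τ)]
          rw [h1]
          refine sub_mem V.one_mem ?_
          rw [← V.valuation_le_one_iff, map_div₀]
          exact div_le_one_of_le₀ (hσ τ (Finset.mem_univ τ)) zero_le
      obtain ⟨u, hu⟩ := (h.prod_gap_associated σ).trans hm
      have hprod : φ (C ((algebraMap B L α ^ m)⁻¹) * (minpoly A α).map (algebraMap A L)) *
          b u * ∏ τ, (b (gap H α i σ τ) / ξ τ) = 1 := by
        have hu' : (∏ τ, b (gap H α i σ τ)) * b u = b (α ^ m) := by
          rw [← hu]
          simp [b]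
        have hm' : φ (C ((algebraMap B L α ^ m)⁻¹)) * b (α ^ m) = 1 := by
          have h3 : algebraMap B L α ^ m ≠ 0 := pow_ne_zero _
            ((FaithfulSMul.algebraMap_eq_zero_iff B L).not.mpr h.irreducible.ne_zero)
          rw [← map_mul, ← C_mul, map_pow, inv_mul_cancel₀ h3, C_1, map_one]
        have hξ : φ ((minpoly A α).map (algebraMap A L)) = ∏ τ, ξ τ := by
          rw [hf, map_prod]
          simp [ξ, b]
        have hξp : (∏ τ, ξ τ) ≠ 0 := Finset.prod_ne_zero_iff.mpr fun τ _ => hξ0 τ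
        rw [Finset.prod_div_distrib, map_mul, hξ]
        generalize φ (C ((algebraMap B L α ^ m)⁻¹)) = t at hm' ⊢
        field_simp
        rw [mul_assoc, mul_comm (b u), hu', hm']
      rw [← Finset.mul_prod_erase _ _ (Finset.mem_univ σ)] at hprod
      have hgσ : gap H α i σ σ = α ^ (i + 1) := by simp [gap, H.one_mem]
      rw [hgσ] at hprod
      have hbα : b (α ^ (i + 1)) ≠ 0 := hb0 _ (pow_ne_zero _ h.irreducible.ne_zero)
      have hσ0 := hξ0 σ
      have : ξ σ / b (α ^ (i + 1)) =
          φ (C ((algebraMap B L α ^ m)⁻¹) * (minpoly A α).map (algebraMap A L)) *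
            b u * ∏ τ ∈ Finset.univ.erase σ, (b (gap H α i σ τ) / ξ τ) := by
        rw [div_eq_iff hbα]
        calc ξ σ = ξ σ * 1 := (mul_one _).symm
          _ = _ := by
            rw [← hprod]
            field_simp
      rw [this]
      exact mul_mem (mul_mem hSV (hBV _)) (prod_mem fun τ _ => hdiv τ)
    -- `q` is an integral polynomial in the coordinate of the disc
    obtain ⟨p, hp⟩ := mem_integralPolys.mp (hq σ)
    have hbα : b (α ^ (i + 1)) ≠ 0 := hb0 _ (pow_ne_zero _ h.irreducible.ne_zero)
    have hpq : φ q = p.eval₂ (φ.comp ((C : L →+* L[X]).comp (algebraMap B L)))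
        (ξ σ / b (α ^ (i + 1))) := by
      let y : RatFunc L := ξ σ / b (α ^ (i + 1))
      have h1 : φ q = eval₂ (φ.comp (C : L →+* L[X])) y (disc L α i σ q) := by
        have h2 : (eval₂RingHom (φ.comp (C : L →+* L[X])) y).comp (disc L α i σ : L[X] →+* L[X]) =
            φ := by
          refine Polynomial.ringHom_ext (fun a => ?_) ?_
          · simp [disc]
          · have h3 : b (σ • α) + b (α ^ (i + 1)) * y = φ X := by
              rw [mul_div_cancel₀ _ hbα]
              simp [ξ]
            rw [← h3]
            simp [disc, discCoord, b, eval₂_pow]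
        exact (DFunLike.congr_fun h2 q).symm
      rw [h1, ← hp, eval₂_map]
      rfl
    rw [hpq, eval₂_eq_sum]
    exact sum_mem fun n _ => mul_mem (hBV _) (pow_mem hσ n)
  rw [iInf_valuationSubring_superset] at key
  change IsIntegral _ _ at key
  have hcl : ∀ x : Subring.closure (ψ.range : Set (RatFunc L)), ∃ d, ψ d = x := by
    intro x
    exact Subring.closure_le.mpr subset_rfl x.2
  obtain ⟨P, hP, hP0⟩ := key
  have hlift : P.map (algebraMap _ (RatFunc L)) ∈ lifts ψ := by
    rw [lifts_iff_coeff_lifts]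
    intro n
    obtain ⟨d, hd⟩ := hcl (P.coeff n)
    exact ⟨d, by rw [hd, coeff_map]; rfl⟩
  obtain ⟨P', hP', -, hmon⟩ := lifts_and_degree_eq_and_monic hlift (hP.map _)
  change IsIntegral (dilatation A L B α m) q
  refine ⟨P', hmon, hφ ?_⟩
  have h1 : eval₂ ψ (φ q) P' = 0 := by rw [← eval_map, hP', eval_map, hP0]
  rw [map_zero, hom_eval₂, ← h1]
  rfl

theorem mem_normalization_iff (h : HasLastBreak H α i) {q : L[X]} :
    q ∈ normalization A L B α m ↔ ∀ σ : G, disc L α i σ q ∈ integralPolys L B :=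
  ⟨fun hq σ => disc_mem_of_mem_normalization hf hm h σ hq,
    mem_normalization_of_disc_mem hf hm h⟩

end Normalization

/-! ### The closed fiber of the normalization -/

section ClosedFiber

open HasLastBreak

variable {A K L B : Type*} [CommRing A] [Field K] [Field L] [CommRing B]
  [Algebra A K] [IsFractionRing A K] [Algebra K L] [Algebra A L] [IsScalarTower A K L]
  [Algebra A B] [Algebra B L] [IsScalarTower A B L] [IsIntegralClosure B A L]
  [IsDomain B] [IsDiscreteValuationRing B] [IsFractionRing B L]

section

variable {G : Type*} [Group G] [Fintype G] [MulSemiringAction G B] {H : Subgroup G}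
  {α : B} {i m : ℕ}
  (hf : (minpoly A α).map (algebraMap A L) = ∏ σ : G, (X - C (algebraMap B L (σ • α))))
  (hm : Associated (∏ τ : G, gap H α i 1 τ) (α ^ m)) (h : HasLastBreak H α i)

theorem mapAlgHom_ofId_injective : Function.Injective (mapAlgHom (Algebra.ofId B L)) :=
  map_injective _ (FaithfulSMul.algebraMap_injective B L)

/-- Restriction of functions on the normalization to the disc around `σ α`. -/
noncomputable def discHom (σ : G) : normalization A L B α m →ₐ[B] B[X] :=
  (AlgEquiv.ofInjective (mapAlgHom (Algebra.ofId B L))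
    mapAlgHom_ofId_injective).symm.toAlgHom.comp
    ((((disc L α i σ).restrictScalars B).comp (normalization A L B α m).val).codRestrict
      (integralPolys L B) fun q => disc_mem_of_mem_normalization hf hm h σ q.2)

theorem map_discHom (σ : G) (q : normalization A L B α m) :
    (discHom hf hm h σ q).map (algebraMap B L) = disc L α i σ q := by
  have h1 := congrArg Subtype.val ((AlgEquiv.ofInjective (mapAlgHom (Algebra.ofId B L))
    mapAlgHom_ofId_injective).apply_symm_apply
    ((((disc L α i σ).restrictScalars B).comp (normalization A L B α m).val).codRestrict
      (integralPolys L B) (fun q => disc_mem_of_mem_normalization hf hm h σ q.2) q))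
  exact h1

/-- Restriction of functions on the closed fiber to the reduction of the disc around `σ α`. -/
noncomputable def redHom (σ : G) : Fiber A L B α m →ₐ[ResidueField B] (ResidueField B)[X] :=
  Algebra.TensorProduct.lift (Algebra.ofId _ _)
    ((mapAlgHom (Algebra.ofId B (ResidueField B))).comp (discHom hf hm h σ))
    fun _ _ => Commute.all _ _

theorem redHom_tmul (σ : G) (q : normalization A L B α m) :
    redHom hf hm h σ (1 ⊗ₜ q) = (discHom hf hm h σ q).map (residue B) := by
  rw [redHom, Algebra.TensorProduct.lift_tmul, map_one, one_mul]
  rfl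

theorem exists_one_tmul {N : Type*} [CommRing N] [Algebra B N] (x : ResidueField B ⊗[B] N) :
    ∃ q, x = 1 ⊗ₜ q := by
  induction x with
  | zero => exact ⟨0, by simp⟩
  | tmul a q =>
    obtain ⟨b, rfl⟩ := residue_surjective a
    refine ⟨b • q, ?_⟩
    rw [← TensorProduct.smul_tmul, Algebra.smul_def, mul_one]
    rfl
  | add x y hx hy =>
    obtain ⟨a, rfl⟩ := hx
    obtain ⟨b, rfl⟩ := hy
    exact ⟨a + b, (TensorProduct.tmul_add _ _ _).symm⟩

include h in
theorem residue_uniformizer : residue B α = 0 := by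
  rw [residue_eq_zero_iff, h.irreducible.maximalIdeal_eq]
  exact Ideal.mem_span_singleton_self α

include h in
theorem C_dvd_iff_map_residue_eq_zero (p : B[X]) : C α ∣ p ↔ p.map (residue B) = 0 := by
  rw [C_dvd_iff_dvd_coeff, Polynomial.ext_iff]
  refine forall_congr' fun n => ?_
  rw [coeff_map, coeff_zero, residue_eq_zero_iff, h.irreducible.maximalIdeal_eq,
    Ideal.mem_span_singleton]

include h in
theorem smul_one_tmul_eq_zero {N : Type*} [CommRing N] [Algebra B N] (q : N) :
    (1 : ResidueField B) ⊗ₜ[B] (α • q) = 0 := by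
  rw [← TensorProduct.smul_tmul, Algebra.smul_def, mul_one]
  change (residue B α) ⊗ₜ[B] q = 0
  rw [residue_uniformizer h, TensorProduct.zero_tmul]

/-- The reductions of the discs cover the closed fiber, which is therefore reduced. -/
theorem eq_zero_of_redHom_eq_zero {x : Fiber A L B α m}
    (hx : ∀ σ : G, redHom hf hm h σ x = 0) : x = 0 := by
  obtain ⟨q, rfl⟩ := exists_one_tmul x
  have hα : algebraMap B L α ≠ 0 :=
    (FaithfulSMul.algebraMap_eq_zero_iff B L).not.mpr h.irreducible.ne_zero
  have hmem : C (algebraMap B L α)⁻¹ * (q : L[X]) ∈ normalization A L B α m := by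
    rw [mem_normalization_iff hf hm h]
    intro σ
    have h1 := hx σ
    rw [redHom_tmul, ← C_dvd_iff_map_residue_eq_zero h] at h1
    obtain ⟨p, hp⟩ := h1
    refine ⟨p, ?_⟩
    rw [map_mul, ← map_discHom hf hm h, hp, disc, aeval_C, Polynomial.map_mul, Polynomial.map_C,
      ← C_eq_algebraMap, ← mul_assoc, ← C_mul, inv_mul_cancel₀ hα, C_1, one_mul]
    rfl
  have hq : q = α • (⟨_, hmem⟩ : normalization A L B α m) := by
    apply Subtype.ext
    change (q : L[X]) = α • (C (algebraMap B L α)⁻¹ * (q : L[X]))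
    rw [Algebra.smul_def, IsScalarTower.algebraMap_apply B L L[X], ← C_eq_algebraMap, ← mul_assoc,
      ← C_mul, mul_inv_cancel₀ hα, C_1, one_mul]
  rw [hq, smul_one_tmul_eq_zero h]

variable {c : H → B} (hc : ∀ σ : H, σ • α = α + α ^ (i + 1) * c σ)

include hc in
theorem discCoord_eq_comp (σ : H) :
    discCoord α i (σ : G) = (discCoord α i (1 : G)).comp (X + C (c σ)) := by
  simp only [discCoord, one_smul, add_comp, mul_comp, C_comp, X_comp]
  have h1 : (σ : G) • α = α + α ^ (i + 1) * c σ := hc σ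
  rw [h1]
  simp only [C_add, C_mul]
  ring

include hc in
theorem disc_eq_comp (σ : H) (q : L[X]) :
    disc L α i (σ : G) q = (disc L α i (1 : G) q).comp ((X + C (c σ)).map (algebraMap B L)) := by
  rw [disc, disc, ← comp_eq_aeval, ← comp_eq_aeval, comp_assoc, ← Polynomial.map_comp,
    discCoord_eq_comp hc]

include hc in
theorem discHom_eq_comp (σ : H) (q : normalization A L B α m) :
    discHom hf hm h (σ : G) q = (discHom hf hm h 1 q).comp (X + C (c σ)) := by
  apply map_injective _ (FaithfulSMul.algebraMap_injective B L)
  rw [Polynomial.map_comp, map_discHom, map_discHom, disc_eq_comp hc]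

include hc in
theorem redHom_eq_comp (σ : H) (x : Fiber A L B α m) :
    redHom hf hm h (σ : G) x = (redHom hf hm h 1 x).comp (X + C (residue B (c σ))) := by
  obtain ⟨q, rfl⟩ := exists_one_tmul x
  rw [redHom_tmul, redHom_tmul, discHom_eq_comp hf hm h hc, Polynomial.map_comp]
  simp

open Classical in
variable (L H α) in
/-- The polynomial `∏ (X - τ α) / (α - τ α)` over `τ ∉ H`; it reduces to `1` on the disc around `α`
and to `0` on the discs around the other conjugates. -/
noncomputable def separator : L[X] :=
  C ((algebraMap B L (∏ τ : G with τ ∉ H, (α - τ • α)))⁻¹) *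
    (∏ τ : G with τ ∉ H, (X - C (τ • α))).map (algebraMap B L)

open Classical in
include h in
theorem prod_sub_ne_zero : (∏ τ : G with τ ∉ H, (α - τ • α)) ≠ 0 := by
  rw [Finset.prod_ne_zero_iff]
  intro τ hτ h0
  refine (Finset.mem_filter.mp hτ).2 ((h.mem_iff τ).mpr ?_)
  rw [h0]
  exact dvd_zero _

open Classical in
include h in
theorem disc_separator_of_eq (σ : G) {p : B[X]}
    (hp : ∏ τ : G with τ ∉ H, (discCoord α i σ - C (τ • α)) =
      C (∏ τ : G with τ ∉ H, (α - τ • α)) * p) :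
    disc L α i σ (separator L H α) = p.map (algebraMap B L) := by
  have h0 : algebraMap B L (∏ τ : G with τ ∉ H, (α - τ • α)) ≠ 0 :=
    (FaithfulSMul.algebraMap_eq_zero_iff B L).not.mpr (prod_sub_ne_zero h)
  rw [separator, map_mul, disc_map, prod_comp]
  simp only [sub_comp, X_comp, C_comp]
  rw [hp, Polynomial.map_mul, disc, aeval_C, ← C_eq_algebraMap, Polynomial.map_C, ← mul_assoc, ← C_mul,
    inv_mul_cancel₀ h0, C_1, one_mul]

include h in
theorem disc_separator_one : ∃ p : B[X],
    disc L α i (1 : G) (separator L H α) = p.map (algebraMap B L) ∧ p.map (residue B) = 1 := by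
  classical
  obtain ⟨p, hp, hp1⟩ := h.exists_prod_not_mem (Finset.univ.filter fun τ : G => τ ∉ H)
    fun τ hτ => (Finset.mem_filter.mp hτ).2
  exact ⟨p, disc_separator_of_eq h 1 (by convert hp), hp1⟩

open Classical in
include h in
/-- The product of the distances to the conjugates of `α` outside its disc is strictly smaller
on the other discs, because the product of the distances to all conjugates is the same on all
discs. -/
theorem mul_prod_sub_dvd (σ : G) (hσ : σ ∉ H) :
    α * ∏ τ : G with τ ∉ H, (α - τ • α) ∣ ∏ τ : G with τ ∉ H, gap H α i σ τ := by
  have h1 := (h.prod_gap_associated σ).symm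
  rw [← Finset.prod_filter_mul_prod_filter_not Finset.univ (fun τ => τ ∈ H),
    ← Finset.prod_filter_mul_prod_filter_not (s := Finset.univ) (p := fun τ => τ ∈ H)
      (f := fun τ => gap H α i σ τ)] at h1
  have h2 : ∏ τ : G with τ ∉ H, gap H α i 1 τ = ∏ τ : G with τ ∉ H, (α - τ • α) := by
    refine Finset.prod_congr rfl fun τ hτ => ?_
    rw [gap, if_neg (by simpa using (Finset.mem_filter.mp hτ).2), one_smul]
  have h3 : α * ∏ τ : G with τ ∈ H, gap H α i σ τ ∣ ∏ τ : G with τ ∈ H, gap H α i 1 τ := by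
    have h1mem : (1 : G) ∈ Finset.univ.filter fun τ : G => τ ∈ H := by simp [H.one_mem]
    rw [← Finset.mul_prod_erase _ _ h1mem, ← Finset.mul_prod_erase _ _ h1mem, ← mul_assoc]
    have key : ∀ τ ∈ H, α * gap H α i σ τ ∣ gap H α i 1 τ := by
      intro τ hτ
      have hστ : σ⁻¹ * τ ∉ H := fun hmem =>
        hσ (by simpa using H.mul_mem hτ (H.inv_mem hmem))
      rw [gap, gap, if_neg hστ, if_pos (by simpa using hτ)]
      exact h.mul_sub_dvd_pow hστ
    refine mul_dvd_mul (key 1 H.one_mem) (Finset.prod_dvd_prod_of_dvd _ _ fun τ hτ => ?_)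
    exact (Dvd.intro_left _ rfl).trans
      (key τ (Finset.mem_filter.mp (Finset.mem_of_mem_erase hτ)).2)
  have h4 : (∏ τ : G with τ ∈ H, gap H α i σ τ) ≠ 0 :=
    Finset.prod_ne_zero_iff.mpr fun τ _ => h.gap_ne_zero σ τ
  refine (mul_dvd_mul_iff_left h4).mp ?_
  refine dvd_trans ?_ h1.dvd
  rw [h2, ← mul_assoc, mul_comm _ α]
  exact mul_dvd_mul_right h3 _

include h in
theorem disc_separator_of_notMem (σ : G) (hσ : σ ∉ H) : ∃ p : B[X],
    disc L α i σ (separator L H α) = (C α * p).map (algebraMap B L) := by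
  classical
  have h1 : C (α * ∏ τ : G with τ ∉ H, (α - τ • α)) ∣
      ∏ τ : G with τ ∉ H, (discCoord α i σ - C (τ • α)) := by
    refine (map_dvd C (mul_prod_sub_dvd h σ hσ)).trans ?_
    rw [map_prod]
    exact Finset.prod_dvd_prod_of_dvd _ _ fun τ _ => h.C_gap_dvd σ τ
  obtain ⟨p, hp⟩ := h1
  refine ⟨p, disc_separator_of_eq h σ ?_⟩
  rw [hp, C_mul]
  ring

include hf hm h hc in
theorem separator_mem : separator L H α ∈ normalization A L B α m := by
  rw [mem_normalization_iff hf hm h]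
  intro σ
  by_cases hσ : σ ∈ H
  · obtain ⟨p, hp, -⟩ := disc_separator_one (L := L) h
    rw [disc_eq_comp hc ⟨σ, hσ⟩, hp, ← Polynomial.map_comp]
    exact map_mem_integralPolys _
  · obtain ⟨p, hp⟩ := disc_separator_of_notMem (L := L) h σ hσ
    rw [hp]
    exact map_mem_integralPolys _

theorem redHom_of_disc_eq (σ : G) {q : normalization A L B α m} {p : B[X]}
    (hp : disc L α i σ q = p.map (algebraMap B L)) :
    redHom hf hm h σ (1 ⊗ₜ q) = p.map (residue B) := by
  have h1 : discHom hf hm h σ q = p := by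
    apply map_injective _ (FaithfulSMul.algebraMap_injective B L)
    rw [map_discHom, hp]
  rw [redHom_tmul, h1]

include hc in
/-- The idempotent of the closed fiber that cuts out the component of the point `α`. -/
theorem exists_idempotent : ∃ e : Fiber A L B α m, IsIdempotentElem e ∧
    ∀ x, redHom hf hm h 1 x = 0 ↔ x * e = 0 := by
  have hs := separator_mem hf hm h hc
  set e : Fiber A L B α m := 1 ⊗ₜ ⟨_, hs⟩ with he
  have he1 : redHom hf hm h 1 e = 1 := by
    obtain ⟨p, hp, hp1⟩ := disc_separator_one (L := L) h
    rw [he, redHom_of_disc_eq hf hm h 1 hp, hp1]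
  have heσ : ∀ σ : G, σ ∉ H → redHom hf hm h σ e = 0 := by
    intro σ hσ
    obtain ⟨p, hp⟩ := disc_separator_of_notMem (L := L) h σ hσ
    rw [he, redHom_of_disc_eq hf hm h σ hp, Polynomial.map_mul, Polynomial.map_C,
      residue_uniformizer h, C_0, zero_mul]
  have key : ∀ x, redHom hf hm h 1 x = 0 → x * e = 0 := by
    intro x hx
    refine eq_zero_of_redHom_eq_zero hf hm h fun σ => ?_
    rw [map_mul]
    by_cases hσ : σ ∈ H
    · rw [redHom_eq_comp hf hm h hc ⟨σ, hσ⟩ x, hx, zero_comp, zero_mul]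
    · rw [heσ σ hσ, mul_zero]
  refine ⟨e, ?_, fun x => ⟨key x, fun hx => ?_⟩⟩
  · have h1 := key (e - 1) (by rw [map_sub, he1, map_one, sub_self])
    rw [sub_mul, one_mul, sub_eq_zero] at h1
    exact h1
  · have h1 := congrArg (redHom hf hm h 1) hx
    rwa [map_mul, he1, mul_one, map_zero] at h1

include hc in
theorem redHom_surjective : Function.Surjective (redHom hf hm h 1) := by
  have hα : algebraMap B L (α ^ (i + 1)) ≠ 0 := (FaithfulSMul.algebraMap_eq_zero_iff B L).not.mpr
    (pow_ne_zero _ h.irreducible.ne_zero)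
  let g : L[X] := separator L H α ^ (i + 1) *
    (C (algebraMap B L (α ^ (i + 1)))⁻¹ * (X - C (algebraMap B L α)))
  have hg : ∀ σ : G, disc L α i σ g = disc L α i σ (separator L H α) ^ (i + 1) *
      (C (algebraMap B L (α ^ (i + 1)))⁻¹ *
        (discCoord α i σ - C α).map (algebraMap B L)) := by
    intro σ
    simp only [g, map_mul, map_pow, map_sub, Polynomial.map_sub, Polynomial.map_C]
    simp [disc]
  have h1 : (discCoord α i (1 : G) - C α) = C (α ^ (i + 1)) * X := by
    rw [discCoord, one_smul]; ring
  obtain ⟨p, hp, hp1⟩ := disc_separator_one (L := L) h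
  have hg1 : disc L α i (1 : G) g = (p ^ (i + 1) * X).map (algebraMap B L) := by
    rw [hg, h1, hp, Polynomial.map_mul, Polynomial.map_C, ← mul_assoc (C _), ← C_mul,
      inv_mul_cancel₀ hα, C_1, one_mul, Polynomial.map_mul, Polynomial.map_pow]
  have hmem : g ∈ normalization A L B α m := by
    rw [mem_normalization_iff hf hm h]
    intro σ
    by_cases hσ : σ ∈ H
    · rw [disc_eq_comp hc ⟨σ, hσ⟩, hg1, ← Polynomial.map_comp]
      exact map_mem_integralPolys _
    · obtain ⟨r, hr⟩ := disc_separator_of_notMem (L := L) h σ hσ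
      have : disc L α i σ g = (r ^ (i + 1) * (discCoord α i σ - C α)).map (algebraMap B L) := by
        rw [hg, hr, ← Polynomial.map_pow, mul_pow, ← C_pow, Polynomial.map_mul, Polynomial.map_C,
          Polynomial.map_mul]
        calc _ = (C (algebraMap B L (α ^ (i + 1))) * C (algebraMap B L (α ^ (i + 1)))⁻¹) *
              (map (algebraMap B L) (r ^ (i + 1)) *
                map (algebraMap B L) (discCoord α i σ - C α)) := by ring
          _ = _ := by rw [← C_mul, mul_inv_cancel₀ hα, C_1, one_mul]
      rw [this]
      exact map_mem_integralPolys _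
  have hX : redHom hf hm h 1 (1 ⊗ₜ ⟨g, hmem⟩) = X := by
    rw [redHom_of_disc_eq hf hm h 1 hg1, Polynomial.map_mul, Polynomial.map_pow, hp1, one_pow, one_mul, map_X]
  intro y
  refine ⟨aeval (1 ⊗ₜ ⟨g, hmem⟩) y, ?_⟩
  rw [← aeval_algHom_apply, hX, aeval_X_left_apply]

/-- The zero locus of the functions that vanish on the disc around `α` is open and closed, and
irreducible, hence a connected component. -/
theorem vanishingIdeal_connectedComponent_eq_ker {R S : Type*} [CommRing R] [CommRing S] [IsDomain S]
    (ψ : R →+* S) {e : R} (he : IsIdempotentElem e) (hψ : ∀ x, ψ x = 0 ↔ x * e = 0)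
    (x : PrimeSpectrum R) (hx : RingHom.ker ψ ≤ x.asIdeal) :
    PrimeSpectrum.vanishingIdeal (connectedComponent x) = RingHom.ker ψ := by
  have hprime : (RingHom.ker ψ).IsPrime := RingHom.ker_isPrime ψ
  have hker : RingHom.ker ψ = Ideal.span {1 - e} := by
    ext y
    rw [RingHom.mem_ker, hψ, Ideal.mem_span_singleton]
    refine ⟨fun hy => ⟨y, by linear_combination hy⟩, ?_⟩
    rintro ⟨z, rfl⟩
    have h1 : e * e = e := he
    linear_combination (-z) * h1
  have hcc : connectedComponent x = PrimeSpectrum.zeroLocus (RingHom.ker ψ : Set R) := by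
    have hxm : x ∈ PrimeSpectrum.zeroLocus (RingHom.ker ψ : Set R) := hx
    apply Set.Subset.antisymm
    · refine IsClopen.connectedComponent_subset ?_ hxm
      rw [PrimeSpectrum.isClopen_iff_zeroLocus]
      exact ⟨1 - e, he.one_sub, by rw [hker, PrimeSpectrum.zeroLocus_span]⟩
    · refine IsPreconnected.subset_connectedComponent ?_ hxm
      refine IsPreirreducible.isPreconnected (IsIrreducible.isPreirreducible ?_)
      rw [PrimeSpectrum.isIrreducible_zeroLocus_iff, hprime.radical]
      exact hprime
  rw [hcc, PrimeSpectrum.vanishingIdeal_zeroLocus_eq_radical, hprime.radical]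

end

end ClosedFiber

/-! ### The component as an affine line -/

section ComponentRing

open HasLastBreak

variable {A K L B : Type*} [CommRing A] [Field K] [Field L] [CommRing B]
  [Algebra A K] [IsFractionRing A K] [Algebra K L] [Algebra A L] [IsScalarTower A K L]
  [Algebra A B] [Algebra B L] [IsScalarTower A B L] [IsIntegralClosure B A L]
  [IsDomain B] [IsDiscreteValuationRing B] [IsFractionRing B L]

section Generator

variable {G : Type*} [Group G] [Fintype G] [MulSemiringAction G B] {H : Subgroup G} [Fintype H]
  {α : B} {i m : ℕ}
  (hf : (minpoly A α).map (algebraMap A L) = ∏ σ : G, (X - C (algebraMap B L (σ • α))))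
  (hm : Associated (∏ τ : G, gap H α i 1 τ) (α ^ m)) (h : HasLastBreak H α i)
  {c : H → B} (hc : ∀ σ : H, σ • α = α + α ^ (i + 1) * c σ)

open Classical in
include hc in
/-- On the reduction of the disc around `α` the function `f / α ^ m` is, up to a unit, the additive
polynomial with roots the classes of `(τ α - α) / α ^ (i + 1)`, for `τ ∈ H`. -/
theorem redHom_generator {u : B}
    (hu : u * α ^ m = (∏ τ : G with τ ∉ H, (α - τ • α)) * α ^ ((i + 1) * Fintype.card H))
    {S : normalization A L B α m}
    (hS : (S : L[X]) = C ((algebraMap B L α ^ m)⁻¹) * (minpoly A α).map (algebraMap A L)) :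
    redHom hf hm h 1 (1 ⊗ₜ S) = C (residue B u) * ∏ τ : H, (X - C (residue B (c τ))) := by
  obtain ⟨p, hp, hpS⟩ := disc_generator_mem hf hm h 1
  rw [← hS] at hpS
  rw [redHom_of_disc_eq hf hm h 1 hpS]
  obtain ⟨p', hp', hp1⟩ := h.exists_prod_not_mem (Finset.univ.filter fun τ : G => τ ∉ H)
    fun τ hτ => (Finset.mem_filter.mp hτ).2
  have hH : ∏ τ : G with τ ∈ H, (discCoord α i (1 : G) - C (τ • α)) =
      C (α ^ ((i + 1) * Fintype.card H)) * ∏ τ : H, (X - C (c τ)) := by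
    rw [Finset.prod_subtype (p := fun τ : G => τ ∈ H) _ (by simp), pow_mul, ← Finset.card_univ,
      ← Finset.prod_const, map_prod, ← Finset.prod_mul_distrib]
    refine Finset.prod_congr rfl fun τ _ => ?_
    have h1 : (τ : G) • α = α + α ^ (i + 1) * c τ := hc τ
    rw [h1, discCoord, one_smul, C_add, C_mul]
    ring
  have hpe : p = C u * p' * ∏ τ : H, (X - C (c τ)) := by
    have h0 : (C (α ^ m) : B[X]) ≠ 0 := C_ne_zero.mpr (pow_ne_zero _ h.irreducible.ne_zero)
    apply mul_left_cancel₀ h0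
    rw [hp, ← Finset.prod_filter_mul_prod_filter_not Finset.univ (fun τ => τ ∈ H), hH]
    have h2 : ∏ τ : G with τ ∉ H, (discCoord α i (1 : G) - C (τ • α)) =
      C (∏ τ : G with τ ∉ H, (α - τ • α)) * p' := hp'
    rw [h2]
    have h3 := congrArg (C : B → B[X]) hu
    rw [C_mul, C_mul] at h3
    linear_combination (-p' * ∏ τ : H, (X - C (c τ))) * h3
  rw [hpe, Polynomial.map_mul, Polynomial.map_mul, hp1, Polynomial.map_prod, mul_one]
  simp

end Generator

section Reduced

variable {G : Type*} [Group G] [Fintype G] [MulSemiringAction G B] {H : Subgroup G}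
  {α : B} {i m : ℕ}
  (hf : (minpoly A α).map (algebraMap A L) = ∏ σ : G, (X - C (algebraMap B L (σ • α))))
  (h : HasLastBreak H α i)

include hf h in
/-- The coordinate `X` is nilpotent on the closed fiber of the dilatation, because `f ≡ X ^ n`
modulo `α`. -/
theorem isNilpotent_X (hm0 : m ≠ 0) {x : dilatation A L B α m} (hx : (x : L[X]) = X) :
    IsNilpotent ((1 : ResidueField B) ⊗ₜ[B] x) := by
  have hα : algebraMap B L α ≠ 0 :=
    (FaithfulSMul.algebraMap_eq_zero_iff B L).not.mpr h.irreducible.ne_zero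
  obtain ⟨r, hr⟩ : C α ∣ X ^ Fintype.card G - ∏ σ : G, (X - C (σ • α)) := by
    rw [C_dvd_iff_map_residue_eq_zero h]
    have h1 : ∀ σ : G, residue B (σ • α) = 0 := by
      intro σ
      rw [residue_eq_zero_iff, h.irreducible.maximalIdeal_eq, Ideal.mem_span_singleton]
      exact (h.smul_associated σ α).symm.dvd
    simp [Polynomial.map_prod, h1]
  let S : dilatation A L B α m := ⟨C ((algebraMap B L α ^ m)⁻¹) * (minpoly A α).map (algebraMap A L),
    Algebra.subset_adjoin (Set.mem_insert_of_mem _ (Set.mem_singleton _))⟩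
  refine ⟨Fintype.card G, ?_⟩
  have h2 : x ^ Fintype.card G = α • (α ^ (m - 1) • S + aeval x r) := by
    apply Subtype.ext
    have h3 : ((aeval x r : dilatation A L B α m) : L[X]) = r.map (algebraMap B L) := by
      have h4 := aeval_algHom_apply (dilatation A L B α m).val x r
      change _ = ((aeval x r : dilatation A L B α m) : L[X]) at h4
      rw [← h4]
      change aeval (x : L[X]) r = _
      rw [hx, aeval_X_left_eq_map]
    have h5 := congrArg (Polynomial.map (algebraMap B L)) hr
    rw [Polynomial.map_sub, Polynomial.map_pow, map_X, ← minpoly_eq_map hf, Polynomial.map_mul, Polynomial.map_C]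
      at h5
    have h6 : α ^ m • (S : L[X]) = (minpoly A α).map (algebraMap A L) := by
      change α ^ m • (C ((algebraMap B L α ^ m)⁻¹) * (minpoly A α).map (algebraMap A L)) = _
      rw [Algebra.smul_def, IsScalarTower.algebraMap_apply B L L[X], ← C_eq_algebraMap, ← mul_assoc,
        ← C_mul, map_pow, mul_inv_cancel₀ (pow_ne_zero _ hα), C_1, one_mul]
    change (x : L[X]) ^ Fintype.card G =
      α • (α ^ (m - 1) • (S : L[X]) + ((aeval x r : dilatation A L B α m) : L[X]))
    rw [hx, h3, smul_add, smul_smul, ← pow_succ', Nat.sub_add_cancel (Nat.pos_of_ne_zero hm0), h6,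
      Algebra.smul_def, IsScalarTower.algebraMap_apply B L L[X], ← C_eq_algebraMap]
    linear_combination h5
  rw [Algebra.TensorProduct.tmul_pow, one_pow, h2, smul_one_tmul_eq_zero h]

/-- A homomorphism from an algebra generated by a set takes values in the range of another
homomorphism if it does so on the generators. -/
theorem exists_map_eq_of_adjoin {R S T U : Type*} [CommRing R] [CommRing S] [Algebra R S]
    [CommRing T] [CommRing U] {s : Set S} {D : Subalgebra R S} (hD : D = Algebra.adjoin R s)
    (θ : D →+* T) (g : U →+* T) (hR : ∀ a, ∃ u, g u = θ (algebraMap R D a))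
    (hs : ∀ d : D, (d : S) ∈ s → ∃ u, g u = θ d) (d : D) : ∃ u, g u = θ d := by
  subst hD
  obtain ⟨d, hd⟩ := d
  refine Algebra.adjoin_induction (p := fun d hd => ∃ u, g u = θ ⟨d, hd⟩) (fun x hx => ?_) hR
    (fun x y hx hy => ?_) (fun x y hx hy => ?_) hd
  · exact hs _ hx
  · rintro ⟨a, ha⟩ ⟨b, hb⟩
    exact ⟨a + b, by rw [map_add, ha, hb, ← map_add]; rfl⟩
  · rintro ⟨a, ha⟩ ⟨b, hb⟩
    exact ⟨a * b, by rw [map_mul, ha, hb, ← map_mul]; rfl⟩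

theorem redFiberToGr_ι {n : ℕ} (w : Gr B n) (l : Module.Dual (ResidueField B) (Gr B n)) :
    redFiberToGr A L B α m w (SymmetricAlgebra.ι _ _ l) = l w • coordS A L B α m :=
  SymmetricAlgebra.lift_ι_apply _ _

/-- The homomorphism from the dilatation to the functions on its reduced closed fiber. -/
noncomputable def toRedFiber : dilatation A L B α m →+* RedFiber A L B α m :=
  (Ideal.Quotient.mk (nilradical (ResidueField B ⊗[B] dilatation A L B α m))).comp
    (Algebra.TensorProduct.includeRight :
      dilatation A L B α m →ₐ[B] ResidueField B ⊗[B] dilatation A L B α m).toRingHom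

theorem toRedFiber_apply (d : dilatation A L B α m) :
    toRedFiber d = Ideal.Quotient.mk _ ((1 : ResidueField B) ⊗ₜ[B] d) := rfl

theorem toRedFiber_algebraMap (b : B) :
    toRedFiber (algebraMap B (dilatation A L B α m) b) =
      algebraMap (ResidueField B) (RedFiber A L B α m) (residue B b) := by
  have h1 : (1 : ResidueField B) ⊗ₜ[B] (algebraMap B (dilatation A L B α m) b) =
      algebraMap (ResidueField B) (ResidueField B ⊗[B] dilatation A L B α m) (residue B b) := by
    rw [Algebra.algebraMap_eq_smul_one, ← TensorProduct.smul_tmul, Algebra.smul_def, mul_one]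
    rfl
  rw [toRedFiber_apply, h1]
  rfl

include hf h in
theorem redFiberToGr_surjective (hm0 : m ≠ 0) {n : ℕ}
    (η : Gr B n ≃ₗ[ResidueField B] ResidueField B) :
    Function.Surjective (redFiberToGr A L B α m (η.symm 1)) := by
  intro z
  obtain ⟨y, rfl⟩ := Ideal.Quotient.mk_surjective z
  obtain ⟨d, rfl⟩ := exists_one_tmul y
  refine exists_map_eq_of_adjoin (T := RedFiber A L B α m)
    (U := VecGrp (ResidueField B) (Gr B n)) (D := dilatation A L B α m) rfl toRedFiber
    (redFiberToGr A L B α m (η.symm 1)).toRingHom (fun b => ?_) (fun d hd => ?_) d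
  · rw [toRedFiber_algebraMap]
    exact ⟨algebraMap _ _ (residue B b), (redFiberToGr A L B α m (η.symm 1)).commutes _⟩
  · rcases hd with hd | hd
    · have h1 : toRedFiber d = 0 := by
        rw [toRedFiber_apply, Ideal.Quotient.eq_zero_iff_mem, mem_nilradical]
        exact isNilpotent_X hf h hm0 hd
      exact ⟨0, h1 ▸ map_zero _⟩
    · refine ⟨SymmetricAlgebra.ι _ _ (η : Gr B n →ₗ[ResidueField B] ResidueField B), ?_⟩
      refine (redFiberToGr_ι _ _).trans ?_
      have h1 : (η : Gr B n →ₗ[ResidueField B] ResidueField B) (η.symm 1) = 1 := by simp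
      rw [h1, one_smul, toRedFiber_apply]
      have h2 : d = ⟨C ((algebraMap B L α ^ m)⁻¹) * (minpoly A α).map (algebraMap A L),
        Algebra.subset_adjoin (Set.mem_insert_of_mem _ (Set.mem_singleton _))⟩ := Subtype.ext hd
      rw [h2]
      rfl

end Reduced

section Galois

variable [Algebra.IsAlgebraic K L] [Fintype Gal(L/K)] [MulSemiringAction Gal(L/K) B]
  {H : Subgroup Gal(L/K)} {α : B} {i m : ℕ}
  (hf : (minpoly A α).map (algebraMap A L) = ∏ σ : Gal(L/K), (X - C (algebraMap B L (σ • α))))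
  (hm : Associated (∏ τ : Gal(L/K), gap H α i 1 τ) (α ^ m)) (h : HasLastBreak H α i)
  {c : H → B} (hc : ∀ σ : H, σ • α = α + α ^ (i + 1) * c σ)
  (hcompat : ∀ (σ : Gal(L/K)) (b : B), algebraMap B L (σ • b) = σ (algebraMap B L b))

include hcompat hc in
/-- The section given by `σ α` meets the reduction of the disc around `α` at the point `c σ`. -/
theorem closedPoint_eq_eval (σ : H) (x : Fiber A L B α m) :
    TotRam.closedPoint A K L B α m (σ : Gal(L/K)) x =
      (redHom hf hm h 1 x).eval (residue B (c σ)) := by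
  obtain ⟨q, rfl⟩ := exists_one_tmul x
  have h1 : sectionConj A K L B α m (σ : Gal(L/K)) q = (discHom hf hm h 1 q).eval (c σ) := by
    apply FaithfulSMul.algebraMap_injective B L
    rw [algebraMap_sectionConj, ← eval₂_at_apply, ← eval_map, map_discHom, disc, ← comp_eq_aeval,
      eval_comp, ← hcompat]
    have h2 : (σ : Gal(L/K)) • α = α + α ^ (i + 1) * c σ := hc σ
    rw [h2, discCoord]
    simp
  rw [redHom_tmul, eval_map, eval₂_at_apply, ← h1, TotRam.closedPoint, Algebra.TensorProduct.lift_tmul]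
  exact one_mul _

include hcompat hc in
theorem componentIdeal_eq_ker :
    componentIdeal A K L B α m = RingHom.ker (redHom hf hm h (1 : Gal(L/K))) := by
  obtain ⟨e, he, hker⟩ := exists_idempotent hf hm h hc
  refine vanishingIdeal_connectedComponent_eq_ker
    (redHom hf hm h (1 : Gal(L/K))).toRingHom he hker _ fun x hx => ?_
  have h1 := closedPoint_eq_eval hf hm h hc hcompat 1 x
  have hx' : redHom hf hm h (1 : Gal(L/K)) x = 0 := hx
  rw [hx', eval_zero] at h1
  exact h1

/-- The component of the closed fiber is an affine line, the reduction of the disc around `α`. -/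
noncomputable def componentEquiv :
    Component A K L B α m ≃ₐ[ResidueField B] (ResidueField B)[X] :=
  (Ideal.quotientEquivAlgOfEq (ResidueField B)
    (componentIdeal_eq_ker hf hm h hc hcompat)).trans
    (Ideal.quotientKerAlgEquivOfSurjective (redHom_surjective hf hm h hc))

open Classical in
/-- On the affine line, the projection to the reduced closed fiber of the dilatation is given by a
multiple of the additive polynomial whose roots are the `c τ`. -/
theorem componentEquiv_redFiberToGr [Fintype H] {u : B}
    (hu : u * α ^ m = (∏ τ : Gal(L/K) with τ ∉ H, (α - τ • α)) * α ^ ((i + 1) * Fintype.card H))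
    {n : ℕ} (w : Gr B n) (l : Module.Dual (ResidueField B) (Gr B n)) :
    componentEquiv hf hm h hc hcompat (redFiberToComponent A K L B α m
      (redFiberToGr A L B α m w (SymmetricAlgebra.ι _ _ l))) =
      l w • (C (residue B u) * ∏ τ : H, (X - C (residue B (c τ)))) := by
  have h1 := (redFiberToComponent A K L B α m).toLinearMap.map_smul (l w) (coordS A L B α m)
  have h2 := (componentEquiv hf hm h hc hcompat).toLinearMap.map_smul (l w)
    (redFiberToComponent A K L B α m (coordS A L B α m))
  have h3 := redHom_generator hf hm h hc hu
    (S := Subalgebra.inclusion (dilatation_le A L B α m)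
      ⟨_, Algebra.subset_adjoin (Set.mem_insert_of_mem _ (Set.mem_singleton _))⟩) rfl
  rw [redFiberToGr_ι, ← h3]
  exact (congrArg (componentEquiv hf hm h hc hcompat) h1).trans h2

end Galois

end ComponentRing

/-! ### The Herbrand function of a finite filtration -/

section Herbrand

variable {G : Type*} [Group G] [Finite G] {g : ℕ → Subgroup G}

variable (g) in
/-- The slope `1 / (G_0 : G_t)` of the Herbrand function at `t`. -/
noncomputable def herbrandSlope (t : ℝ) : ℝ := (((g ⌈t⌉₊).relIndex (g 0) : ℕ) : ℝ)⁻¹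

variable (g) in
/-- The Herbrand function of a filtration. -/
noncomputable def herbrandFun (x : ℝ) : ℝ := ∫ t in (0 : ℝ)..x, herbrandSlope g t

theorem relIndex_pos (j : ℕ) : 0 < (g j).relIndex (g 0) :=
  Nat.pos_of_ne_zero Subgroup.FiniteIndex.index_ne_zero

theorem herbrandSlope_antitone (hg : Antitone g) : Antitone (herbrandSlope g) := by
  intro s t hst
  refine inv_anti₀ (by exact_mod_cast relIndex_pos _) ?_
  exact_mod_cast Nat.le_of_dvd (relIndex_pos _)
    (Subgroup.relIndex_dvd_of_le_left _ (hg (Nat.ceil_mono hst)))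

theorem herbrandSlope_intervalIntegrable (hg : Antitone g) (a b : ℝ) :
    IntervalIntegrable (herbrandSlope g) MeasureTheory.volume a b :=
  (herbrandSlope_antitone hg).intervalIntegrable

theorem inv_card_le_herbrandSlope (t : ℝ) : ((Nat.card G : ℕ) : ℝ)⁻¹ ≤ herbrandSlope g t := by
  refine inv_anti₀ (by exact_mod_cast relIndex_pos _) ?_
  exact_mod_cast Nat.le_of_dvd Nat.card_pos
    ((Subgroup.index_dvd_card _).trans (Subgroup.card_subgroup_dvd_card _))

theorem mul_inv_card_le_herbrandFun_sub (hg : Antitone g) {x y : ℝ} (hxy : x ≤ y) :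
    (y - x) * ((Nat.card G : ℕ) : ℝ)⁻¹ ≤ herbrandFun g y - herbrandFun g x := by
  rw [herbrandFun, herbrandFun, intervalIntegral.integral_interval_sub_left
    (herbrandSlope_intervalIntegrable hg _ _) (herbrandSlope_intervalIntegrable hg _ _)]
  calc (y - x) * ((Nat.card G : ℕ) : ℝ)⁻¹ = ∫ _ in x..y, ((Nat.card G : ℕ) : ℝ)⁻¹ := by simp
    _ ≤ _ := intervalIntegral.integral_mono_on hxy (by simp) (herbrandSlope_intervalIntegrable hg _ _)
      fun t _ => inv_card_le_herbrandSlope t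

theorem herbrandFun_strictMono (hg : Antitone g) : StrictMono (herbrandFun g) := by
  intro x y hxy
  have h1 := mul_inv_card_le_herbrandFun_sub hg hxy.le
  have h2 : 0 < (y - x) * ((Nat.card G : ℕ) : ℝ)⁻¹ :=
    mul_pos (sub_pos.mpr hxy) (inv_pos.mpr (by exact_mod_cast Nat.card_pos))
  linarith

theorem herbrandFun_zero : herbrandFun g 0 = 0 := intervalIntegral.integral_same

theorem exists_herbrandFun_eq (hg : Antitone g) {v : ℝ} (hv : 0 ≤ v) :
    ∃ x ∈ Set.Ici (0 : ℝ), herbrandFun g x = v := by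
  have hcont : Continuous (herbrandFun g) :=
    intervalIntegral.continuous_primitive (herbrandSlope_intervalIntegrable hg) 0
  have hcard : (0 : ℝ) < ((Nat.card G : ℕ) : ℝ) := by exact_mod_cast Nat.card_pos
  have hy : 0 ≤ v * (Nat.card G : ℕ) := mul_nonneg hv hcard.le
  have h1 := mul_inv_card_le_herbrandFun_sub hg hy
  rw [herbrandFun_zero, sub_zero, sub_zero, mul_assoc, mul_inv_cancel₀ hcard.ne', mul_one] at h1
  obtain ⟨x, hx, hxv⟩ := intermediate_value_Icc hy hcont.continuousOn
    ⟨by rwa [herbrandFun_zero], h1⟩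
  exact ⟨x, hx.1, hxv⟩

theorem herbrandFun_natCast (hg : Antitone g) (j : ℕ) :
    herbrandFun g j * Nat.card (g 0) = ∑ k ∈ Finset.range j, (Nat.card (g (k + 1)) : ℝ) := by
  have h1 : ∀ k : ℕ, (∫ t in ((k : ℕ) : ℝ)..((k + 1 : ℕ) : ℝ), herbrandSlope g t) * Nat.card (g 0) =
      Nat.card (g (k + 1)) := by
    intro k
    have h2 : (∫ t in ((k : ℕ) : ℝ)..((k + 1 : ℕ) : ℝ), herbrandSlope g t) =
        ∫ _ in ((k : ℕ) : ℝ)..((k + 1 : ℕ) : ℝ), ((((g (k + 1)).relIndex (g 0) : ℕ) : ℝ))⁻¹ := by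
      rw [intervalIntegral.integral_of_le (by simp), intervalIntegral.integral_of_le (by simp)]
      refine MeasureTheory.setIntegral_congr_fun measurableSet_Ioc fun t ht => ?_
      have h3 : ⌈t⌉₊ = k + 1 := by
        rw [Nat.ceil_eq_iff (Nat.succ_ne_zero k)]
        exact ⟨by simpa using ht.1, ht.2⟩
      simp only [herbrandSlope, h3]
    rw [h2]
    have h5 : ((g (k + 1)).relIndex (g 0) : ℝ) ≠ 0 := by exact_mod_cast (relIndex_pos _).ne'
    have h6 : ((g (k + 1)).relIndex (g 0) : ℝ) * Nat.card (g (k + 1)) = Nat.card (g 0) := by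
      have h7 := Subgroup.card_mul_index ((g (k + 1)).subgroupOf (g 0))
      have h8 := Nat.card_congr (Subgroup.subgroupOfEquivOfLe (hg (Nat.zero_le (k + 1)))).toEquiv
      rw [h8, mul_comm] at h7
      exact_mod_cast h7
    rw [← h6]
    simp
    field_simp
  have h2 : herbrandFun g j = ∑ k ∈ Finset.range j,
      ∫ t in ((k : ℕ) : ℝ)..((k + 1 : ℕ) : ℝ), herbrandSlope g t := by
    rw [intervalIntegral.sum_integral_adjacent_intervals
      fun k _ => herbrandSlope_intervalIntegrable hg _ _]
    simp [herbrandFun]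
  rw [h2, Finset.sum_mul]
  exact Finset.sum_congr rfl fun k _ => h1 k

variable (g) in
/-- The upper numbering of a filtration. -/
noncomputable def upperNumbering (v : ℝ) : Subgroup G :=
  g ⌈Function.invFunOn (herbrandFun g) (Set.Ici 0) v⌉₊

theorem ne_bot_iff_le (hg : Antitone g) {i : ℕ} (hi : IsGreatest {j : ℕ | 0 < j ∧ g j ≠ ⊥} i)
    (j : ℕ) : g j ≠ ⊥ ↔ j ≤ i := by
  refine ⟨fun hj => ?_, fun hj hbot => hi.1.2 (eq_bot_iff.mpr (hbot ▸ hg hj))⟩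
  rcases Nat.eq_zero_or_pos j with rfl | hpos
  · exact Nat.zero_le _
  · exact hi.2 ⟨hpos, hj⟩

/-- The last upper break is the value of the Herbrand function at the last lower break. -/
theorem last_upper_break (hg : Antitone g) {i : ℕ} (hi : IsGreatest {j : ℕ | 0 < j ∧ g j ≠ ⊥} i)
    {r : ℚ} (hr : IsGreatest {s : ℚ | 1 < s ∧ upperNumbering g ((s : ℝ) - 1) ≠ ⊥} r) :
    (r : ℝ) - 1 = herbrandFun g i ∧ upperNumbering g ((r : ℝ) - 1) = g i := by
  have hinv : ∀ v : ℝ, 0 ≤ v →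
      Function.invFunOn (herbrandFun g) (Set.Ici 0) v ∈ Set.Ici (0 : ℝ) ∧
        herbrandFun g (Function.invFunOn (herbrandFun g) (Set.Ici 0) v) = v := fun v hv =>
    ⟨Function.invFunOn_mem (exists_herbrandFun_eq hg hv),
      Function.invFunOn_eq (exists_herbrandFun_eq hg hv)⟩
  have hmono := herbrandFun_strictMono hg
  have hinvi : Function.invFunOn (herbrandFun g) (Set.Ici 0) (herbrandFun g i) = i :=
    hmono.injective (hinv _ (by
      rw [← herbrandFun_zero (g := g)]
      exact hmono.monotone (Nat.cast_nonneg i))).2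
  have hupi : upperNumbering g (herbrandFun g i) = g i := by
    rw [upperNumbering, hinvi, Nat.ceil_natCast]
  have hpos : 0 < herbrandFun g i := by
    rw [← herbrandFun_zero (g := g)]
    exact hmono (by exact_mod_cast hi.1.1)
  have hcard : ((Nat.card (g 0) : ℕ) : ℝ) ≠ 0 := by exact_mod_cast Nat.card_pos.ne'
  set ρ : ℚ := (∑ k ∈ Finset.range i, (Nat.card (g (k + 1)) : ℚ)) / Nat.card (g 0) with hρ
  have hρφ : (ρ : ℝ) = herbrandFun g i := by
    rw [hρ, Rat.cast_div, eq_comm, eq_div_iff (by exact_mod_cast hcard)]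
    have h1 := herbrandFun_natCast hg i
    push_cast
    exact h1
  have hle : 1 + ρ ≤ r := by
    refine hr.2 ⟨?_, ?_⟩
    · have : (0 : ℝ) < ρ := hρφ ▸ hpos
      have h2 : 0 < ρ := by exact_mod_cast this
      linarith
    · have h1 : ((1 + ρ : ℚ) : ℝ) - 1 = herbrandFun g i := by
        push_cast
        rw [hρφ]
        ring
      rw [h1, hupi]
      exact hi.1.2
  have hr1 : (0 : ℝ) ≤ (r : ℝ) - 1 := by
    have : (1 : ℝ) < r := by exact_mod_cast hr.1.1
    linarith
  have hge : (r : ℝ) - 1 ≤ herbrandFun g i := by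
    have h1 := (ne_bot_iff_le hg hi _).mp hr.1.2
    rw [← (hinv _ hr1).2]
    exact hmono.monotone (Nat.ceil_le.mp h1)
  have heq : (r : ℝ) - 1 = herbrandFun g i := by
    refine le_antisymm hge ?_
    have : ((1 + ρ : ℚ) : ℝ) ≤ r := by exact_mod_cast hle
    push_cast at this
    linarith
  exact ⟨heq, by rw [heq, hupi]⟩

theorem last_upper_break_mul_card (hg : Antitone g) {i : ℕ}
    (hi : IsGreatest {j : ℕ | 0 < j ∧ g j ≠ ⊥} i)
    {r : ℚ} (hr : IsGreatest {s : ℚ | 1 < s ∧ upperNumbering g ((s : ℝ) - 1) ≠ ⊥} r) :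
    ((∑ k ∈ Finset.range (i + 1), Nat.card (g k) : ℕ) : ℚ) = Nat.card (g 0) * r := by
  have h1 := (last_upper_break hg hi hr).1
  have h2 := herbrandFun_natCast hg i
  rw [← h1] at h2
  rw [Finset.sum_range_succ']
  have h3 : ((∑ k ∈ Finset.range i, Nat.card (g (k + 1)) + Nat.card (g 0) : ℕ) : ℝ) =
      Nat.card (g 0) * r := by
    push_cast
    rw [← h2]
    ring
  exact_mod_cast h3

end Herbrand

/-! ### Totally ramified Galois extensions -/

section TotallyRamified

variable {A K L B : Type*} [CommRing A] [IsDomain A] [IsDiscreteValuationRing A]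
  [Field K] [Algebra A K] [IsFractionRing A K]
  [Field L] [Algebra K L] [FiniteDimensional K L] [IsGalois K L]
  [Algebra A L] [IsScalarTower A K L]
  [CommRing B] [IsDomain B] [IsDiscreteValuationRing B]
  [Algebra A B] [Algebra B L] [IsScalarTower A B L] [IsFractionRing B L]
  [IsIntegralClosure B A L]
  {α : B}

include K L in
/-- A totally ramified extension does not change the residue field. -/
theorem exists_dvd_sub_algebraMap
    (htot : (maximalIdeal A).map (algebraMap A B) = maximalIdeal B ^ Module.finrank K L)
    (hα : Irreducible α) (b : B) : ∃ a : A, α ∣ b - algebraMap A B a := by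
  have hfin : Module.Finite A B := IsIntegralClosure.finite A K L B
  have hinj : Function.Injective (algebraMap A B) :=
    (FaithfulSMul.of_field_isFractionRing A B K L).algebraMap_injective A B
  have hp0 : maximalIdeal A ≠ ⊥ := IsDiscreteValuationRing.not_a_field A
  have hpos : 0 < Module.finrank K L := Module.finrank_pos
  have hB0 : maximalIdeal B ≠ ⊥ := IsDiscreteValuationRing.not_a_field B
  have h1 := Ideal.ramificationIdx_mul_inertiaDeg_of_isLocalRing B K L hp0
  have h2 : (maximalIdeal A).ramificationIdx' (maximalIdeal B) = Module.finrank K L := by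
    refine Ideal.ramificationIdx'_spec htot.le ?_
    rw [htot]
    intro hle
    have h3 := (pow_dvd_pow_iff hα.ne_zero hα.not_isUnit).mp (show
      α ^ (Module.finrank K L + 1) ∣ α ^ Module.finrank K L by
        rw [← Ideal.mem_span_singleton, ← Ideal.span_singleton_pow, ← hα.maximalIdeal_eq]
        exact hle (Ideal.pow_mem_pow (hα.maximalIdeal_eq ▸ Ideal.mem_span_singleton_self α) _))
    omega
  rw [h2] at h1
  have h4 : (maximalIdeal A).inertiaDeg' (maximalIdeal B) = 1 := by
    have := Nat.eq_of_mul_eq_mul_left hpos (h1.trans (mul_one _).symm)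
    exact this
  have hloc : IsLocalHom (algebraMap A B) :=
    (algebraMap_isIntegral_iff.mpr inferInstance).isLocalHom hinj
  have hover : (maximalIdeal B).LiesOver (maximalIdeal A) := inferInstance
  rw [Ideal.inertiaDeg'_algebraMap] at h4
  let _ : Field (A ⧸ maximalIdeal A) := Ideal.Quotient.field _
  obtain ⟨y, hy⟩ := (finrank_eq_one_iff_of_nonzero' (K := A ⧸ maximalIdeal A) (1 : B ⧸ maximalIdeal B) one_ne_zero).mp h4
    (Ideal.Quotient.mk _ b)
  obtain ⟨a, rfl⟩ := Ideal.Quotient.mk_surjective y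
  refine ⟨a, ?_⟩
  rw [← Ideal.mem_span_singleton, ← hα.maximalIdeal_eq, ← Ideal.Quotient.eq, ← hy, Algebra.smul_def, mul_one]
  rfl

variable [MulSemiringAction Gal(L/K) B]
  (hcompat : ∀ (σ : Gal(L/K)) (b : B), algebraMap B L (σ • b) = σ (algebraMap B L b))

include hcompat in
theorem smul_algebraMap_of_compat (σ : Gal(L/K)) (a : A) : σ • algebraMap A B a = algebraMap A B a := by
  apply FaithfulSMul.algebraMap_injective B L
  rw [hcompat, ← IsScalarTower.algebraMap_apply, IsScalarTower.algebraMap_apply A K L, AlgEquiv.commutes]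

include hcompat in
theorem galRestrict_eq_smul (σ : Gal(L/K)) (b : B) : galRestrict A K L B σ b = σ • b := by
  apply FaithfulSMul.algebraMap_injective B L
  rw [hcompat, algebraMap_galRestrict_apply]

include hcompat in
theorem mem_lowerRam_iff_forall (hα : Irreducible α) (j : ℕ) (σ : Gal(L/K)) :
    σ ∈ lowerRam A K L B j ↔ ∀ b : B, α ^ (j + 1) ∣ σ • b - b := by
  have h1 : ∀ b : B, σ • b - b ∈ maximalIdeal B ^ (j + 1) ↔ α ^ (j + 1) ∣ σ • b - b := fun b => by
    rw [hα.maximalIdeal_eq, Ideal.span_singleton_pow, Ideal.mem_span_singleton]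
  simp only [← h1]
  change (∀ b : B, galRestrict A K L B σ b - b ∈ maximalIdeal B ^ (j + 1)) ↔ _
  simp only [galRestrict_eq_smul hcompat]

include hcompat in
/-- As `B` is generated by `α` and the elements of `A` up to any power of `α`, the ramification
groups are determined by the action on `α`. -/
theorem mem_lowerRam_iff (hα : Irreducible α) (hres : ∀ b : B, ∃ a : A, α ∣ b - algebraMap A B a)
    (j : ℕ) (σ : Gal(L/K)) :
    σ ∈ lowerRam A K L B j ↔ α ^ (j + 1) ∣ α - σ • α := by
  rw [mem_lowerRam_iff_forall hcompat hα]
  refine ⟨fun h => (dvd_sub_comm).mp (h α), fun h => ?_⟩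
  suffices ∀ N ≤ j + 1, ∀ b : B, α ^ N ∣ σ • b - b from this _ le_rfl
  intro N
  induction N with
  | zero => simp
  | succ N ih =>
    intro hN b
    obtain ⟨a, d, hd⟩ := hres b
    obtain ⟨e, he⟩ := ih (by omega) d
    obtain ⟨k, hk⟩ := (pow_dvd_pow α hN).trans h
    have hb : b = algebraMap A B a + α * d := by rw [← hd]; ring
    have h3 : σ • b = algebraMap A B a + (σ • α) * (σ • d) := by
      rw [hb, smul_add, smul_mul', smul_algebraMap_of_compat hcompat]
    refine ⟨e - k * σ • d, ?_⟩
    rw [h3, hb]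
    linear_combination (-(σ • d)) * hk + α * he

theorem lowerRam_antitone : Antitone (lowerRam A K L B) := by
  intro j k hjk σ hσ x
  exact Ideal.pow_le_pow_right (by omega) (hσ x)

include hcompat in
theorem smul_associated_of_irreducible (hα : Irreducible α) (σ : Gal(L/K)) : Associated (σ • α) α :=
  IsDiscreteValuationRing.associated_of_irreducible B
    ((MulEquiv.irreducible_iff (MulSemiringAction.toRingEquiv Gal(L/K) B σ)).mpr hα) hα

include hcompat in
theorem lowerRam_zero (hα : Irreducible α) (hres : ∀ b : B, ∃ a : A, α ∣ b - algebraMap A B a) :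
    lowerRam A K L B 0 = ⊤ := by
  rw [eq_top_iff]
  intro σ _
  rw [mem_lowerRam_iff hcompat hα hres, zero_add, pow_one]
  exact dvd_sub dvd_rfl (smul_associated_of_irreducible hcompat hα σ).symm.dvd

variable {i : ℕ} (hi : IsGreatest {j : ℕ | 0 < j ∧ lowerRam A K L B j ≠ ⊥} i)

include hcompat hi in
theorem hasLastBreak_lowerRam (hα : Irreducible α)
    (hres : ∀ b : B, ∃ a : A, α ∣ b - algebraMap A B a) :
    HasLastBreak (lowerRam A K L B i) α i where
  irreducible := hα
  mem_iff := mem_lowerRam_iff hcompat hα hres i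
  associated σ hσ hσ1 := by
    have h1 := (mem_lowerRam_iff hcompat hα hres i σ).mp hσ
    have hbot : lowerRam A K L B (i + 1) = ⊥ := by
      by_contra hne
      exact absurd ((ne_bot_iff_le lowerRam_antitone hi _).mp hne) (by omega)
    have h2 : ¬ α ^ (i + 2) ∣ α - σ • α := by
      rw [← mem_lowerRam_iff hcompat hα hres (i + 1) σ, hbot, Subgroup.mem_bot]
      exact hσ1
    have h0 : α - σ • α ≠ 0 := fun h0 => h2 (h0 ▸ dvd_zero _)
    obtain ⟨s, hs⟩ := IsDiscreteValuationRing.associated_pow_irreducible h0 hα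
    rw [hs.dvd_iff_dvd_right, pow_dvd_pow_iff hα.ne_zero hα.not_isUnit] at h1 h2
    have : s = i + 1 := by omega
    rwa [this] at hs
  exists_fixed b := by
    obtain ⟨a, ha⟩ := hres b
    exact ⟨algebraMap A B a, fun σ => smul_algebraMap_of_compat hcompat σ a, ha⟩

include hcompat hi in
theorem smul_uniformizer_injective (hα : Irreducible α)
    (hres : ∀ b : B, ∃ a : A, α ∣ b - algebraMap A B a) :
    Function.Injective fun σ : Gal(L/K) => σ • α := by
  intro σ τ he
  have he' : σ • α = τ • α := he
  have h1 : (τ⁻¹ * σ) • α = α := by rw [mul_smul, he', inv_smul_smul]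
  have hbot : lowerRam A K L B (i + 1) = ⊥ := by
    by_contra hne
    exact absurd ((ne_bot_iff_le lowerRam_antitone hi _).mp hne) (by omega)
  have h2 : τ⁻¹ * σ ∈ lowerRam A K L B (i + 1) := by
    rw [mem_lowerRam_iff hcompat hα hres, h1, sub_self]
    exact dvd_zero _
  rw [hbot, Subgroup.mem_bot] at h2
  exact (inv_mul_eq_one.mp h2).symm

include hcompat hi in
theorem minpoly_map_eq_prod (hα : Irreducible α)
    (hres : ∀ b : B, ∃ a : A, α ∣ b - algebraMap A B a) :
    (minpoly A α).map (algebraMap A L) =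
      ∏ σ : Gal(L/K), (X - C (algebraMap B L (σ • α))) := by
  have hint : IsIntegral A α := IsIntegralClosure.isIntegral A L α
  have hmap : (minpoly A α).map (algebraMap A K) = minpoly K (algebraMap B L α) :=
    (minpoly.isIntegrallyClosed_eq_field_fractions K L hint).symm
  have hmonic : ((minpoly A α).map (algebraMap A L)).Monic := (minpoly.monic hint).map _
  refine eq_of_monic_of_dvd_of_natDegree_le (monic_prod_of_monic _ _ fun σ _ => monic_X_sub_C _)
    hmonic ?_ ?_
  · refine Finset.prod_dvd_of_coprime (fun σ _ τ _ hστ => ?_) fun σ _ => ?_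
    · refine pairwise_coprime_X_sub_C (s := fun σ : Gal(L/K) => algebraMap B L (σ • α)) ?_ hστ
      exact (FaithfulSMul.algebraMap_injective B L).comp
        (smul_uniformizer_injective hcompat hi hα hres)
    · rw [dvd_iff_isRoot, IsRoot.def, hcompat, IsScalarTower.algebraMap_eq A K L, ← Polynomial.map_map,
        hmap, eval_map_algebraMap, aeval_algHom_apply, minpoly.aeval, map_zero]
  · rw [natDegree_prod_of_monic _ _ fun σ _ => monic_X_sub_C _]
    simp only [natDegree_X_sub_C, Finset.sum_const, Finset.card_univ, smul_eq_mul, mul_one]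
    rw [IsScalarTower.algebraMap_eq A K L, ← Polynomial.map_map, hmap,
      (minpoly.monic (Algebra.IsIntegral.isIntegral _)).natDegree_map, ← Nat.card_eq_fintype_card,
      IsGalois.card_aut_eq_finrank]
    exact minpoly.natDegree_le _

include hcompat in
/-- The two ways of counting the pairs of an automorphism and a ramification group `G_k`, `k ≤ i`, that
contains it. -/
theorem prod_gap_associated_pow_sum (hα : Irreducible α)
    (hres : ∀ b : B, ∃ a : A, α ∣ b - algebraMap A B a) :
    Associated (∏ τ : Gal(L/K), HasLastBreak.gap (lowerRam A K L B i) α i 1 τ)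
      (α ^ ∑ k ∈ Finset.range (i + 1), Nat.card (lowerRam A K L B k)) := by
  classical
  have h1 : ∀ k, Nat.card (lowerRam A K L B k) =
      ∑ τ : Gal(L/K), if τ ∈ lowerRam A K L B k then 1 else 0 := by
    intro k
    rw [Finset.sum_boole, Nat.cast_id, Nat.card_eq_fintype_card, Fintype.card_subtype]
  simp only [h1]
  rw [Finset.sum_comm, ← Finset.prod_pow_eq_pow_sum]
  refine Associated.prod _ _ _ fun τ _ => ?_
  rw [Finset.sum_boole, Nat.cast_id]
  by_cases hτ : τ ∈ lowerRam A K L B i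
  · rw [HasLastBreak.gap, if_pos (by simpa using hτ), Finset.filter_true_of_mem fun k hk =>
      lowerRam_antitone (Nat.lt_succ_iff.mp (Finset.mem_range.mp hk)) hτ, Finset.card_range]
    exact Associated.refl _
  · rw [HasLastBreak.gap, if_neg (by simpa using hτ), one_smul]
    have h2 : ¬ α ^ (i + 1) ∣ α - τ • α := by rwa [← mem_lowerRam_iff hcompat hα hres]
    have h0 : α - τ • α ≠ 0 := fun h0 => h2 (h0 ▸ dvd_zero _)
    obtain ⟨s, hs⟩ := IsDiscreteValuationRing.associated_pow_irreducible h0 hα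
    rw [hs.dvd_iff_dvd_right, pow_dvd_pow_iff hα.ne_zero hα.not_isUnit] at h2
    have h3 : Finset.filter (fun k => τ ∈ lowerRam A K L B k) (Finset.range (i + 1)) =
        Finset.range s := by
      ext k
      rw [Finset.mem_filter, Finset.mem_range, Finset.mem_range,
        mem_lowerRam_iff hcompat hα hres, hs.dvd_iff_dvd_right,
        pow_dvd_pow_iff hα.ne_zero hα.not_isUnit]
      omega
    rwa [h3, Finset.card_range]

section Different

variable (hf : (minpoly A α).map (algebraMap A L) =
  ∏ σ : Gal(L/K), (X - C (algebraMap B L (σ • α))))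

include hf in
theorem minpoly_map_eq_prod_smul :
    (minpoly A α).map (algebraMap A B) = ∏ σ : Gal(L/K), (X - C (σ • α)) := by
  apply map_injective _ (FaithfulSMul.algebraMap_injective B L)
  rw [Polynomial.map_map, ← IsScalarTower.algebraMap_eq, minpoly_eq_map hf]

include hf in
theorem algebraMap_coeff_zero_minpoly_associated (hα : Irreducible α) :
    Associated (algebraMap A B ((minpoly A α).coeff 0)) (α ^ Module.finrank K L) := by
  rw [← coeff_map, minpoly_map_eq_prod_smul hf, coeff_zero_prod, ← IsGalois.card_aut_eq_finrank,
    Nat.card_eq_fintype_card, ← Finset.card_univ, ← Finset.prod_const]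
  refine Associated.prod _ _ _ fun σ _ => ?_
  rw [coeff_sub, coeff_X_zero, coeff_C_zero, zero_sub]
  exact (Associated.refl _).neg_left.trans (IsDiscreteValuationRing.associated_of_irreducible B
    ((MulEquiv.irreducible_iff (MulSemiringAction.toRingEquiv Gal(L/K) B σ)).mpr hα) hα)

open Classical in
include hf in
/-- `f'(α)` is the product of the differences `α - σ α`. -/
theorem aeval_derivative_minpoly (H : Subgroup Gal(L/K)) [Fintype H] :
    aeval α (derivative (minpoly A α)) =
      (∏ τ : Gal(L/K) with τ ∉ H, (α - τ • α)) * HasSingleBreak.different H α := by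
  have h1 : aeval α (derivative (minpoly A α)) =
      (derivative ((minpoly A α).map (algebraMap A B))).eval α := by
    rw [derivative_map, eval_map_algebraMap]
  rw [h1, minpoly_map_eq_prod_smul hf, ← Finset.mul_prod_erase _ _ (Finset.mem_univ (1 : Gal(L/K)))]
  rw [derivative_mul, eval_add, eval_mul, eval_mul]
  simp only [one_smul, derivative_sub, derivative_X, derivative_C, sub_zero, eval_one, one_mul,
    eval_sub, eval_X, eval_C, sub_self, zero_mul, add_zero, eval_prod]
  rw [HasSingleBreak.different]
  have h2 : ∏ σ ∈ Finset.univ.erase (1 : H), (α - σ • α) =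
      ∏ τ ∈ Finset.univ.erase (1 : Gal(L/K)) with τ ∈ H, (α - τ • α) := by
    refine Finset.prod_bij (fun σ _ => (σ : Gal(L/K))) (fun σ hσ => ?_) (fun σ _ τ _ he =>
      Subtype.ext he) (fun τ hτ => ?_) fun σ _ => rfl
    · simpa using hσ
    · simp only [Finset.mem_filter, Finset.mem_erase, Finset.mem_univ, and_true] at hτ
      exact ⟨⟨τ, hτ.2⟩, by simpa using hτ.1, rfl⟩
  rw [h2, ← Finset.prod_filter_mul_prod_filter_not _ (fun τ => τ ∈ H), mul_comm]
  congr 1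
  refine Finset.prod_congr ?_ fun _ _ => rfl
  ext τ
  simp only [Finset.mem_filter, Finset.mem_erase, Finset.mem_univ, and_true, true_and,
    and_iff_right_iff_imp]
  rintro hτ rfl
  exact hτ H.one_mem

open Classical in
theorem prod_gap_eq {H : Subgroup Gal(L/K)} [Fintype H] :
    ∏ τ : Gal(L/K), HasLastBreak.gap H α i 1 τ =
      (∏ τ : Gal(L/K) with τ ∉ H, (α - τ • α)) * α ^ ((i + 1) * Fintype.card H) := by
  rw [← Finset.prod_filter_mul_prod_filter_not _ (fun τ => τ ∈ H), mul_comm]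
  congr 1
  · refine Finset.prod_congr rfl fun τ hτ => ?_
    rw [HasLastBreak.gap, if_neg (by simpa using hτ), one_smul]
  · rw [pow_mul, Fintype.card_of_subtype (Finset.univ.filter fun τ => τ ∈ H) (by simp),
      ← Finset.prod_const]
    refine Finset.prod_congr rfl fun τ hτ => ?_
    rw [HasLastBreak.gap, if_pos (by simpa using hτ)]

include hf in
theorem aeval_derivative_mul_pow_associated {H : Subgroup Gal(L/K)} {m : ℕ}
    (hm : Associated (∏ τ : Gal(L/K), HasLastBreak.gap H α i 1 τ) (α ^ m))
    (h : HasLastBreak H α i) :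
    Associated (aeval α (derivative (minpoly A α)) * α ^ (i + 1)) (α ^ m) := by
  classical
  refine Associated.trans ?_ hm
  rw [aeval_derivative_minpoly hf H, prod_gap_eq, mul_assoc]
  refine (Associated.refl _).mul_mul ?_
  have h1 := (h.hasSingleBreak.different_associated).mul_mul (Associated.refl (α ^ (i + 1)))
  refine h1.trans ?_
  obtain ⟨k, hk⟩ : ∃ k, Fintype.card H = k + 1 :=
    ⟨_, (Nat.sub_add_cancel Fintype.card_pos).symm⟩
  rw [← pow_add, hk, Nat.add_sub_cancel, mul_add, mul_one]
  exact Associated.refl _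

end Different

end TotallyRamified

/-! ### The norm composed with the inverse of the trace -/

theorem coeff_one_prod_one_add_X_mul {ι R : Type*} [CommRing R] (t : Finset ι) (y : ι → R) :
    (∏ σ ∈ t, (1 + X * C (y σ))).coeff 1 = ∑ σ ∈ t, y σ := by
  classical
  induction t using Finset.induction_on with
  | empty => simp [coeff_one]
  | insert σ t hσ ih =>
    rw [Finset.prod_insert hσ, Finset.sum_insert hσ, add_mul, one_mul, coeff_add, ih, mul_assoc,
      coeff_X_mul, coeff_C_mul, coeff_zero_prod]
    simp [add_comm]

namespace HasSingleBreak

variable {B : Type*} [CommRing B] [IsDomain B] [IsDiscreteValuationRing B]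
  {H : Type*} [Group H] [MulSemiringAction H B] {α : B} {i : ℕ}

theorem residue_eq_zero_iff_dvd (h : HasSingleBreak H α i) (b : B) : residue B b = 0 ↔ α ∣ b := by
  rw [residue_eq_zero_iff, h.irreducible.maximalIdeal_eq, Ideal.mem_span_singleton]

theorem residue_uniformizer (h : HasSingleBreak H α i) : residue B α = 0 :=
  (h.residue_eq_zero_iff_dvd α).mpr dvd_rfl

/-- The action on the residue field is trivial. -/
theorem residue_smul (h : HasSingleBreak H α i) (σ : H) (b : B) : residue B (σ • b) = residue B b := by
  obtain ⟨a, ha, hb⟩ := h.exists_fixed b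
  have h1 : α ∣ σ • b - a := by
    obtain ⟨d, hd⟩ := hb
    rw [← ha σ, ← smul_sub, hd, smul_mul']
    exact Dvd.dvd.mul_right (h.smul_associated σ).symm.dvd _
  have h2 := dvd_sub h1 hb
  rw [sub_sub_sub_cancel_right, ← h.residue_eq_zero_iff_dvd, map_sub, sub_eq_zero] at h2
  exact h2

section Coordinates

variable {c : H → B} (hc : ∀ σ : H, σ • α = α + α ^ (i + 1) * c σ)

include hc

/-- The coordinate of `σ α` in the disc around `α` is additive in `σ` modulo `α`. -/
theorem residue_coord_mul (h : HasSingleBreak H α i) (hi : 0 < i) (σ τ : H) :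
    residue B (c (σ * τ)) = residue B (c σ) + residue B (c τ) := by
  have h1 := hc (σ * τ)
  rw [mul_smul, hc τ, smul_add, hc σ, smul_mul', smul_pow', hc σ] at h1
  have h2 : α + α ^ (i + 1) * c σ = α * (1 + α ^ i * c σ) := by ring
  have h3 : c (σ * τ) = c σ + (1 + α ^ i * c σ) ^ (i + 1) * σ • c τ := by
    apply mul_left_cancel₀ (pow_ne_zero (i + 1) h.irreducible.ne_zero)
    have h4 : (α + α ^ (i + 1) * c σ) ^ (i + 1) = α ^ (i + 1) * (1 + α ^ i * c σ) ^ (i + 1) := by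
      rw [h2, mul_pow]
    rw [h4] at h1
    linear_combination -h1
  rw [h3, map_add, map_mul, map_pow, map_add, map_mul, map_pow, h.residue_uniformizer, zero_pow hi.ne',
    zero_mul, add_zero, map_one, one_pow, one_mul, h.residue_smul]

theorem residue_coord_ne_zero (h : HasSingleBreak H α i) {σ : H} (hσ : σ ≠ 1) :
    residue B (c σ) ≠ 0 := by
  rw [Ne, h.residue_eq_zero_iff_dvd]
  intro hd
  have h1 : α ^ (i + 1) * α ∣ α - σ • α := by
    rw [hc σ, sub_add_cancel_left, dvd_neg]
    exact mul_dvd_mul_left _ hd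
  rw [(h.associated σ hσ).dvd_iff_dvd_right, ← pow_succ,
    pow_dvd_pow_iff h.irreducible.ne_zero h.irreducible.not_isUnit] at h1
  omega

theorem residue_coord_one (h : HasSingleBreak H α i) : residue B (c 1) = 0 := by
  have h1 := hc 1
  rw [one_smul, left_eq_add, mul_eq_zero] at h1
  rw [h1.resolve_left (pow_ne_zero _ h.irreducible.ne_zero), map_zero]

theorem residue_coord_injective (h : HasSingleBreak H α i) (hi : 0 < i) :
    Function.Injective fun σ : H => residue B (c σ) := by
  intro σ τ he
  have he' : residue B (c σ) = residue B (c τ) := he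
  by_contra hne
  refine h.residue_coord_ne_zero hc (σ := σ * τ⁻¹) (fun h1 => hne (mul_inv_eq_one.mp h1)) ?_
  have h1 := h.residue_coord_mul hc hi (σ * τ⁻¹) τ
  rw [inv_mul_cancel_right, he'] at h1
  simpa using h1

end Coordinates

variable [Fintype H] [DecidableEq H]

/-- An invariant element that is not a unit is divisible by `α ^ q`, where `q` is the order of `H`.
Indeed multiplication by it maps an element of `m ^ i` whose trace has the smallest possible valuation
into `m ^ (i + 1)`. -/
theorem pow_card_dvd_of_fixed (h : HasSingleBreak H α i) {z : B} (hfix : ∀ σ : H, σ • z = z)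
    (hz : α ∣ z) : α ^ Fintype.card H ∣ z := by
  set ϖ : B := ∏ σ : H, σ • α with hϖ
  have hϖfix : ∀ τ : H, τ • ϖ = ϖ := fun τ => by
    rw [hϖ, Finset.smul_prod']
    simp_rw [← mul_smul]
    exact Equiv.prod_comp (Equiv.mulLeft τ) fun σ : H => σ • α
  have hϖi : Associated (ϖ ^ i) (α ^ (i * Fintype.card H)) := by
    rw [mul_comm, pow_mul]
    exact h.prod_smul_associated.pow_pow
  obtain ⟨w, hw, htr⟩ := h.exists_trace_eq (n := i) le_rfl (z := ϖ ^ i)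
    (fun σ => by rw [smul_pow', hϖfix]) hϖi.symm.dvd
  have h1 := h.pow_dvd_trace (n := i + 1) le_rfl (x := z * w)
    (by rw [pow_succ']; exact mul_dvd_mul hz hw)
  simp only [smul_mul', hfix] at h1
  rw [← Finset.mul_sum, htr, add_mul, one_mul, add_comm, pow_add,
    ((Associated.refl z).mul_mul hϖi).dvd_iff_dvd_right] at h1
  exact (mul_dvd_mul_iff_right (pow_ne_zero _ h.irreducible.ne_zero)).mp h1

/-- The trace is injective on `m ^ i / m ^ (i + 1)`. -/
theorem pow_dvd_of_pow_dvd_trace (h : HasSingleBreak H α i) {w : B} (hw : α ^ i ∣ w)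
    (htr : α ^ ((i + 1) * Fintype.card H) ∣ ∑ σ : H, σ • w) : α ^ (i + 1) ∣ w := by
  obtain ⟨b, rfl⟩ := hw
  rw [pow_succ, mul_dvd_mul_iff_left (pow_ne_zero _ h.irreducible.ne_zero)]
  by_contra hb
  obtain ⟨d, hd⟩ : IsUnit b := by
    by_contra hu
    exact hb (by
      rw [← Ideal.mem_span_singleton, ← h.irreducible.maximalIdeal_eq]
      exact hu)
  -- every element of `m ^ i` is a fixed multiple of `α ^ i b` up to `m ^ (i + 1)`
  have key : ∀ y : B, α ^ i ∣ y → α ^ ((i + 1) * Fintype.card H) ∣ ∑ σ : H, σ • y := by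
    rintro _ ⟨y, rfl⟩
    obtain ⟨a, ha, e, he⟩ := h.exists_fixed (y * ((d⁻¹ : Bˣ) : B))
    have h1 : α ^ i * y = a * (α ^ i * b) + α ^ (i + 1) * (e * b) := by
      have h2 : ((d⁻¹ : Bˣ) : B) * b = 1 := by rw [← hd, Units.inv_mul]
      linear_combination α ^ i * b * he - α ^ i * y * h2
    have h2 : ∀ σ : H, σ • (a * (α ^ i * b) + α ^ (i + 1) * (e * b)) =
        a * σ • (α ^ i * b) + σ • (α ^ (i + 1) * (e * b)) := fun σ => by
      rw [smul_add, smul_mul' σ a, ha]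
    rw [h1, Finset.sum_congr rfl fun σ _ => h2 σ, Finset.sum_add_distrib, ← Finset.mul_sum]
    exact dvd_add (Dvd.dvd.mul_left htr _) (h.pow_dvd_trace le_rfl (Dvd.intro _ rfl))
  set ϖ : B := ∏ σ : H, σ • α with hϖ
  have hϖfix : ∀ τ : H, τ • ϖ = ϖ := fun τ => by
    rw [hϖ, Finset.smul_prod']
    simp_rw [← mul_smul]
    exact Equiv.prod_comp (Equiv.mulLeft τ) fun σ : H => σ • α
  have hϖi : Associated (ϖ ^ i) (α ^ (i * Fintype.card H)) := by
    rw [mul_comm, pow_mul]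
    exact h.prod_smul_associated.pow_pow
  obtain ⟨w, hw, htr'⟩ := h.exists_trace_eq (n := i) le_rfl (z := ϖ ^ i)
    (fun σ => by rw [smul_pow', hϖfix]) hϖi.symm.dvd
  have h1 := key w hw
  rw [htr', hϖi.dvd_iff_dvd_right, pow_dvd_pow_iff h.irreducible.ne_zero h.irreducible.not_isUnit,
    add_mul, one_mul] at h1
  have := Fintype.card_pos (α := H)
  omega

variable (B) in
/-- The additive polynomial with roots the coordinates of the conjugates `σ α` and with linear
coefficient `1`. -/
noncomputable def rootPoly (c : H → B) : (ResidueField B)[X] :=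
  C (∏ σ ∈ Finset.univ.erase (1 : H), (-residue B (c σ)))⁻¹ * ∏ σ : H, (X - C (residue B (c σ)))

section RootPoly

variable {c : H → B} (hc : ∀ σ : H, σ • α = α + α ^ (i + 1) * c σ)

include hc

theorem prod_neg_residue_coord_ne_zero (h : HasSingleBreak H α i) :
    ∏ σ ∈ Finset.univ.erase (1 : H), (-residue B (c σ)) ≠ 0 :=
  Finset.prod_ne_zero_iff.mpr fun _ hσ =>
    neg_ne_zero.mpr (h.residue_coord_ne_zero hc (Finset.ne_of_mem_erase hσ))

theorem coeff_one_rootPoly (h : HasSingleBreak H α i) : (rootPoly B c).coeff 1 = 1 := by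
  rw [rootPoly, coeff_C_mul, ← Finset.mul_prod_erase _ _ (Finset.mem_univ (1 : H)),
    h.residue_coord_one hc, C_0, sub_zero, coeff_X_mul, coeff_zero_prod]
  simp only [coeff_sub, coeff_X_zero, coeff_C_zero, zero_sub]
  exact inv_mul_cancel₀ (h.prod_neg_residue_coord_ne_zero hc)

theorem eval_rootPoly_zero (h : HasSingleBreak H α i) : (rootPoly B c).eval 0 = 0 := by
  rw [rootPoly, eval_mul, ← Finset.mul_prod_erase _ _ (Finset.mem_univ (1 : H)),
    h.residue_coord_one hc]
  simp

omit hc in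
theorem eval_rootPoly (c : H → B) (σ : H) : (rootPoly B c).eval (residue B (c σ)) = 0 := by
  rw [rootPoly, eval_mul, eval_prod, Finset.prod_eq_zero (Finset.mem_univ σ) (by simp), mul_zero]

omit hc in
theorem natDegree_rootPoly_le (c : H → B) : (rootPoly B c).natDegree ≤ Fintype.card H := by
  refine (natDegree_C_mul_le _ _).trans ?_
  rw [natDegree_prod_of_monic _ _ fun σ _ => monic_X_sub_C _]
  simp

/-- A polynomial of degree at most `q` that vanishes at the `q` points `c σ / s` is determined by its
linear coefficient. -/
theorem eq_rootPoly_comp (h : HasSingleBreak H α i) (hi : 0 < i) {R : (ResidueField B)[X]}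
    {s : ResidueField B} (hs : s ≠ 0) (hdeg : R.natDegree ≤ Fintype.card H) (h1 : R.coeff 1 = s)
    (hroot : ∀ σ : H, R.eval (residue B (c σ) / s) = 0) : R = (rootPoly B c).comp (C s * X) := by
  set N := (rootPoly B c).comp (C s * X) with hN
  have hNdeg : N.natDegree ≤ Fintype.card H := by
    refine natDegree_comp_le.trans ?_
    rw [natDegree_C_mul_X _ hs, mul_one]
    exact natDegree_rootPoly_le c
  have hN1 : N.coeff 1 = s := by
    rw [hN, comp_C_mul_X_coeff, h.coeff_one_rootPoly hc, pow_one, one_mul]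
  have hNroot : ∀ σ : H, N.eval (residue B (c σ) / s) = 0 := by
    intro σ
    rw [hN, eval_comp, eval_mul, eval_C, eval_X, mul_div_cancel₀ _ hs, eval_rootPoly]
  have hinj : Function.Injective fun σ : H => residue B (c σ) / s := fun σ τ he =>
    h.residue_coord_injective hc hi (by
      rwa [div_left_inj' hs] at he)
  classical
  -- a combination of the two polynomials has degree less than `q`, hence vanishes
  have hcomb : C (N.coeff (Fintype.card H)) * R - C (R.coeff (Fintype.card H)) * N = 0 := by
    refine eq_zero_of_degree_lt_of_eval_finset_eq_zero (Finset.univ.image fun σ : H => residue B (c σ) / s) ?_ ?_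
    · rw [Finset.card_image_of_injective _ hinj, Finset.card_univ, degree_lt_iff_coeff_zero]
      intro k hk
      rcases hk.eq_or_lt with rfl | hk
      · rw [coeff_sub, coeff_C_mul, coeff_C_mul]
        ring
      · rw [coeff_sub, coeff_C_mul, coeff_C_mul, coeff_eq_zero_of_natDegree_lt (hdeg.trans_lt hk),
          coeff_eq_zero_of_natDegree_lt (hNdeg.trans_lt hk)]
        ring
    · intro x hx
      obtain ⟨σ, -, rfl⟩ := Finset.mem_image.mp hx
      rw [eval_sub, eval_mul, eval_mul, hroot, hNroot]
      simp
  have hlead : N.coeff (Fintype.card H) ≠ 0 := by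
    rw [hN, comp_C_mul_X_coeff, rootPoly, coeff_C_mul]
    refine mul_ne_zero (mul_ne_zero (inv_ne_zero (h.prod_neg_residue_coord_ne_zero hc)) ?_)
      (pow_ne_zero _ hs)
    have h2 : (∏ σ : H, (X - C (residue B (c σ)))).Monic :=
      monic_prod_of_monic _ _ fun σ _ => monic_X_sub_C _
    have h3 : (∏ σ : H, (X - C (residue B (c σ)))).natDegree = Fintype.card H := by
      rw [natDegree_prod_of_monic _ _ fun σ _ => monic_X_sub_C _]
      simp
    rw [← h3, h2.coeff_natDegree]
    exact one_ne_zero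
  have h2 := congrArg (fun P => P.coeff 1) hcomb
  simp only [coeff_sub, coeff_C_mul, h1, hN1, coeff_zero] at h2
  have h3 : N.coeff (Fintype.card H) = R.coeff (Fintype.card H) :=
    mul_right_cancel₀ hs (sub_eq_zero.mp h2)
  rw [← h3, ← mul_sub, mul_eq_zero, C_eq_zero] at hcomb
  exact sub_eq_zero.mp (hcomb.resolve_left hlead)

/-- The norm of a unit congruent to `σ α / α` modulo `m ^ (i + 1)` is congruent to `1` modulo the
power `i + 1` of the maximal ideal of the ring of invariants. -/
theorem pow_dvd_norm_sub_one (h : HasSingleBreak H α i) (σ : H) {y : B}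
    (hy : α ^ (i + 1) ∣ y - α ^ i * c σ) :
    α ^ ((i + 1) * Fintype.card H) ∣ ∏ τ : H, (1 + τ • y) - 1 := by
  obtain ⟨d, hd⟩ := hy
  have hu : IsUnit (1 + α ^ i * c σ) := by
    have h1 : α * (1 + α ^ i * c σ) = σ • α := by rw [hc σ]; ring
    obtain ⟨u, hu⟩ := (h.smul_associated σ).symm
    have h2 : 1 + α ^ i * c σ = u :=
      mul_left_cancel₀ h.irreducible.ne_zero (h1.trans hu.symm)
    rw [h2]
    exact u.isUnit
  obtain ⟨u, hu⟩ := hu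
  have hnorm : ∏ τ : H, τ • (1 + α ^ i * c σ) = 1 := by
    have h1 : ∏ τ : H, τ • (α * (1 + α ^ i * c σ)) = ∏ τ : H, τ • α := by
      have h2 : α * (1 + α ^ i * c σ) = σ • α := by rw [hc σ]; ring
      rw [h2]
      simp_rw [← mul_smul]
      exact Equiv.prod_comp (Equiv.mulRight σ) fun τ : H => τ • α
    simp only [smul_mul' _ α] at h1
    rw [Finset.prod_mul_distrib] at h1
    refine mul_left_cancel₀ ?_ (h1.trans (mul_one _).symm)
    rw [h.prod_smul_associated.ne_zero_iff]
    exact pow_ne_zero _ h.irreducible.ne_zero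
  set x : B := ((u⁻¹ : Bˣ) : B) * (α ^ (i + 1) * d) with hx
  have hfac : 1 + y = (1 + α ^ i * c σ) * (1 + x) := by
    have h1 : (u : B) * ((u⁻¹ : Bˣ) : B) = 1 := u.mul_inv
    rw [hu] at h1
    rw [hx]
    linear_combination hd - (α ^ (i + 1) * d) * h1
  have hprod : ∏ τ : H, (1 + τ • y) = ∏ τ : H, (1 + τ • x) := by
    have h1 : ∀ τ : H, 1 + τ • y = τ • (1 + α ^ i * c σ) * (1 + τ • x) := fun τ => by
      have h2 := congrArg (fun z => τ • z) hfac
      simpa only [smul_mul', smul_add, smul_one] using h2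
    rw [Finset.prod_congr rfl fun τ _ => h1 τ, Finset.prod_mul_distrib, hnorm, one_mul]
  have heval : ∏ τ : H, (1 + τ • x) = (∏ τ : H, (1 + X * C (τ • x))).eval 1 := by
    rw [eval_prod]
    simp
  have hcoeff : (∏ τ : H, (1 + X * C (τ • x))).coeff 0 = 1 := by
    rw [coeff_zero_prod]
    simp
  rw [hprod, heval, eval_eq_sum_range, Finset.sum_range_succ', hcoeff]
  simp only [one_pow, mul_one, add_sub_cancel_right]
  refine Finset.dvd_sum fun k _ => h.pow_dvd_coeff_norm (Nat.le_succ i) le_rfl ?_ (Nat.succ_ne_zero k)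
  rw [hx]
  exact Dvd.dvd.mul_left (Dvd.intro _ rfl) _

/-- The composite of the norm with the inverse of the trace is given by the additive polynomial
`rootPoly` in the coordinate of `m ^ i / m ^ (i + 1)` given by `α ^ i`. Here `α ^ i b k` has the
same trace as the `k`-th coefficient of the norm of `1 + t α ^ i s`. -/
theorem sum_monomial_residue_eq_rootPoly_comp (h : HasSingleBreak H α i) (hi : 0 < i) (s : B) {b : ℕ → B}
    (hb0 : b 0 = 0) (hb : ∀ k ≠ 0, ∑ σ : H, σ • (α ^ i * b k) =
      (∏ σ : H, (1 + X * C (σ • (α ^ i * s)))).coeff k) :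
    ∑ k ∈ Finset.range (Fintype.card H + 1), monomial k (residue B (b k)) =
      (rootPoly B c).comp (C (residue B s) * X) := by
  have hdegP : (∏ σ : H, (1 + X * C (σ • (α ^ i * s)))).natDegree ≤ Fintype.card H := by
    refine (natDegree_prod_le _ _).trans ?_
    refine (Finset.sum_le_card_nsmul _ _ 1 fun σ _ => ?_).trans (by simp)
    compute_degree
  rcases eq_or_ne (residue B s) 0 with hs | hs
  · rw [hs, C_0, zero_mul, comp_zero, h.eval_rootPoly_zero hc, C_0]
    refine Finset.sum_eq_zero fun k _ => ?_
    rw [monomial_eq_zero_iff]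
    rcases eq_or_ne k 0 with rfl | hk
    · rw [hb0, map_zero]
    · rw [h.residue_eq_zero_iff_dvd,
        ← mul_dvd_mul_iff_left (pow_ne_zero i h.irreducible.ne_zero), ← pow_succ]
      refine h.pow_dvd_of_pow_dvd_trace (Dvd.intro _ rfl) ?_
      rw [hb k hk]
      refine h.pow_dvd_coeff_norm (Nat.le_succ i) le_rfl ?_ hk
      rw [pow_succ]
      exact mul_dvd_mul_left _ ((h.residue_eq_zero_iff_dvd s).mp hs)
  · refine h.eq_rootPoly_comp hc hi hs ?_ ?_ fun σ => ?_
    · refine natDegree_sum_le_of_forall_le _ _ fun k hk => (natDegree_monomial_le _).trans ?_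
      exact Nat.lt_succ_iff.mp (Finset.mem_range.mp hk)
    · have h1 : α ^ (i + 1) ∣ α ^ i * (b 1 - s) := by
        refine h.pow_dvd_of_pow_dvd_trace (Dvd.intro _ rfl) ?_
        simp only [mul_sub, smul_sub]
        rw [Finset.sum_sub_distrib, hb 1 one_ne_zero, coeff_one_prod_one_add_X_mul, sub_self]
        exact dvd_zero _
      rw [pow_succ, mul_dvd_mul_iff_left (pow_ne_zero i h.irreducible.ne_zero),
        ← h.residue_eq_zero_iff_dvd, map_sub, sub_eq_zero] at h1
      rw [finsetSum_coeff, Finset.sum_eq_single 1 (fun k _ hk => coeff_monomial_of_ne _ hk.symm)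
        fun h2 => absurd (Finset.mem_range.mpr (Nat.succ_lt_succ Fintype.card_pos)) h2,
        coeff_monomial_same, h1]
    · obtain ⟨a', ha'⟩ := residue_surjective (residue B (c σ) / residue B s)
      obtain ⟨a, ha, haa⟩ := h.exists_fixed a'
      rw [← h.residue_eq_zero_iff_dvd, map_sub, ha', sub_eq_zero] at haa
      have heval : (∑ k ∈ Finset.range (Fintype.card H + 1), monomial k (residue B (b k))).eval
          (residue B (c σ) / residue B s) =
          residue B (∑ k ∈ Finset.range (Fintype.card H + 1), b k * a ^ k) := by
        rw [haa, eval_finsetSum, map_sum]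
        exact Finset.sum_congr rfl fun k _ => by rw [eval_monomial, map_mul, map_pow]
      rw [heval, h.residue_eq_zero_iff_dvd,
        ← mul_dvd_mul_iff_left (pow_ne_zero i h.irreducible.ne_zero), ← pow_succ]
      refine h.pow_dvd_of_pow_dvd_trace (Dvd.intro _ rfl) ?_
      have htr : ∑ τ : H, τ • (α ^ i * ∑ k ∈ Finset.range (Fintype.card H + 1), b k * a ^ k) =
          ∏ τ : H, (1 + τ • (a * (α ^ i * s))) - 1 := by
        have h1 : ∏ τ : H, (1 + τ • (a * (α ^ i * s))) =
            (∏ τ : H, (1 + X * C (τ • (α ^ i * s)))).eval a := by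
          rw [eval_prod]
          refine Finset.prod_congr rfl fun τ _ => ?_
          rw [smul_mul' τ a, ha]
          simp
        have h2 : (∏ τ : H, (1 + X * C (τ • (α ^ i * s)))).coeff 0 = 1 := by
          rw [coeff_zero_prod]
          simp
        have h3 : ∀ τ : H, τ • (α ^ i * ∑ k ∈ Finset.range (Fintype.card H + 1), b k * a ^ k) =
            ∑ k ∈ Finset.range (Fintype.card H + 1), τ • (α ^ i * b k) * a ^ k := fun τ => by
          rw [Finset.mul_sum, Finset.smul_sum]
          refine Finset.sum_congr rfl fun k _ => ?_
          rw [← mul_assoc, smul_mul', smul_pow', ha]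
        rw [h1, eval_eq_sum_range' (Nat.lt_succ_iff.mpr hdegP), Finset.sum_congr rfl fun τ _ => h3 τ,
          Finset.sum_comm, Finset.sum_range_succ', Finset.sum_range_succ', h2, hb0]
        simp only [mul_zero, smul_zero, Finset.sum_const_zero, add_zero, pow_zero, mul_one,
          add_sub_cancel_right]
        refine Finset.sum_congr rfl fun k _ => ?_
        rw [← Finset.sum_mul, hb _ (Nat.succ_ne_zero k)]
      rw [htr]
      refine h.pow_dvd_norm_sub_one hc σ ?_
      have h1 : a * (α ^ i * s) - α ^ i * c σ = α ^ i * (a * s - c σ) := by ring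
      rw [h1, pow_succ]
      refine mul_dvd_mul_left _ ?_
      rw [← h.residue_eq_zero_iff_dvd, map_sub, map_mul, ← haa, div_mul_cancel₀ _ hs, sub_self]

end RootPoly

end HasSingleBreak

/-! ### Graded pieces -/

section GradedPieces

theorem quotient_mk_eq_iff {R : Type*} [CommRing R] {I : Ideal R} {n : ℕ} (x y : ↥(I ^ n)) :
    (Submodule.Quotient.mk x : ↥(I ^ n) ⧸ (I • ⊤ : Submodule R ↥(I ^ n))) = Submodule.Quotient.mk y ↔
      (x : R) - y ∈ I ^ (n + 1) := by
  rw [Submodule.Quotient.eq, Submodule.mem_smul_top_iff, smul_eq_mul, ← pow_succ']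
  rfl

theorem quotient_mk_surjective {R : Type*} [CommRing R] {I : Ideal R} {n : ℕ}
    (z : ↥(I ^ n) ⧸ (I • ⊤ : Submodule R ↥(I ^ n))) : ∃ x : ↥(I ^ n), Submodule.Quotient.mk x = z :=
  Submodule.Quotient.mk_surjective _ z

variable {B : Type*} [CommRing B] [IsDomain B] [IsDiscreteValuationRing B] {α : B}

theorem mem_maximalIdeal_pow_iff (hα : Irreducible α) (n : ℕ) (x : B) :
    x ∈ maximalIdeal B ^ n ↔ α ^ n ∣ x := by
  rw [hα.maximalIdeal_eq, Ideal.span_singleton_pow, Ideal.mem_span_singleton]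

theorem grMk_eq_iff (hα : Irreducible α) {n : ℕ} (x y : ↥(maximalIdeal B ^ n)) :
    Gr.mk x = Gr.mk y ↔ α ^ (n + 1) ∣ (x : B) - y := by
  rw [Gr.mk, Gr.mk, quotient_mk_eq_iff, mem_maximalIdeal_pow_iff hα]

theorem residue_smul_grMk {n : ℕ} (b : B) (x : ↥(maximalIdeal B ^ n)) :
    residue B b • Gr.mk x = Gr.mk (b • x) := rfl

theorem grMk_add {n : ℕ} (x y : ↥(maximalIdeal B ^ n)) : Gr.mk (x + y) = Gr.mk x + Gr.mk y := rfl

/-- The class of `α ^ n` in `m ^ n / m ^ (n + 1)`. -/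
def grPow (hα : Irreducible α) (n : ℕ) : Gr B n :=
  Gr.mk ⟨α ^ n, (mem_maximalIdeal_pow_iff hα n _).mpr dvd_rfl⟩

theorem grMk_eq_residue_smul (hα : Irreducible α) {n : ℕ} (x : ↥(maximalIdeal B ^ n)) {b : B}
    (hb : (x : B) = α ^ n * b) : Gr.mk x = residue B b • grPow hα n := by
  rw [grPow, residue_smul_grMk, grMk_eq_iff hα]
  have h1 : (x : B) - ((b • ⟨α ^ n, (mem_maximalIdeal_pow_iff hα n _).mpr dvd_rfl⟩ :
      ↥(maximalIdeal B ^ n)) : B) = α ^ n * b - b * α ^ n := by rw [hb]; rfl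
  rw [h1, mul_comm, sub_self]
  exact dvd_zero _

/-- The coordinate on `m ^ n / m ^ (n + 1)` for which `α ^ n` has coordinate `1`. -/
noncomputable def grEquiv (hα : Irreducible α) (n : ℕ) : Gr B n ≃ₗ[ResidueField B] ResidueField B :=
  (LinearEquiv.ofBijective (LinearMap.toSpanSingleton (ResidueField B) (Gr B n) (grPow hα n)) (by
    constructor
    · rw [injective_iff_map_eq_zero]
      intro a ha
      obtain ⟨b, rfl⟩ := residue_surjective a
      have h1 : Gr.mk (b • ⟨α ^ n, (mem_maximalIdeal_pow_iff hα n _).mpr dvd_rfl⟩) =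
        Gr.mk (0 : ↥(maximalIdeal B ^ n)) := ha
      rw [grMk_eq_iff hα] at h1
      have h2 : α ^ (n + 1) ∣ α ^ n * b := by
        rw [mul_comm]
        simpa using h1
      rw [pow_succ, mul_dvd_mul_iff_left (pow_ne_zero _ hα.ne_zero)] at h2
      rwa [residue_eq_zero_iff, hα.maximalIdeal_eq, Ideal.mem_span_singleton]
    · intro y
      obtain ⟨x, rfl⟩ := quotient_mk_surjective y
      obtain ⟨b, hb⟩ := (mem_maximalIdeal_pow_iff hα n _).mp x.2
      exact ⟨residue B b, (grMk_eq_residue_smul hα x hb).symm⟩)).symm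

theorem grEquiv_symm_one (hα : Irreducible α) (n : ℕ) : (grEquiv hα n).symm 1 = grPow hα n :=
  one_smul (ResidueField B) (grPow hα n)

end GradedPieces

/-! ### The ring of invariants, the norm and the trace -/

section Invariants

variable {A K L B : Type*} [CommRing A] [IsDomain A] [IsDiscreteValuationRing A]
  [Field K] [Algebra A K] [IsFractionRing A K]
  [Field L] [Algebra K L] [FiniteDimensional K L] [IsGalois K L]
  [Algebra A L] [IsScalarTower A K L]
  [CommRing B] [IsDomain B] [IsDiscreteValuationRing B]
  [Algebra A B] [Algebra B L] [IsScalarTower A B L] [IsFractionRing B L]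
  [IsIntegralClosure B A L]
  [MulSemiringAction Gal(L/K) B]
  (hcompat : ∀ (σ : Gal(L/K)) (b : B), algebraMap B L (σ • b) = σ (algebraMap B L b))
  {H : Subgroup Gal(L/K)} {α : B} {i : ℕ}

include hcompat in
theorem mem_intRing_fixedField_iff (b : B) :
    b ∈ intRing A B (IntermediateField.fixedField H) ↔ ∀ σ : H, σ • b = b := by
  have h1 : b ∈ intRing A B (IntermediateField.fixedField H) ↔
      algebraMap B L b ∈ IntermediateField.fixedField H := Iff.rfl
  rw [h1, IntermediateField.mem_fixedField_iff]
  refine ⟨fun h2 σ => FaithfulSMul.algebraMap_injective B L ?_, fun h2 σ hσ => ?_⟩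
  · exact (hcompat σ b).trans (h2 σ σ.2)
  · rw [← hcompat]
    exact congrArg _ (h2 ⟨σ, hσ⟩)

variable [Fintype H] [DecidableEq H]

include hcompat in
/-- The ring of invariants has ramification index `q = |H|` in `B`. -/
theorem mem_maxIdeal_pow_iff (h : HasSingleBreak H α i) (n : ℕ)
    (z : intRing A B (IntermediateField.fixedField H)) :
    z ∈ maxIdeal A B (IntermediateField.fixedField H) ^ n ↔ α ^ (n * Fintype.card H) ∣ (z : B) := by
  have hfix : ∀ z : intRing A B (IntermediateField.fixedField H), ∀ σ : H, σ • (z : B) = z := fun z =>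
    (mem_intRing_fixedField_iff hcompat (z : B)).mp z.2
  have hmem : ∀ z : intRing A B (IntermediateField.fixedField H),
      z ∈ maxIdeal A B (IntermediateField.fixedField H) ↔ α ∣ (z : B) := fun z => by
    rw [← Ideal.mem_span_singleton, ← h.irreducible.maximalIdeal_eq]
    rfl
  constructor
  · intro hz
    have h1 : maxIdeal A B (IntermediateField.fixedField H) ≤
        (Ideal.span {α ^ Fintype.card H}).comap (intRing A B (IntermediateField.fixedField H)).val := by
      intro y hy
      rw [Ideal.mem_comap, Ideal.mem_span_singleton]
      exact h.pow_card_dvd_of_fixed (hfix y) ((hmem y).mp hy)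
    have h2 := Ideal.le_comap_pow _ n (Ideal.pow_right_mono h1 n hz)
    rw [Ideal.mem_comap, Ideal.span_singleton_pow, Ideal.mem_span_singleton, ← pow_mul, mul_comm] at h2
    exact h2
  · rintro ⟨y, hy⟩
    have hϖfix : ∀ τ : H, τ • (∏ σ : H, σ • α) = ∏ σ : H, σ • α := fun τ => by
      rw [Finset.smul_prod']
      simp_rw [← mul_smul]
      exact Equiv.prod_comp (Equiv.mulLeft τ) fun σ : H => σ • α
    set ϖ : intRing A B (IntermediateField.fixedField H) :=
      ⟨∏ σ : H, σ • α, (mem_intRing_fixedField_iff hcompat _).mpr hϖfix⟩ with hϖ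
    have hϖα : Associated (ϖ : B) (α ^ Fintype.card H) := h.prod_smul_associated
    have hϖ0 : (ϖ : B) ≠ 0 := hϖα.ne_zero_iff.mpr (pow_ne_zero _ h.irreducible.ne_zero)
    obtain ⟨t, ht⟩ : (ϖ : B) ^ n ∣ z := by
      rw [(hϖα.pow_pow (n := n)).dvd_iff_dvd_left, ← pow_mul, mul_comm, hy]
      exact Dvd.intro _ rfl
    have htfix : ∀ σ : H, σ • t = t := fun σ => by
      have h1 := congrArg (fun y => σ • y) ht
      simp only [smul_mul', smul_pow', hfix] at h1
      rw [ht] at h1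
      exact (mul_left_cancel₀ (pow_ne_zero n hϖ0) h1).symm
    have hz : z = ⟨t, (mem_intRing_fixedField_iff hcompat t).mpr htfix⟩ * ϖ ^ n := by
      apply Subtype.ext
      rw [ht, mul_comm]
      rfl
    rw [hz]
    refine Ideal.mul_mem_left _ _ (Ideal.pow_mem_pow ?_ n)
    rw [hmem]
    exact (dvd_pow_self α Fintype.card_ne_zero).trans hϖα.symm.dvd

include hcompat in
theorem grSubMk_eq_iff (h : HasSingleBreak H α i) {n : ℕ}
    (z z' : ↥(maxIdeal A B (IntermediateField.fixedField H) ^ n)) :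
    GrSub.mk A B _ z = GrSub.mk A B _ z' ↔ α ^ ((n + 1) * Fintype.card H) ∣
      ((z : intRing A B (IntermediateField.fixedField H)) : B) -
        (z' : intRing A B (IntermediateField.fixedField H)) := by
  refine (quotient_mk_eq_iff z z').trans ?_
  rw [mem_maxIdeal_pow_iff hcompat h]
  rfl

theorem smul_sum_smul (τ : H) (x : B) : τ • ∑ σ : H, σ • x = ∑ σ : H, σ • x := by
  rw [Finset.smul_sum]
  simp_rw [← mul_smul]
  exact Equiv.sum_comp (Equiv.mulLeft τ) fun σ : H => σ • x

theorem smul_coeff_norm (τ : H) (x : B) (k : ℕ) :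
    τ • (∏ σ : H, (1 + X * C (σ • x))).coeff k = (∏ σ : H, (1 + X * C (σ • x))).coeff k := by
  have h1 : (∏ σ : H, (1 + X * C (σ • x))).map (MulSemiringAction.toRingHom H B τ) =
      ∏ σ : H, (1 + X * C (σ • x)) := by
    rw [Polynomial.map_prod]
    simp only [Polynomial.map_add, Polynomial.map_one, Polynomial.map_mul, map_X, Polynomial.map_C,
      MulSemiringAction.toRingHom_apply, ← mul_smul]
    exact Equiv.prod_comp (Equiv.mulLeft τ) fun σ : H => 1 + X * C (σ • x)
  conv_rhs => rw [← h1, coeff_map]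
  rfl

include hcompat in
theorem algebraMap_trace_fixedField (b : B) :
    algebraMap (IntermediateField.fixedField H) L
      (Algebra.trace (IntermediateField.fixedField H) L (algebraMap B L b)) =
      algebraMap B L (∑ σ : H, σ • b) := by
  rw [trace_eq_sum_automorphisms, map_sum]
  refine (Fintype.sum_equiv (IntermediateField.subgroupEquivAlgEquiv H).toEquiv _ _ fun σ => ?_).symm
  exact hcompat σ b

include hcompat in
theorem algebraMap_norm_fixedField (y : L) :
    algebraMap (IntermediateField.fixedField H) L
      (Algebra.norm (IntermediateField.fixedField H) y) = ∏ σ : H, (σ : Gal(L/K)) y := by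
  rw [Algebra.norm_eq_prod_automorphisms]
  refine (Fintype.prod_equiv (IntermediateField.subgroupEquivAlgEquiv H).toEquiv _ _ fun σ => ?_).symm
  rfl

/-- The norm of `1 + t x` over `M[t]` is a polynomial whose values are the norms of the elements
`1 + a x`. -/
theorem eval_normPoly {K L : Type*} [Field K] [Field L] [Algebra K L] [FiniteDimensional K L]
    (M : IntermediateField K L) (x : L) (a : M) :
    (normPoly M x).eval a = Algebra.norm M (1 + a • x) := by
  classical
  let b := Module.finBasis M L
  have h1 : Algebra.leftMulMatrix (Algebra.TensorProduct.basis M[X] b)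
      (1 + (X : M[X]) ⊗ₜ[M] x : M[X] ⊗[M] L) =
      1 + (X : M[X]) • (Algebra.leftMulMatrix b x).map C := by
    rw [map_add, map_one]
    congr 1
    ext1 k l
    rw [Algebra.leftMulMatrix_eq_repr_mul, Algebra.TensorProduct.basis_apply,
      Algebra.TensorProduct.tmul_mul_tmul, mul_one, Algebra.TensorProduct.basis_repr_tmul]
    simp [Algebra.leftMulMatrix_eq_repr_mul]
  rw [normPoly, Algebra.norm_eq_matrix_det (Algebra.TensorProduct.basis M[X] b), h1,
    Algebra.norm_eq_matrix_det b, map_add, map_one, map_smul, ← coe_evalRingHom, RingHom.map_det]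
  congr 1
  ext1 k l
  by_cases hkl : k = l <;> simp [hkl] <;> exact mul_comm _ _

include A hcompat in
theorem map_normPoly (b : B) :
    (normPoly (IntermediateField.fixedField H) (algebraMap B L b)).map
      (algebraMap (IntermediateField.fixedField H) L) =
      (∏ σ : H, (1 + X * C (σ • b))).map (algebraMap B L) := by
  have hinf : Infinite A := by
    refine not_finite_iff_infinite.mp fun _ => ?_
    exact IsDiscreteValuationRing.not_isField A (Finite.isField_of_domain A)
  have : Infinite K := Infinite.of_injective _ (IsFractionRing.injective A K)
  have hM : Infinite (IntermediateField.fixedField H) :=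
    Infinite.of_injective _ (algebraMap K (IntermediateField.fixedField H)).injective
  refine eq_of_infinite_eval_eq _ _ ((Set.infinite_range_of_injective
    (algebraMap (IntermediateField.fixedField H) L).injective).mono ?_)
  rintro _ ⟨a, rfl⟩
  rw [Set.mem_ofPred_eq, eval_map, eval₂_at_apply, eval_normPoly, algebraMap_norm_fixedField hcompat,
    Polynomial.map_prod, eval_prod]
  refine Finset.prod_congr rfl fun σ _ => ?_
  have h1 : (σ : Gal(L/K)) (algebraMap (IntermediateField.fixedField H) L a) =
      algebraMap (IntermediateField.fixedField H) L a :=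
    (IntermediateField.mem_fixedField_iff _ _).mp a.2 σ σ.2
  have h2 : (σ : Gal(L/K)) (algebraMap B L b) = algebraMap B L (σ • b) := (hcompat σ b).symm
  rw [Algebra.smul_def, map_add, map_one, map_mul, h1, h2]
  simp
  exact mul_comm _ _

/-- The trace as a map into the ring of invariants. -/
noncomputable def invTrace (b : B) : intRing A B (IntermediateField.fixedField H) :=
  ⟨∑ σ : H, σ • b, (mem_intRing_fixedField_iff hcompat _).mpr fun τ => smul_sum_smul τ b⟩

include hcompat in
/-- The isomorphism `m_L ^ i / m_L ^ (i + 1) → m_M ^ i / m_M ^ (i + 1)` induced by the trace. -/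
theorem exists_traceEquiv (h : HasSingleBreak H α i) :
    ∃ T : Gr B i ≃+ GrSub A B (IntermediateField.fixedField H) i,
      ∀ (y : ↥(maximalIdeal B ^ i)) (z : ↥(maxIdeal A B (IntermediateField.fixedField H) ^ i)),
        ((z : intRing A B (IntermediateField.fixedField H)) : B) = ∑ σ : H, σ • (y : B) →
          T (Gr.mk y) = GrSub.mk A B _ z := by
  have hmem : ∀ y : ↥(maximalIdeal B ^ i),
      invTrace (A := A) hcompat (H := H) y ∈ maxIdeal A B (IntermediateField.fixedField H) ^ i := fun y => by
    rw [mem_maxIdeal_pow_iff hcompat h]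
    exact h.pow_dvd_trace (Nat.le_succ i) ((mem_maximalIdeal_pow_iff h.irreducible i _).mp y.2)
  let tr : ↥(maximalIdeal B ^ i) → ↥(maxIdeal A B (IntermediateField.fixedField H) ^ i) := fun y =>
    ⟨invTrace hcompat y, hmem y⟩
  have hsurj := Submodule.Quotient.mk_surjective
    (maximalIdeal B • ⊤ : Submodule B ↥(maximalIdeal B ^ i))
  choose s hs using hsurj
  have hs' : ∀ y, Gr.mk (s y) = y := hs
  have htr : ∀ (y y' : ↥(maximalIdeal B ^ i)), Gr.mk y = Gr.mk y' ↔
      GrSub.mk A B _ (tr y) = GrSub.mk A B _ (tr y') := fun y y' => by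
    rw [grMk_eq_iff h.irreducible, grSubMk_eq_iff hcompat h]
    have h1 : ((tr y : intRing A B (IntermediateField.fixedField H)) : B) -
        (tr y' : intRing A B (IntermediateField.fixedField H)) = ∑ σ : H, σ • ((y : B) - y') := by
      simp only [smul_sub]
      rw [Finset.sum_sub_distrib]
      rfl
    rw [h1]
    refine ⟨fun h2 => h.pow_dvd_trace le_rfl h2, fun h2 => h.pow_dvd_of_pow_dvd_trace ?_ h2⟩
    exact dvd_sub ((mem_maximalIdeal_pow_iff h.irreducible i _).mp y.2)
      ((mem_maximalIdeal_pow_iff h.irreducible i _).mp y'.2)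
  have hT : ∀ y, GrSub.mk A B _ (tr (s (Gr.mk y))) = GrSub.mk A B _ (tr y) := fun y =>
    (htr _ _).mp (hs' _)
  refine ⟨AddEquiv.ofBijective (AddMonoidHom.mk' (fun y => GrSub.mk A B _ (tr (s y))) ?_) ⟨?_, ?_⟩, ?_⟩
  · intro y y'
    have h1 : GrSub.mk A B _ (tr (s y)) + GrSub.mk A B _ (tr (s y')) =
      GrSub.mk A B _ (tr (s y) + tr (s y')) := rfl
    have h2 : tr (s y) + tr (s y') = tr (s y + s y') := by
      apply Subtype.ext
      apply Subtype.ext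
      change ∑ σ : H, σ • (s y : B) + ∑ σ : H, σ • (s y' : B) = ∑ σ : H, σ • ((s y : B) + s y')
      simp only [smul_add, Finset.sum_add_distrib]
    rw [h1, h2, ← htr, hs', grMk_add, hs', hs']
  · intro y y' hyy
    have h1 := (htr _ _).mpr hyy
    rwa [hs', hs'] at h1
  · intro z
    obtain ⟨z, rfl⟩ := quotient_mk_surjective z
    obtain ⟨w, hw, hwz⟩ := h.exists_trace_eq (n := i) le_rfl
      ((mem_intRing_fixedField_iff (A := A) hcompat _).mp (z : intRing A B _).2)
      ((mem_maxIdeal_pow_iff hcompat h i _).mp z.2)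
    refine ⟨Gr.mk ⟨w, (mem_maximalIdeal_pow_iff h.irreducible i _).mpr hw⟩, ?_⟩
    refine (hT _).trans ?_
    exact congrArg _ (Subtype.ext (Subtype.ext hwz))
  · intro y z hyz
    refine (hT _).trans ?_
    exact congrArg _ (Subtype.ext (Subtype.ext hyz.symm))

end Invariants

/-! ### The classical sequence -/

section Classical

open TotRam.VecGrp HasSingleBreak

variable {A K L B : Type*} [CommRing A] [IsDomain A] [IsDiscreteValuationRing A]
  [Field K] [Algebra A K] [IsFractionRing A K]
  [Field L] [Algebra K L] [FiniteDimensional K L] [IsGalois K L]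
  [Algebra A L] [IsScalarTower A K L]
  [CommRing B] [IsDomain B] [IsDiscreteValuationRing B]
  [Algebra A B] [Algebra B L] [IsScalarTower A B L] [IsFractionRing B L]
  [IsIntegralClosure B A L]
  [MulSemiringAction Gal(L/K) B]
  (hcompat : ∀ (σ : Gal(L/K)) (b : B), algebraMap B L (σ • b) = σ (algebraMap B L b))
  {H : Subgroup Gal(L/K)} {α : B} {i : ℕ} [Fintype H] [DecidableEq H]

theorem isAdditivePoly_rootPoly {B : Type*} [CommRing B] [IsDomain B] [IsDiscreteValuationRing B]
    {H : Type*} [Group H] [MulSemiringAction H B] {α : B} {i : ℕ} [Fintype H] [DecidableEq H]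
    {c : H → B} (hc : ∀ σ : H, σ • α = α + α ^ (i + 1) * c σ)
    (h : HasSingleBreak H α i) (hi : 0 < i) : IsAdditivePoly (rootPoly B c) :=
  (isAdditivePoly_prod (fun σ : H => residue B (c σ)) (h.residue_coord_injective hc hi)
    (h.residue_coord_mul hc hi)).C_mul _

variable {T : Gr B i ≃+ GrSub A B (IntermediateField.fixedField H) i}
  (hT : ∀ (y : ↥(maximalIdeal B ^ i)) (z : ↥(maxIdeal A B (IntermediateField.fixedField H) ^ i)),
    ((z : intRing A B (IntermediateField.fixedField H)) : B) = ∑ σ : H, σ • (y : B) →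
      T (Gr.mk y) = GrSub.mk A B _ z)

include hcompat hT in
theorem isTraceMap_of_eq_sum (h : HasSingleBreak H α i) :
    IsTraceMap (IntermediateField.fixedField H) T := by
  intro y
  have hmem : invTrace (A := A) hcompat (H := H) y ∈
      maxIdeal A B (IntermediateField.fixedField H) ^ i := by
    rw [mem_maxIdeal_pow_iff hcompat h]
    exact h.pow_dvd_trace (Nat.le_succ i) ((mem_maximalIdeal_pow_iff h.irreducible i _).mp y.2)
  exact ⟨⟨_, hmem⟩, (algebraMap_trace_fixedField hcompat (y : B)).symm, hT y _ rfl⟩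

include hcompat hT in
/-- On a line the norm followed by the inverse of the trace is the additive polynomial with roots the
classes of the `c σ`: both have degree at most `|H|`, these roots, and the same linear coefficient. -/
theorem isTraceInvNorm_polyHom (h : HasSingleBreak H α i) (hi : 0 < i) {c : H → B}
    (hc : ∀ σ : H, σ • α = α + α ^ (i + 1) * c σ) :
    IsTraceInvNorm (IntermediateField.fixedField H) T
      (polyHom (grEquiv h.irreducible i) ((grEquiv h.irreducible i).symm 1) (rootPoly B c)
        (isAdditivePoly_rootPoly hc h hi)) := by
  intro x
  obtain ⟨s, hs⟩ := (mem_maximalIdeal_pow_iff h.irreducible i _).mp x.2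
  set P : B[X] := ∏ σ : H, (1 + X * C (σ • (x : B))) with hP
  have hcoeff : ∀ k : ℕ, ∃ a : ↥(maxIdeal A B (IntermediateField.fixedField H) ^ i),
      (k = 0 → a = 0) ∧
        (k ≠ 0 → ((a : intRing A B (IntermediateField.fixedField H)) : B) = P.coeff k) := by
    intro k
    rcases eq_or_ne k 0 with rfl | hk
    · exact ⟨0, fun _ => rfl, fun h0 => absurd rfl h0⟩
    · refine ⟨⟨⟨P.coeff k, (mem_intRing_fixedField_iff hcompat _).mpr fun τ =>
        smul_coeff_norm τ (x : B) k⟩, ?_⟩, fun h0 => absurd h0 hk, fun _ => rfl⟩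
      rw [mem_maxIdeal_pow_iff hcompat h]
      exact h.pow_dvd_coeff_norm le_rfl (Nat.le_succ i) (hs ▸ Dvd.intro _ rfl) hk
  choose a ha0 ha using hcoeff
  have hdeg : P.natDegree < Fintype.card H + 1 := by
    refine Nat.lt_succ_iff.mpr ((natDegree_prod_le _ _).trans ?_)
    refine (Finset.sum_le_card_nsmul _ _ 1 fun σ _ => ?_).trans (by simp)
    compute_degree
  have hw : ∀ k : ℕ, ∃ b : B, (k = 0 → b = 0) ∧
      ∑ σ : H, σ • (α ^ i * b) = ((a k : intRing A B (IntermediateField.fixedField H)) : B) := by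
    intro k
    rcases eq_or_ne k 0 with rfl | hk
    · exact ⟨0, fun _ => rfl, by rw [ha0 0 rfl]; simp⟩
    · obtain ⟨w, ⟨b, rfl⟩, hwz⟩ := h.exists_trace_eq (n := i) le_rfl
        ((mem_intRing_fixedField_iff (A := A) hcompat _).mp (a k : intRing A B _).2)
        ((mem_maxIdeal_pow_iff hcompat h i _).mp (a k).2)
      exact ⟨b, fun h0 => absurd h0 hk, hwz⟩
  choose b hb0 hb using hw
  have hTsymm : ∀ k, T.symm (GrSub.mk A B _ (a k)) =
      residue B (b k) • (grEquiv h.irreducible i).symm 1 := fun k => by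
    have hbm : α ^ i * b k ∈ maximalIdeal B ^ i :=
      (mem_maximalIdeal_pow_iff h.irreducible i _).mpr (Dvd.intro _ rfl)
    rw [AddEquiv.symm_apply_eq, grEquiv_symm_one,
      ← grMk_eq_residue_smul h.irreducible ⟨α ^ i * b k, hbm⟩ rfl]
    exact (hT ⟨α ^ i * b k, hbm⟩ _ (hb k).symm).symm
  have hsupp : ∀ k, a k ≠ 0 → k ∈ Finset.range (Fintype.card H + 1) := fun k hk => by
    rw [Finset.mem_range]
    by_contra hlt
    refine hk (Subtype.ext (Subtype.ext ?_))
    have hk0 : k ≠ 0 := fun h0 => hk (ha0 k h0)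
    rw [ha k hk0]
    exact coeff_eq_zero_of_natDegree_lt (hdeg.trans_le (not_lt.mp hlt))
  refine ⟨Finsupp.onFinset (Finset.range (Fintype.card H + 1)) a hsupp, ha0 0 rfl, ?_, fun l => ?_⟩
  · rw [map_normPoly (A := A) hcompat, Finsupp.onFinset_sum _ fun k => by simp, ← hP,
      as_sum_range' P _ hdeg, Polynomial.map_sum, Finset.sum_range_succ', Finset.sum_range_succ' _ (_ : ℕ)]
    have h0 : P.coeff 0 = 1 := by
      rw [hP, coeff_zero_prod]
      simp
    rw [h0, ha0 0 rfl, add_comm]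
    congr 1
    · simp
    · rw [ZeroMemClass.coe_zero, ZeroMemClass.coe_zero, map_zero, monomial_zero_right, add_zero]
      refine Finset.sum_congr rfl fun k _ => ?_
      rw [map_monomial, ha _ (Nat.succ_ne_zero k)]
  · have hT0 : T.symm (GrSub.mk A B (IntermediateField.fixedField H) 0) = Gr.mk 0 := by
      rw [AddEquiv.symm_apply_eq]
      exact (hT 0 0 (by simp)).symm
    have hl0 : l (T.symm (GrSub.mk A B (IntermediateField.fixedField H) 0)) = 0 := by
      rw [hT0]
      exact map_zero l
    rw [Finsupp.onFinset_sum _ fun k => by rw [hl0, monomial_zero_right]]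
    rw [polyHom_ι, map_smul, grMk_eq_residue_smul h.irreducible x hs, ← grEquiv_symm_one,
      line_smul, ← lineEquiv_apply, lineEquiv_aeval,
      ← h.sum_monomial_residue_eq_rootPoly_comp hc hi s (hb0 0 rfl) fun k hk => by
        rw [hb, ha k hk, hP, hs], Finset.smul_sum]
    refine Finset.sum_congr rfl fun k _ => ?_
    rw [hTsymm, map_smul, smul_monomial, smul_eq_mul, smul_eq_mul, mul_comm]

end Classical

/-! ### Comparison of the two sequences -/

theorem TotRam.IsExactSequence.comp_mulEquiv {Γ Γ' E AH AV : Type*} [Field E] [Group Γ] [Group Γ']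
    [CommRing AH] [HopfAlgebra E AH] [CommRing AV] [HopfAlgebra E AV]
    {ι : Γ →* WithConv (AH →ₐ[E] E)} {π : AV →ₐc[E] AH} (h : IsExactSequence E AH AV ι π)
    (e : Γ' ≃* Γ) : IsExactSequence E AH AV (ι.comp e.toMonoidHom) π where
  finite := have := h.finite; Finite.of_equiv Γ e.symm.toEquiv
  surjective f := by
    obtain ⟨a, ha⟩ := h.surjective fun σ => f (e.symm σ)
    refine ⟨a, funext fun σ => ?_⟩
    have h1 := congrFun ha (e σ)
    simpa using h1
  kernel a := by
    rw [← h.kernel a]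
    exact ⟨fun h1 σ => by simpa using h1 (e.symm σ), fun h1 σ => h1 (e σ)⟩
  faithfullyFlat := h.faithfullyFlat

theorem exists_equiv_symm_one {E V : Type*} [Field E] [AddCommGroup V] [Module E V] (η : V ≃ₗ[E] E)
    {w : V} (hw : w ≠ 0) : ∃ η' : V ≃ₗ[E] E, η'.symm 1 = w := by
  have h0 : η w ≠ 0 := (map_ne_zero_iff η η.injective).mpr hw
  refine ⟨η.trans (LinearEquiv.smulOfNeZero E E (η w)⁻¹ (inv_ne_zero h0)), ?_⟩
  rw [LinearEquiv.symm_apply_eq, LinearEquiv.trans_apply, LinearEquiv.smulOfNeZero_apply, smul_eq_mul,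
    inv_mul_cancel₀ h0]

theorem TotRam.VecGrp.counitAlgHom_eq_eval {E V : Type*} [Field E] [AddCommGroup V] [Module E V]
    (η : V ≃ₗ[E] E) (a : VecGrp E V) :
    Bialgebra.counitAlgHom E (VecGrp E V) a = (VecGrp.lineEquiv η a).eval 0 := by
  have h1 : Bialgebra.counitAlgHom E (VecGrp E V) =
      (aeval (0 : E) : E[X] →ₐ[E] E).comp (VecGrp.lineEquiv η).toAlgHom := by
    refine VecGrp.algHom_ext_coord η ?_
    have h2 : (VecGrp.lineEquiv η).toAlgHom (VecGrp.coord η) = X := VecGrp.lineEquiv_coord η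
    rw [AlgHom.comp_apply, h2, aeval_X]
    exact VecGrp.counit_coord η
  rw [h1]
  exact coe_aeval_eq_eval (0 : E) ▸ rfl

section Comparison

open TotRam.VecGrp HasSingleBreak

variable {A K L B : Type*} [CommRing A] [IsDomain A] [IsDiscreteValuationRing A]
  [Field K] [Algebra A K] [IsFractionRing A K]
  [Field L] [Algebra K L] [FiniteDimensional K L] [IsGalois K L]
  [Algebra A L] [IsScalarTower A K L]
  [CommRing B] [IsDomain B] [IsDiscreteValuationRing B]
  [Algebra A B] [Algebra B L] [IsScalarTower A B L] [IsFractionRing B L]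
  [IsIntegralClosure B A L]
  [MulSemiringAction Gal(L/K) B]
  {H : Subgroup Gal(L/K)} [Fintype H] {α : B} {i m : ℕ}

open Classical in
/-- The unit `f'(α) α ^ (i + 1) / α ^ m` is the product of the unit by which `f / α ^ m` differs
from the monic polynomial with roots the coordinates of the conjugates, and the linear coefficient
of that polynomial. -/
theorem aeval_derivative_mul_pow_eq
    (hf : (minpoly A α).map (algebraMap A L) = ∏ σ : Gal(L/K), (X - C (algebraMap B L (σ • α))))
    {c : H → B} (hc : ∀ σ : H, σ • α = α + α ^ (i + 1) * c σ) {u : B}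
    (hu : u * α ^ m = (∏ τ : Gal(L/K) with τ ∉ H, (α - τ • α)) * α ^ ((i + 1) * Fintype.card H)) :
    aeval α (derivative (minpoly A α)) * α ^ (i + 1) =
      u * (∏ σ ∈ Finset.univ.erase (1 : H), (-c σ)) * α ^ m := by
  have h1 : different H α = (α ^ (i + 1)) ^ (Fintype.card H - 1) *
      ∏ σ ∈ Finset.univ.erase (1 : H), (-c σ) := by
    rw [different, ← Finset.card_univ, ← Finset.card_erase_of_mem (Finset.mem_univ (1 : H)),
      ← Finset.prod_const, ← Finset.prod_mul_distrib]
    refine Finset.prod_congr rfl fun σ _ => ?_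
    rw [hc σ]
    ring
  obtain ⟨k, hk⟩ : ∃ k, Fintype.card H = k + 1 :=
    ⟨_, (Nat.sub_add_cancel Fintype.card_pos).symm⟩
  rw [aeval_derivative_minpoly hf H, h1]
  have h2 : (α ^ (i + 1)) ^ (Fintype.card H - 1) * α ^ (i + 1) = α ^ ((i + 1) * Fintype.card H) := by
    rw [hk, Nat.add_sub_cancel, pow_mul, ← pow_succ]
  linear_combination (∏ τ : Gal(L/K) with τ ∉ H, (α - τ • α)) *
    (∏ σ ∈ Finset.univ.erase (1 : H), (-c σ)) * h2 -
    (∏ σ ∈ Finset.univ.erase (1 : H), (-c σ)) * hu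

/-- For `δ` that sends the coordinate of `V` to that of `W`, homomorphisms given by the same additive
polynomial correspond to each other. -/
theorem polyHom_comp_map {E V W : Type*} [Field E] [AddCommGroup V] [Module E V]
    [AddCommGroup W] [Module E W] (η : V ≃ₗ[E] E) (η' : W ≃ₗ[E] E) (N : E[X]) (hN : IsAdditivePoly N)
    (a : VecGrp E W) :
    polyHom η (η'.symm 1) N hN a =
      polyHom η (η.symm 1) N hN (VecGrp.map (η.trans η'.symm : V →ₗ[E] W) a) := by
  have h1 : (polyHom η (η'.symm 1) N hN : VecGrp E W →ₐ[E] VecGrp E V) =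
      (polyHom η (η.symm 1) N hN : VecGrp E V →ₐ[E] VecGrp E V).comp
        (VecGrp.map (η.trans η'.symm : V →ₗ[E] W)) := by
    refine SymmetricAlgebra.algHom_ext (LinearMap.ext fun l => ?_)
    have h2 : VecGrp.map (η.trans η'.symm : V →ₗ[E] W) (SymmetricAlgebra.ι E _ l) =
        SymmetricAlgebra.ι E _ (l.comp (η.trans η'.symm : V →ₗ[E] W)) :=
      SymmetricAlgebra.lift_ι_apply _ _
    have h3 : η.trans η'.symm (η.symm 1) = η'.symm 1 := congrArg η'.symm (η.apply_symm_apply 1)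
    change polyHom η (η'.symm 1) N hN (SymmetricAlgebra.ι E _ l) =
      polyHom η (η.symm 1) N hN (VecGrp.map (η.trans η'.symm : V →ₗ[E] W) (SymmetricAlgebra.ι E _ l))
    rw [h2, polyHom_ι, polyHom_ι, ← h3]
    rfl
  exact DFunLike.congr_fun h1 a

section Component

variable (hf : (minpoly A α).map (algebraMap A L) =
    ∏ σ : Gal(L/K), (X - C (algebraMap B L (σ • α))))
  (hm : Associated (∏ τ : Gal(L/K), HasLastBreak.gap H α i 1 τ) (α ^ m)) (h : HasLastBreak H α i)
  {c : H → B} (hc : ∀ σ : H, σ • α = α + α ^ (i + 1) * c σ)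
  (hcompat : ∀ (σ : Gal(L/K)) (b : B), algebraMap B L (σ • b) = σ (algebraMap B L b))

open Classical in
/-- Under the identification of the component of the closed fiber with the vector group of a line, the
projection to the reduced closed fiber of the dilatation is given by the additive polynomial
`rootPoly`. -/
theorem lineEquiv_polyHom_eq {u : B}
    (hu : u * α ^ m = (∏ τ : Gal(L/K) with τ ∉ H, (α - τ • α)) * α ^ ((i + 1) * Fintype.card H))
    {V : Type*} [AddCommGroup V] [Module (ResidueField B) V] (η : V ≃ₗ[ResidueField B] ResidueField B)
    (hN : IsAdditivePoly (rootPoly B c)) {n : ℕ} (w : Gr B n)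
    (a : VecGrp (ResidueField B) (Gr B n)) :
    lineEquiv η (polyHom η (residue B (u * ∏ σ ∈ Finset.univ.erase (1 : H), (-c σ)) • w)
      (rootPoly B c) hN a) =
      componentEquiv hf hm h hc hcompat (redFiberToComponent A K L B α m
        (redFiberToGr A L B α m w a)) := by
  have h1 : (lineEquiv η).toAlgHom.comp (polyHom η (residue B (u * ∏ σ ∈ Finset.univ.erase (1 : H),
        (-c σ)) • w) (rootPoly B c) hN :
        VecGrp (ResidueField B) (Gr B n) →ₐ[ResidueField B] VecGrp (ResidueField B) V) =
      (componentEquiv hf hm h hc hcompat).toAlgHom.comp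
        ((redFiberToComponent A K L B α m).comp (redFiberToGr A L B α m w)) := by
    refine SymmetricAlgebra.algHom_ext (LinearMap.ext fun l => ?_)
    change lineEquiv η (polyHom η (residue B (u * ∏ σ ∈ Finset.univ.erase (1 : H), (-c σ)) • w)
      (rootPoly B c) hN (SymmetricAlgebra.ι _ _ l)) =
      componentEquiv hf hm h hc hcompat (redFiberToComponent A K L B α m
        (redFiberToGr A L B α m w (SymmetricAlgebra.ι _ _ l)))
    have hκ := h.hasSingleBreak.prod_neg_residue_coord_ne_zero hc
    have hv : residue B (u * ∏ σ ∈ Finset.univ.erase (1 : H), (-c σ)) = residue B u *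
        ∏ σ ∈ Finset.univ.erase (1 : H), (-residue B (c σ)) := by
      rw [map_mul, map_prod]
      simp only [map_neg]
    rw [componentEquiv_redFiberToGr hf hm h hc hcompat hu, polyHom_ι, map_smul, lineEquiv_aeval,
      map_smul, hv, rootPoly, smul_eq_mul, smul_eq_C_mul, smul_eq_C_mul, ← mul_assoc, ← mul_assoc,
      ← C_mul, ← C_mul]
    congr 2
    field_simp
  exact DFunLike.congr_fun h1 a

variable {V : Type*} [AddCommGroup V] [Module (ResidueField B) V] (η : V ≃ₗ[ResidueField B] ResidueField B)

/-- The identification of the component of the closed fiber with the vector group of a line. -/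
noncomputable def vecGrpEquivComponent :
    VecGrp (ResidueField B) V ≃ₐ[ResidueField B] Component A K L B α m :=
  (lineEquiv η).trans (componentEquiv hf hm h hc hcompat).symm

theorem lineEquiv_vecGrpEquivComponent_symm_mk (a : Fiber A L B α m) :
    lineEquiv η ((vecGrpEquivComponent hf hm h hc hcompat η).symm (Ideal.Quotient.mk _ a)) =
      redHom hf hm h 1 a :=
  (lineEquiv η).apply_symm_apply _

theorem point_vecGrpEquivComponent_symm_mk (σ : H) (a : Fiber A L B α m) :
    point (residue B (c σ) • η.symm 1)
      ((vecGrpEquivComponent hf hm h hc hcompat η).symm (Ideal.Quotient.mk _ a)) =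
      TotRam.closedPoint A K L B α m σ a := by
  rw [point_eq_eval, lineEquiv_vecGrpEquivComponent_symm_mk,
    closedPoint_eq_eval hf hm h hc hcompat]

/-- The origin of the vector group is the closed point of the section given by `α`. -/
theorem counit_vecGrpEquivComponent_symm_mk (a : Fiber A L B α m) :
    Bialgebra.counitAlgHom (ResidueField B) (VecGrp (ResidueField B) V)
      ((vecGrpEquivComponent hf hm h hc hcompat η).symm (Ideal.Quotient.mk _ a)) =
      TotRam.closedPoint A K L B α m 1 a := by
  rw [counitAlgHom_eq_eval η, lineEquiv_vecGrpEquivComponent_symm_mk,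
    ← h.hasSingleBreak.residue_coord_one hc]
  exact (closedPoint_eq_eval hf hm h hc hcompat 1 a).symm

end Component

end Comparison

set_option maxHeartbeats 1000000 in
theorem corollary1p3
    {A K : Type*} {L B : Type u}
    [CommRing A] [IsDomain A] [IsDiscreteValuationRing A] [HenselianLocalRing A]
    [Field K] [Algebra A K] [IsFractionRing A K]
    [Field L] [Algebra K L] [FiniteDimensional K L] [IsGalois K L]
    [Algebra A L] [IsScalarTower A K L]
    [CommRing B] [IsDomain B] [IsDiscreteValuationRing B]
    [Algebra A B] [Algebra B L] [IsScalarTower A B L] [IsFractionRing B L]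
    [IsIntegralClosure B A L]
    (p : ℕ) [Fact p.Prime] [CharP (ResidueField A) p]
    (htot : (maximalIdeal A).map (algebraMap A B) = maximalIdeal B ^ Module.finrank K L)
    (α : B) (hα : Irreducible α)
    (r : ℚ) (hr : IsGreatest {s : ℚ | 1 < s ∧ upperRam A K L B s ≠ ⊥} r)
    (i : ℕ) (hi : IsGreatest {j : ℕ | 0 < j ∧ lowerRam A K L B j ≠ ⊥} i) :
    -- `m` is the integer `e r`
    ∃ m : ℕ, (m : ℚ) = Module.finrank K L * r ∧
      (m : ℕ∞) = IsDiscreteValuationRing.addVal B (aeval α (derivative (minpoly A α))) + (i + 1) ∧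
      upperRam A K L B r = lowerRam A K L B i ∧
      ∃ -- the class of `α ^ m / f(0)` and the identification of `Q^[r]_E` that it defines
        (c : ↥(maximalIdeal B ^ (m - Module.finrank K L)))
        -- multiplication by `f'(α) α / f(0)`
        (δ : Gr B i ≃ₗ[ResidueField B] Gr B (m - Module.finrank K L))
        -- the isomorphism induced by the trace, and the morphism `T⁻¹ ∘ N`
        (T : Gr B i ≃+ GrSub A B (IntermediateField.fixedField (lowerRam A K L B i)) i)
        (ν : VecGrp (ResidueField B) (Gr B i) →ₐc[ResidueField B]
          VecGrp (ResidueField B) (Gr B i))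
        -- the group scheme structure on `Q^(r)∘_E`
        (Q : Type u) (_ : CommRing Q) (_ : HopfAlgebra (ResidueField B) Q)
        (q : Q ≃ₐ[ResidueField B] Component A K L B α m)
        -- the two rows
        (π : VecGrp (ResidueField B) (Gr B (m - Module.finrank K L)) →ₐc[ResidueField B] Q)
        (ιQ : upperRam A K L B r →* WithConv (Q →ₐ[ResidueField B] ResidueField B))
        (ιU : lowerRam A K L B i →*
          WithConv (VecGrp (ResidueField B) (Gr B i) →ₐ[ResidueField B] ResidueField B))
        -- the middle vertical isomorphism
        (Φ : Q ≃ₐc[ResidueField B] VecGrp (ResidueField B) (Gr B i)),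
        -- the identification of `Q^[r]_E`
        (c : B) * algebraMap A B ((minpoly A α).coeff 0) = α ^ m ∧
        Function.Bijective (redFiberToGr A L B α m (Gr.mk c)) ∧
        -- the right vertical map
        (∀ y : ↥(maximalIdeal B ^ i), ∃ z : ↥(maximalIdeal B ^ (m - Module.finrank K L)),
          (z : B) * algebraMap A B ((minpoly A α).coeff 0) =
            aeval α (derivative (minpoly A α)) * α * y ∧
          δ (Gr.mk y) = Gr.mk z) ∧
        -- the upper row
        (∀ a, q (π a) = redFiberToComponent A K L B α m (redFiberToGr A L B α m (Gr.mk c) a)) ∧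
        (∀ σ : upperRam A K L B r, ∀ a : Fiber A L B α m,
          (ιQ σ).ofConv (q.symm (Ideal.Quotient.mk (componentIdeal A K L B α m) a)) =
            closedPoint A K L B α m σ a) ∧
        IsExactSequence (ResidueField B) Q
          (VecGrp (ResidueField B) (Gr B (m - Module.finrank K L))) ιQ π ∧
        -- the group scheme structure on `Q^(r)∘_E` is the only one such that the projection to
        -- `Q^[r]_E` is a homomorphism and such that the section given by `α` is the origin
        (∀ (Q' : Type u) [CommRing Q'] [HopfAlgebra (ResidueField B) Q']
          (q' : Q' ≃ₐ[ResidueField B] Component A K L B α m)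
          (π' : VecGrp (ResidueField B) (Gr B (m - Module.finrank K L)) →ₐc[ResidueField B] Q'),
          (∀ a, q' (π' a) =
            redFiberToComponent A K L B α m (redFiberToGr A L B α m (Gr.mk c) a)) →
          (∀ a : Fiber A L B α m, Bialgebra.counitAlgHom (ResidueField B) Q'
            (q'.symm (Ideal.Quotient.mk (componentIdeal A K L B α m) a)) =
              closedPoint A K L B α m 1 a) →
          ∃ g : Q' ≃ₐc[ResidueField B] Q, ∀ a, q (g a) = q' a) ∧
        -- the lower row
        IsTraceMap _ T ∧ IsTraceInvNorm _ T ν ∧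
        (∀ σ : lowerRam A K L B i, ∃ x : ↥(maximalIdeal B ^ i),
          (σ : Gal(L/K)) (algebraMap B L α) = algebraMap B L (α * (1 + x)) ∧
          (ιU σ).ofConv = VecGrp.point (Gr.mk x)) ∧
        IsExactSequence (ResidueField B) (VecGrp (ResidueField B) (Gr B i))
          (VecGrp (ResidueField B) (Gr B i)) ιU ν ∧
        -- commutativity of the two squares
        (∀ (σ : Gal(L/K)) (h : σ ∈ upperRam A K L B r) (h' : σ ∈ lowerRam A K L B i),
          ∀ a, (ιU ⟨σ, h'⟩).ofConv (Φ a) = (ιQ ⟨σ, h⟩).ofConv a) ∧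
        (∀ a, Φ (π a) = ν (VecGrp.map (δ : Gr B i →ₗ[ResidueField B] _) a)) := by
  classical
  let _ : MulSemiringAction Gal(L/K) B := IsIntegralClosure.MulSemiringAction A K L B
  have hcompat : ∀ (σ : Gal(L/K)) (b : B), algebraMap B L (σ • b) = σ (algebraMap B L b) :=
    fun σ b => algebraMap_galRestrict_apply A σ b
  have hres := exists_dvd_sub_algebraMap (K := K) (L := L) htot hα
  have hH := hasLastBreak_lowerRam hcompat hi hα hres
  have hS := hH.hasSingleBreak
  have hi0 : 0 < i := hi.1.1
  have hf := minpoly_map_eq_prod hcompat hi hα hres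
  have hup : upperRam A K L B r = lowerRam A K L B i :=
    (last_upper_break lowerRam_antitone hi hr).2
  have hmr := last_upper_break_mul_card lowerRam_antitone hi hr
  have hm := prod_gap_associated_pow_sum (i := i) hcompat hα hres
  have hcard : Nat.card (lowerRam A K L B 0) = Module.finrank K L := by
    rw [lowerRam_zero hcompat hα hres, Subgroup.card_top, IsGalois.card_aut_eq_finrank]
  have hnm : Module.finrank K L ≤ ∑ k ∈ Finset.range (i + 1), Nat.card (lowerRam A K L B k) := by
    rw [Finset.sum_range_succ', hcard]
    exact Nat.le_add_left _ _
  rw [hcard] at hmr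
  set m := ∑ k ∈ Finset.range (i + 1), Nat.card (lowerRam A K L B k) with hmdef
  have hn0 : 0 < Module.finrank K L := Module.finrank_pos
  have hm0 : m ≠ 0 := by omega
  -- the constants `u` and `v`, and the coordinates of the conjugates of `α`
  obtain ⟨u, hu⟩ : ∃ u : Bˣ, (u : B) * α ^ m = (∏ τ : Gal(L/K) with τ ∉ lowerRam A K L B i,
      (α - τ • α)) * α ^ ((i + 1) * Fintype.card (lowerRam A K L B i)) := by
    obtain ⟨u, hu⟩ := hm.symm
    exact ⟨u, by rw [mul_comm, hu, prod_gap_eq]⟩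
  have hcex : ∀ σ : lowerRam A K L B i, ∃ c : B, σ • α = α + α ^ (i + 1) * c := fun σ => by
    obtain ⟨c, hc⟩ := dvd_sub_comm.mp ((hH.mem_iff σ).mp σ.2)
    exact ⟨c, by rw [← hc]; exact (add_sub_cancel _ _).symm⟩
  choose c hc using hcex
  have hcadd := hS.residue_coord_mul hc hi0
  have hcinj := hS.residue_coord_injective hc hi0
  have hκ := hS.prod_neg_residue_coord_ne_zero hc
  have hderiv := aeval_derivative_mul_pow_eq hf hc hu
  set v : B := u * ∏ σ ∈ Finset.univ.erase (1 : lowerRam A K L B i), (-c σ) with hv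
  have hv0 : residue B v ≠ 0 := by
    rw [hv, map_mul, map_prod]
    simp only [map_neg]
    exact mul_ne_zero (u.isUnit.map (residue B)).ne_zero hκ
  -- the class of `α ^ m / f(0)`
  obtain ⟨d, hd⟩ : ∃ d : Bˣ, α ^ Module.finrank K L =
      algebraMap A B ((minpoly A α).coeff 0) * d := by
    obtain ⟨d, hd⟩ := algebraMap_coeff_zero_minpoly_associated hf hα
    exact ⟨d, hd.symm⟩
  have hmsub : α ^ m = α ^ (m - Module.finrank K L) * α ^ Module.finrank K L := by
    rw [← pow_add, Nat.sub_add_cancel hnm]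
  let c₀ : ↥(maximalIdeal B ^ (m - Module.finrank K L)) :=
    ⟨α ^ (m - Module.finrank K L) * d, (mem_maximalIdeal_pow_iff hα _ _).mpr (Dvd.intro _ rfl)⟩
  have hc₀ : (c₀ : B) * algebraMap A B ((minpoly A α).coeff 0) = α ^ m := by
    rw [hmsub, hd]
    change α ^ (m - Module.finrank K L) * d * _ = _
    ring
  let η := grEquiv hα i
  let η₀ := grEquiv hα (m - Module.finrank K L)
  have hd0 : residue B (d : B) ≠ 0 := (d.isUnit.map (residue B)).ne_zero
  have hmk : ∀ (z : ↥(maximalIdeal B ^ (m - Module.finrank K L))) (b : B),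
      (z : B) = α ^ (m - Module.finrank K L) * b → Gr.mk z = residue B b • η₀.symm 1 := fun z b hb => by
    rw [grMk_eq_residue_smul hα z hb, grEquiv_symm_one]
  have hc₀mk : Gr.mk c₀ = residue B (d : B) • η₀.symm 1 := hmk c₀ d rfl
  have hη₀1 : η₀.symm 1 ≠ 0 := (map_ne_zero_iff _ η₀.symm.injective).mpr one_ne_zero
  have hc₀0 : Gr.mk c₀ ≠ 0 := hc₀mk ▸ smul_ne_zero hd0 hη₀1
  obtain ⟨ηc, hηc⟩ := exists_equiv_symm_one η₀ hc₀0
  obtain ⟨η', hη'⟩ := exists_equiv_symm_one η₀ (smul_ne_zero hv0 hc₀0)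
  let δ : Gr B i ≃ₗ[ResidueField B] Gr B (m - Module.finrank K L) := η.trans η'.symm
  obtain ⟨T, hT⟩ := exists_traceEquiv (A := A) hcompat hS
  have hN := isAdditivePoly_rootPoly hc hS hi0
  let ν := VecGrp.polyHom η (η.symm 1) (HasSingleBreak.rootPoly B c) hN
  let π := VecGrp.polyHom η (η'.symm 1) (HasSingleBreak.rootPoly B c) hN
  let ιU := VecGrp.pointHom (η.symm 1) (fun σ => residue B (c σ)) hcadd
  let ιQ := ιU.comp (MulEquiv.subgroupCongr hup).toMonoidHom
  let q := vecGrpEquivComponent hf hm hH hc hcompat η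
  have hπι := VecGrp.polyHom_ι η (η'.symm 1) (HasSingleBreak.rootPoly B c) hN
  have hrow : ∀ a, q (π a) =
      redFiberToComponent A K L B α m (redFiberToGr A L B α m (Gr.mk c₀) a) := fun a => by
    have h1 := lineEquiv_polyHom_eq hf hm hH hc hcompat hu η hN (Gr.mk c₀) a
    rw [← hv, ← hη'] at h1
    exact (AlgEquiv.symm_apply_eq _).mpr h1
  have hexQ : IsExactSequence (ResidueField B) (VecGrp (ResidueField B) (Gr B i)) _ ιU π :=
    VecGrp.isExactSequence η η' hcinj (inv_ne_zero hκ) (fun σ => rfl) hπι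
  have hexU : IsExactSequence (ResidueField B) (VecGrp (ResidueField B) (Gr B i)) _ ιU ν :=
    VecGrp.isExactSequence η η hcinj (inv_ne_zero hκ) (fun σ => rfl)
      (VecGrp.polyHom_ι η (η.symm 1) (HasSingleBreak.rootPoly B c) hN)
  have hπinj : Function.Injective π :=
    let _ := (π : VecGrp (ResidueField B) (Gr B (m - Module.finrank K L)) →ₐ[ResidueField B]
      VecGrp (ResidueField B) (Gr B i)).toRingHom.toAlgebra
    hexQ.faithfullyFlat.injective
  refine ⟨m, hmr, ?_, hup, c₀, δ, T, ν, VecGrp (ResidueField B) (Gr B i), inferInstance, inferInstance,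
    q, π, ιQ, ιU, BialgEquiv.refl (ResidueField B) (VecGrp (ResidueField B) (Gr B i)), hc₀, ⟨?_, ?_⟩, ?_, hrow, ?_, hexQ.comp_mulEquiv _, ?_,
    isTraceMap_of_eq_sum hcompat hT hS, isTraceInvNorm_polyHom hcompat hT hS hi0 hc, ?_,
    hexU, fun σ h h' a => rfl, ?_⟩
  · have h1 := (IsDiscreteValuationRing.addVal_eq_iff_associated _ _).mpr
      (aeval_derivative_mul_pow_associated hf hm hH)
    rw [AddValuation.map_mul, AddValuation.map_pow, AddValuation.map_pow,
      IsDiscreteValuationRing.addVal_uniformizer hα] at h1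
    simpa using h1.symm
  · rw [injective_iff_map_eq_zero]
    intro a ha
    have h1 := hrow a
    rw [ha, map_zero, map_eq_zero_iff q q.injective] at h1
    exact (map_eq_zero_iff π hπinj).mp h1
  · rw [← hηc]
    exact redFiberToGr_surjective hf hH hm0 ηc
  · intro y
    obtain ⟨b, hb⟩ := (mem_maximalIdeal_pow_iff hα i _).mp y.2
    refine ⟨(v * b) • c₀, ?_, ?_⟩
    · change v * b * (c₀ : B) * _ = _
      rw [mul_assoc, hc₀, hb]
      linear_combination -b * hderiv
    · rw [grMk_eq_residue_smul hα y hb, ← grEquiv_symm_one, map_smul]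
      change residue B b • η'.symm (η (η.symm 1)) = _
      rw [LinearEquiv.apply_symm_apply, hη', smul_smul, ← map_mul, residue_smul_grMk, mul_comm]
  · exact fun σ a => point_vecGrpEquivComponent_symm_mk hf hm hH hc hcompat η
      (MulEquiv.subgroupCongr hup σ) a
  · intro Q' _ _ q' π' hπ' hcounit
    obtain ⟨g, hg⟩ := VecGrp.exists_bialgEquiv η η' hcinj hcadd (inv_ne_zero hκ) hπι (q'.trans q.symm) π'
      (fun a => by rw [AlgEquiv.trans_apply, AlgEquiv.symm_apply_eq, hπ', hrow])
      (fun a => by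
        obtain ⟨x, hx⟩ := Ideal.Quotient.mk_surjective (q a)
        have h1 : (q'.trans q.symm).symm a = q'.symm (q a) := rfl
        have h2 : a = q.symm (Ideal.Quotient.mk _ x) := (AlgEquiv.eq_symm_apply q).mpr hx.symm
        rw [h1, ← hx, hcounit, h2]
        exact (counit_vecGrpEquivComponent_symm_mk hf hm hH hc hcompat η x).symm)
    exact ⟨g, fun a => (congrArg q (hg a)).trans (q.apply_symm_apply _)⟩
  · intro σ
    refine ⟨⟨α ^ i * c σ, (mem_maximalIdeal_pow_iff hα i _).mpr (Dvd.intro _ rfl)⟩, ?_, ?_⟩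
    · rw [← hcompat]
      refine congrArg _ ((hc σ).trans ?_)
      ring
    · rw [VecGrp.pointHom_ofConv, grMk_eq_residue_smul hα _ rfl, grEquiv_symm_one]
  · exact fun a => polyHom_comp_map η η' _ hN a
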